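/- **Definitions.** Write $\mathbb K(H,H')$ for the compact operators between complex Hilbert spaces and $\mathbb K(H)=\mathbb K(H,H)$. A *DD-bundle* over a space $X$ is a locally trivial bundle $\mathcal A\to X$ of $C^*$-algebras with typical fibre $\mathbb K(H)$, where $H\neq 0$ is a separable complex Hilbert space (its dimension, finite or infinite, may vary from one connected component to another), and structure group $\operatorname{Aut}\mathbb K(H)=PU(H)$ in the strong topology. A *Morita isomorphism* $\mathcal E\colon\mathcal A_1\dashrightarrow\mathcal A_2$ is a locally trivial bundle of Banach spaces with a fibrewise $(\mathcal A_2,\mathcal A_1)$-bimodule structure that is locally isomorphic to $\mathbb K(H_1,H_2)$ with post- and pre-composition of operators, where $\mathbb K(H_i)$ is the typical fibre of $\mathcal A_i$. The composition of $\mathcal E_1\colon\mathcal A_1\dashrightarrow\mathcal A_2$ and $\mathcal E_2\colon\mathcal A_2\dashrightarrow\mathcal A_3$ is $\mathcal E_2\circ\mathcal E_1=\mathcal E_2\otimes_{\mathcal A_2}\mathcal E_1$, the fibrewise completion of the algebraic tensor product (in the norm for which, in local trivializations, $\|\sum_i f_i\otimes e_i\|$ is the operator norm of $\sum_i f_i e_i$),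 and the identity of $\mathcal A$ is $\mathcal A$ itself. A *2-isomorphism* $\mathcal E\Rightarrow\mathcal E'$ is a continuous bundle isomorphism that preserves the norms and the bimodule structures. With the canonical associativity and unit isomorphisms of tensor products, these are the objects, 1-arrows and 2-arrows of a bicategory $\mathfrak X(X)$, and a continuous map $f\colon Y\to X$ induces a pullback pseudofunctor $f^*\colon\mathfrak X(X)\to\mathfrak X(Y)$; so $\mathfrak X$ is a presheaf of bicategories over manifolds. Let $\{U_i\}_{i\in I}$ be an open cover of a manifold $M$, let $U_k=\bigsqcup_{i_0,\dots,i_k}U_{i_0}\cap\dots\cap U_{i_k}$, let $\pi\colon U_0\to M$ be the projection, and let a subscript such as $01$ or $012$ denote the pullback along the projection $U_k\to U_m$ that keeps the indicated indices. The *descent bicategory* $\mathfrak X(U_\bullet)$ is the following. * Objects are triples $(\mathcal A,\mathcal E,\tau)$ with $\mathcal A\in\mathfrak X(U_0)$, a 1-arrow $\mathcal E\colon\mathcal A_0\to\mathcal A_1$ over $U_1$, and a 2-arrow $\tau\colon\mathcal E_{12}\circ\mathcal E_{01}\Rightarrow\mathcal E_{02}$ over $U_2$ such that over $U_3$ $$\tau_{023}\circ(\mathrm{id}\star\tau_{012})=\tau_{013}\circ(\tau_{123}\star\mathrm{id})\colon\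 \mathcal E_{23}\circ\mathcal E_{12}\circ\mathcal E_{01}\Rightarrow\mathcal E_{03}.$$ * 1-arrows $(\mathcal A,\mathcal E,\tau)\to(\mathcal A',\mathcal E',\tau')$ are pairs $(\mathcal F,\alpha)$ of a 1-arrow $\mathcal F\colon\mathcal A\to\mathcal A'$ over $U_0$ and a 2-arrow $\alpha\colon\mathcal E'\circ\mathcal F_0\Rightarrow\mathcal F_1\circ\mathcal E$ over $U_1$ such that over $U_2$ $$(\mathrm{id}\star\tau)\circ(\alpha_{12}\star\mathrm{id})\circ(\mathrm{id}\star\alpha_{01})=\alpha_{02}\circ(\tau'\star\mathrm{id}).$$ * 2-arrows $(\mathcal F,\alpha)\Rightarrow(\mathcal F',\alpha')$ are 2-arrows $\beta\colon\mathcal F\Rightarrow\mathcal F'$ over $U_0$ such that over $U_1$ $$\alpha'\circ(\mathrm{id}\star\beta_0)=(\beta_1\star\mathrm{id})\circ\alpha .$$ The restriction pseudofunctor $\pi^*\colon\mathfrak X(M)\to\mathfrak X(U_\bullet)$ sends $\mathcal A$ to $\pi^*\mathcal A$ with the identity 1-arrow and the canonical 2-arrow $\mathrm{id}\circ\mathrm{id}\Rightarrow\mathrm{id}$,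 sends $\mathcal E$ to $\pi^*\mathcal E$ with the canonical 2-arrow, and sends $\tau$ to $\pi^*\tau$. **Theorem.** The presheaf of bicategories $\mathfrak X$ of DD-bundles, Morita isomorphisms and 2-isomorphisms is a 2-stack over manifolds: for every smooth manifold $M$ (finite-dimensional, Hausdorff, second countable) and every open cover $\{U_i\}$ of $M$, the restriction pseudofunctor $\pi^*\colon\mathfrak X(M)\to\mathfrak X(U_\bullet)$ is an equivalence of bicategories, that is, it induces equivalences between the categories of 1-arrows and every object of $\mathfrak X(U_\bullet)$ is equivalent to $\pi^*\mathcal B$ for some DD-bundle $\mathcal B$ over $M$. -/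

import Mathlib

/-!
# Dixmier-Douady bundles, Morita isomorphisms and descent
-/

universe u v

set_option linter.unusedSectionVars false
set_option linter.unusedSimpArgs false

noncomputable section

namespace DixmierDouady

open CategoryTheory Bicategory TopologicalSpace UniformSpace Topology
open scoped TensorProduct

section Operators
variable {H K L : Type*} [NormedAddCommGroup H] [InnerProductSpace ℂ H]
  [NormedAddCommGroup K] [InnerProductSpace ℂ K] [NormedAddCommGroup L] [InnerProductSpace ℂ L]

theorem isCompactOperator_rankOne (x : K) (y : H) :
    IsCompactOperator (InnerProductSpace.rankOne ℂ x y) := by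
  exact (isCompactOperator_of_locallyCompactSpace_dom (innerSL ℂ y)).clm_comp
    (ContinuousLinearMap.toSpanSingleton ℂ x)

/-- Compact operators are norm limits of sums of products of compact operators through a nonzero
Hilbert space. -/
theorem exists_approx (T : H →L[ℂ] L) (hT : IsCompactOperator T) [Nontrivial K] {r : ℝ}
    (hr : 0 < r) : ∃ (n : ℕ) (S : Fin n → K →L[ℂ] L) (R : Fin n → H →L[ℂ] K),
      (∀ i, IsCompactOperator (S i)) ∧ (∀ i, IsCompactOperator (R i)) ∧
      ‖T - ∑ i, S i ∘L R i‖ ≤ r := by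
  obtain ⟨w, hw⟩ := exists_norm_eq K (zero_le_one (α := ℝ))
  obtain ⟨Q, hQ, hTQ⟩ := hT.image_closedBall_subset_compact (1 : ℝ) (f := (T : H →ₗ[ℂ] L))
  obtain ⟨t, -, htf, ht⟩ := hQ.finite_cover_balls hr
  let V : Submodule ℂ L := Submodule.span ℂ t
  have : FiniteDimensional ℂ V := FiniteDimensional.span_of_finite ℂ htf
  let b := stdOrthonormalBasis ℂ V
  refine ⟨_, fun i => InnerProductSpace.rankOne ℂ (b i : L) w,
    fun i => InnerProductSpace.rankOne ℂ w (b i : L) ∘L T,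
    fun i => isCompactOperator_rankOne _ _,
    fun i => (isCompactOperator_rankOne w (b i : L)).comp_clm T, ?_⟩
  have key : ∑ i, InnerProductSpace.rankOne ℂ (b i : L) w ∘L
      (InnerProductSpace.rankOne ℂ w (b i : L) ∘L T) = V.starProjection ∘L T := by
    rw [b.starProjection_eq_sum_rankOne]
    ext x
    simp [hw]
  rw [key]
  refine ContinuousLinearMap.opNorm_le_of_unit_norm hr.le fun x hx => ?_
  have hx' : T x ∈ Q := hTQ ⟨x, by simp [hx], rfl⟩
  obtain ⟨y, hy, hxy⟩ := Set.mem_iUnion₂.1 (ht hx')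
  have hyV : y ∈ V := Submodule.subset_span hy
  calc ‖(T - V.starProjection ∘L T) x‖ = ‖T x - V.starProjection (T x)‖ := rfl
    _ ≤ ‖T x - y‖ := by
        rw [Submodule.starProjection_minimal]
        exact ciInf_le ⟨0, by rintro _ ⟨z, rfl⟩; exact norm_nonneg _⟩ (⟨y, hyV⟩ : V)
    _ ≤ r := by rw [← dist_eq_norm]; exact (Metric.mem_ball.1 hxy).le

end Operators

section Charts
variable {A B C E F : Type*} [NonUnitalCStarAlgebra A] [NonUnitalCStarAlgebra B]
  [NonUnitalCStarAlgebra C]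
  [NormedAddCommGroup E] [NormedSpace ℂ E] [NormedAddCommGroup F] [NormedSpace ℂ F]
  {H K L : Type*} [NormedAddCommGroup H] [InnerProductSpace ℂ H] [CompleteSpace H]
  [NormedAddCommGroup K] [InnerProductSpace ℂ K] [CompleteSpace K]
  [NormedAddCommGroup L] [InnerProductSpace ℂ L] [CompleteSpace L]

/-- `φ` is an isomorphism of `C⋆`-algebras of `A` onto the compact operators on `H`. -/
structure IsAlgChart (φ : A →ₗ[ℂ] (H →L[ℂ] H)) : Prop where
  norm_map : ∀ a, ‖φ a‖ = ‖a‖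
  map_mul : ∀ a b, φ (a * b) = φ a ∘L φ b
  map_star : ∀ a, φ (star a) = ContinuousLinearMap.adjoint (φ a)
  range_eq : Set.range φ = {T : H →L[ℂ] H | IsCompactOperator T}

/-- `ψ` is an isometric isomorphism of `E` onto the compact operators from `H` to `K` that
intertwines the left action `l` of `B` and the right action `r` of `A` on `E` with post- and
pre-composition, where `A` and `B` act through `φA` and `φB`. -/
structure IsModChart (φA : A →ₗ[ℂ] (H →L[ℂ] H)) (φB : B →ₗ[ℂ] (K →L[ℂ] K))
    (l : B → E →ₗ[ℂ] E) (r : A → E →ₗ[ℂ] E) (ψ : E →ₗ[ℂ] (H →L[ℂ] K)) : Prop where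
  norm_map : ∀ e, ‖ψ e‖ = ‖e‖
  range_eq : Set.range ψ = {T : H →L[ℂ] K | IsCompactOperator T}
  map_left : ∀ b e, ψ (l b e) = φB b ∘L ψ e
  map_right : ∀ a e, ψ (r a e) = ψ e ∘L φA a

variable {φA : A →ₗ[ℂ] (H →L[ℂ] H)} {φB : B →ₗ[ℂ] (K →L[ℂ] K)} {φC : C →ₗ[ℂ] (L →L[ℂ] L)}
  {l : B → E →ₗ[ℂ] E} {r : A → E →ₗ[ℂ] E} {ψ : E →ₗ[ℂ] (H →L[ℂ] K)}
  {l' : C → F →ₗ[ℂ] F} {r' : B → F →ₗ[ℂ] F} {ψ' : F →ₗ[ℂ] (K →L[ℂ] L)}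

theorem inj_of_norm_map {E G : Type*} [NormedAddCommGroup E] [NormedSpace ℂ E]
    [NormedAddCommGroup G] [NormedSpace ℂ G] {ψ : E →ₗ[ℂ] G} (h : ∀ e, ‖ψ e‖ = ‖e‖) {x y : E}
    (hxy : ψ x = ψ y) : x = y := by
  rw [← sub_eq_zero, ← norm_eq_zero, ← h, map_sub, hxy, sub_self, norm_zero]

theorem IsAlgChart.exists_eq (h : IsAlgChart φA) {T : H →L[ℂ] H} (hT : IsCompactOperator T) :
    ∃ a, φA a = T := by
  have : T ∈ Set.range φA := by rw [h.range_eq]; exact hT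
  exact this

theorem IsModChart.exists_eq (h : IsModChart φA φB l r ψ) {T : H →L[ℂ] K}
    (hT : IsCompactOperator T) : ∃ e, ψ e = T := by
  have : T ∈ Set.range ψ := by rw [h.range_eq]; exact hT
  exact this

theorem IsModChart.compact (h : IsModChart φA φB l r ψ) (e : E) : IsCompactOperator (ψ e) := by
  have : ψ e ∈ Set.range ψ := ⟨e, rfl⟩
  rw [h.range_eq] at this; exact this

/-- A homomorphism of bimodules between copies of the compact operators is a scalar. -/
theorem schur [Nontrivial H] [Nontrivial K] (hA : IsAlgChart φA) (hB : IsAlgChart φB)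
    (hψ : IsModChart φA φB l r ψ) (f : E →ₗ[ℂ] (H →L[ℂ] K))
    (hl : ∀ b e, f (l b e) = φB b ∘L f e) (hr : ∀ a e, f (r a e) = f e ∘L φA a) :
    ∃ c : ℂ, ∀ e, f e = c • ψ e := by
  obtain ⟨p, hp⟩ := exists_norm_eq H (zero_le_one (α := ℝ))
  obtain ⟨q, hq⟩ := exists_norm_eq K (zero_le_one (α := ℝ))
  obtain ⟨e₀, he₀⟩ := hψ.exists_eq (isCompactOperator_rankOne q p)
  obtain ⟨a, ha⟩ := hA.exists_eq (isCompactOperator_rankOne p p)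
  obtain ⟨b, hb⟩ := hB.exists_eq (isCompactOperator_rankOne q q)
  have h1 : l b e₀ = e₀ := inj_of_norm_map hψ.norm_map (by
    rw [hψ.map_left, he₀, hb]; ext x; simp [hq])
  have h2 : r a e₀ = e₀ := inj_of_norm_map hψ.norm_map (by
    rw [hψ.map_right, he₀, ha]; ext x; simp [hp])
  refine ⟨inner ℂ q (f e₀ p), fun e => ?_⟩
  ext v
  obtain ⟨av, hav⟩ := hA.exists_eq (isCompactOperator_rankOne v p)
  obtain ⟨b', hb'⟩ := hB.exists_eq (isCompactOperator_rankOne (ψ e v) q)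
  have h3 : r av e = l b' e₀ := inj_of_norm_map hψ.norm_map (by
    rw [hψ.map_right, hψ.map_left, he₀, hav, hb']; ext x; simp [hq])
  have h4 := congrArg (fun T => T p) (congrArg f h3)
  simp only [hr, hl, hav, hb', ContinuousLinearMap.comp_apply, InnerProductSpace.rankOne_apply,
    inner_self_eq_norm_sq_to_K, hp] at h4
  simpa using h4

/-- The bilinear map `(x, y) ↦ ψ' x ∘ ψ y`, on the algebraic tensor product. -/
def compMap (ψ' : F →ₗ[ℂ] (K →L[ℂ] L)) (ψ : E →ₗ[ℂ] (H →L[ℂ] K)) :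
    F ⊗[ℂ] E →ₗ[ℂ] (H →L[ℂ] L) :=
  TensorProduct.lift (LinearMap.mk₂ ℂ (fun x y => ψ' x ∘L ψ y)
    (fun x x' y => by simp) (fun c x y => by simp) (fun x y y' => by simp)
    (fun c x y => by simp))

@[simp] theorem compMap_tmul (ψ' : F →ₗ[ℂ] (K →L[ℂ] L)) (ψ : E →ₗ[ℂ] (H →L[ℂ] K)) (x : F)
    (y : E) : compMap ψ' ψ (x ⊗ₜ y) = ψ' x ∘L ψ y := rfl

/-- The norm of `compMap ψ' ψ t` does not depend on the charts. -/
theorem norm_compMap_le {H₂ K₂ L₂ : Type*} [NormedAddCommGroup H₂] [InnerProductSpace ℂ H₂]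
    [CompleteSpace H₂] [NormedAddCommGroup K₂] [InnerProductSpace ℂ K₂] [CompleteSpace K₂]
    [NormedAddCommGroup L₂] [InnerProductSpace ℂ L₂] [CompleteSpace L₂]
    [Nontrivial K] [Nontrivial K₂]
    {φA₂ : A →ₗ[ℂ] (H₂ →L[ℂ] H₂)} {φB₂ : B →ₗ[ℂ] (K₂ →L[ℂ] K₂)} {φC₂ : C →ₗ[ℂ] (L₂ →L[ℂ] L₂)}
    {ψ₂ : E →ₗ[ℂ] (H₂ →L[ℂ] K₂)} {ψ₂' : F →ₗ[ℂ] (K₂ →L[ℂ] L₂)}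
    (hB : IsAlgChart φB) (hE : IsModChart φA φB l r ψ) (hF : IsModChart φB φC l' r' ψ')
    (hB₂ : IsAlgChart φB₂) (hE₂ : IsModChart φA₂ φB₂ l r ψ₂)
    (hF₂ : IsModChart φB₂ φC₂ l' r' ψ₂') (t : F ⊗[ℂ] E) :
    ‖compMap ψ₂' ψ₂ t‖ ≤ ‖compMap ψ' ψ t‖ := by
  obtain ⟨n, x, y, rfl⟩ := TensorProduct.exists_sum_tmul_eq t
  obtain ⟨w, hw⟩ := exists_norm_eq K (zero_le_one (α := ℝ))
  obtain ⟨e', he'⟩ := exists_norm_eq K₂ (zero_le_one (α := ℝ))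
  set T := compMap ψ' ψ (∑ j, x j ⊗ₜ y j) with hT
  refine ContinuousLinearMap.opNorm_le_bound _ (norm_nonneg _) fun v => ?_
  choose f hf using fun z => hB₂.exists_eq
    (T := ψ₂ z ∘L InnerProductSpace.rankOne ℂ v e') ((hE₂.compact z).comp_clm (InnerProductSpace.rankOne ℂ v e'))
  have hfn : ∀ z, ‖f z‖ ≤ ‖z‖ * ‖v‖ := fun z => by
    rw [← hB₂.norm_map, hf, ← hE₂.norm_map z]
    refine (ContinuousLinearMap.opNorm_comp_le _ _).trans ?_
    rw [InnerProductSpace.norm_rankOne, he', mul_one]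
  set z := ∑ j, r' (f (y j)) (x j) with hz
  have hz₂ : ψ₂' z = compMap ψ₂' ψ₂ (∑ j, x j ⊗ₜ y j) ∘L InnerProductSpace.rankOne ℂ v e' := by
    rw [hz, map_sum, map_sum]
    ext k
    simp [hF₂.map_right, hf, Finset.smul_sum]
  have hS : ‖ψ' z‖ ≤ ‖v‖ * ‖T‖ := by
    refine ContinuousLinearMap.opNorm_le_bound _ (by positivity) fun k => ?_
    rcases eq_or_ne (ψ' z k) 0 with h0 | h0
    · rw [h0, norm_zero]; positivity
    obtain ⟨u, hu⟩ : ∃ u, u = ψ' z k := ⟨_, rfl⟩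
    choose b hb using fun j => hB.exists_eq
      (T := InnerProductSpace.rankOne ℂ w u ∘L ψ' (x j)) ((hF.compact (x j)).clm_comp (InnerProductSpace.rankOne ℂ w u))
    set y' := ∑ j, l (b j) (y j) with hy'
    have h1 : ψ y' = InnerProductSpace.rankOne ℂ w u ∘L T := by
      rw [hy', hT, map_sum, map_sum]
      ext k
      simp [hE.map_left, hb]
    have h2 : f y' = ∑ j, b j * f (y j) := inj_of_norm_map hB₂.norm_map (by
      rw [hf, hy', map_sum, map_sum]
      ext k
      simp [hE₂.map_left, hB₂.map_mul, hf, Finset.smul_sum])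
    have h3 : φB (f y') = InnerProductSpace.rankOne ℂ w u ∘L ψ' z := by
      rw [h2, hz, map_sum, map_sum]
      ext k
      simp [hB.map_mul, hb, hF.map_right]
    rw [hu] at h1 h3
    have h4 : ‖φB (f y')‖ ≤ ‖ψ' z k‖ * ‖T‖ * ‖v‖ := by
      rw [hB.norm_map]
      refine (hfn y').trans ?_
      gcongr
      rw [← hE.norm_map, h1]
      refine (ContinuousLinearMap.opNorm_comp_le _ _).trans ?_
      rw [InnerProductSpace.norm_rankOne, hw, one_mul]
    have h5 := (φB (f y')).le_opNorm k
    have h6 : ‖φB (f y') k‖ = ‖ψ' z k‖ * ‖ψ' z k‖ := by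
      rw [h3]
      simp [norm_smul, hw, ← sq]
    rw [h6] at h5
    have h7 : 0 < ‖ψ' z k‖ := norm_pos_iff.2 h0
    have h8 : ‖ψ' z k‖ * ‖ψ' z k‖ ≤ ‖ψ' z k‖ * (‖v‖ * ‖T‖ * ‖k‖) := by
      refine h5.trans ?_
      calc _ ≤ (‖ψ' z k‖ * ‖T‖ * ‖v‖) * ‖k‖ := by gcongr
        _ = _ := by ring
    exact le_of_mul_le_mul_left h8 h7
  have h9 : compMap ψ₂' ψ₂ (∑ j, x j ⊗ₜ y j) v = ψ₂' z e' := by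
    rw [hz₂]; simp [he']
  rw [h9]
  calc ‖ψ₂' z e'‖ ≤ ‖ψ₂' z‖ * ‖e'‖ := ContinuousLinearMap.le_opNorm _ _
    _ = ‖ψ' z‖ := by rw [he', mul_one, hF₂.norm_map, hF.norm_map]
    _ ≤ ‖T‖ * ‖v‖ := by rw [mul_comm]; exact hS

theorem compact_compMap (hF : IsModChart φB φC l' r' ψ') (t : F ⊗[ℂ] E) :
    IsCompactOperator (compMap ψ' ψ t) := by
  induction t with
  | zero => rw [map_zero]; exact isCompactOperator_zero
  | tmul x y => exact (hF.compact x).comp_clm (ψ y)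
  | add s t hs ht => rw [map_add]; exact hs.add ht

/-- The algebraic tensor product `F ⊗ E`, with the seminorm that gives `∑ xᵢ ⊗ yᵢ` the operator
norm of `∑ ψ' xᵢ ∘ ψ yᵢ`. Elements `x b ⊗ y - x ⊗ b y` have seminorm zero. -/
def PreTensor (_ : F →ₗ[ℂ] (K →L[ℂ] L)) (_ : E →ₗ[ℂ] (H →L[ℂ] K)) : Type _ := F ⊗[ℂ] E

instance (ψ' : F →ₗ[ℂ] (K →L[ℂ] L)) (ψ : E →ₗ[ℂ] (H →L[ℂ] K)) :
    AddCommGroup (PreTensor ψ' ψ) := inferInstanceAs (AddCommGroup (F ⊗[ℂ] E))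

instance (ψ' : F →ₗ[ℂ] (K →L[ℂ] L)) (ψ : E →ₗ[ℂ] (H →L[ℂ] K)) :
    Module ℂ (PreTensor ψ' ψ) := inferInstanceAs (Module ℂ (F ⊗[ℂ] E))

instance (ψ' : F →ₗ[ℂ] (K →L[ℂ] L)) (ψ : E →ₗ[ℂ] (H →L[ℂ] K)) :
    SeminormedAddCommGroup (PreTensor ψ' ψ) :=
  SeminormedAddCommGroup.induced (PreTensor ψ' ψ) (H →L[ℂ] L)
    (show PreTensor ψ' ψ →ₗ[ℂ] (H →L[ℂ] L) from compMap ψ' ψ)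

instance (ψ' : F →ₗ[ℂ] (K →L[ℂ] L)) (ψ : E →ₗ[ℂ] (H →L[ℂ] K)) :
    NormedSpace ℂ (PreTensor ψ' ψ) :=
  NormedSpace.induced ℂ (PreTensor ψ' ψ) (H →L[ℂ] L)
    (show PreTensor ψ' ψ →ₗ[ℂ] (H →L[ℂ] L) from compMap ψ' ψ)

/-- The completed tensor product of `F` and `E` over the algebra between them. -/
abbrev CTensor (ψ' : F →ₗ[ℂ] (K →L[ℂ] L)) (ψ : E →ₗ[ℂ] (H →L[ℂ] K)) : Type _ :=
  Completion (PreTensor ψ' ψ)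

namespace CTensor

/-- The canonical map from the algebraic to the completed tensor product. -/
def mk (ψ' : F →ₗ[ℂ] (K →L[ℂ] L)) (ψ : E →ₗ[ℂ] (H →L[ℂ] K)) : F ⊗[ℂ] E →ₗ[ℂ] CTensor ψ' ψ :=
  (Completion.toComplₗᵢ : PreTensor ψ' ψ →ₗᵢ[ℂ] Completion (PreTensor ψ' ψ)).toLinearMap

theorem norm_mk (t : F ⊗[ℂ] E) : ‖mk ψ' ψ t‖ = ‖compMap ψ' ψ t‖ :=
  Completion.norm_coe (E := PreTensor ψ' ψ) t

theorem denseRange_mk : DenseRange (mk ψ' ψ) :=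
  Completion.denseRange_coe (α := PreTensor ψ' ψ)

variable {G : Type*} [NormedAddCommGroup G] [NormedSpace ℂ G] [CompleteSpace G]

/-- The continuous extension of a linear map from the algebraic to the completed tensor product. -/
def extend (ψ' : F →ₗ[ℂ] (K →L[ℂ] L)) (ψ : E →ₗ[ℂ] (H →L[ℂ] K)) (f : F ⊗[ℂ] E →ₗ[ℂ] G) :
    CTensor ψ' ψ →L[ℂ] G := f.extendOfNorm (mk ψ' ψ)

theorem extend_mk {f : F ⊗[ℂ] E →ₗ[ℂ] G} {c : ℝ} (h : ∀ t, ‖f t‖ ≤ c * ‖compMap ψ' ψ t‖)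
    (t : F ⊗[ℂ] E) : extend ψ' ψ f (mk ψ' ψ t) = f t :=
  LinearMap.extendOfNorm_eq denseRange_mk ⟨c, fun t => by rw [norm_mk]; exact h t⟩ t

theorem norm_extend {f : F ⊗[ℂ] E →ₗ[ℂ] G} (h : ∀ t, ‖f t‖ = ‖compMap ψ' ψ t‖)
    (c : CTensor ψ' ψ) : ‖extend ψ' ψ f c‖ = ‖c‖ := by
  refine denseRange_mk.induction_on c (isClosed_eq (by fun_prop) (by fun_prop)) fun t => ?_
  rw [extend_mk (c := 1) (fun t => by rw [h, one_mul]), norm_mk, h]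

/-- The left action `c (x ⊗ y) = (c x) ⊗ y`. -/
def left (ψ' : F →ₗ[ℂ] (K →L[ℂ] L)) (ψ : E →ₗ[ℂ] (H →L[ℂ] K)) (l' : C → F →ₗ[ℂ] F) (c : C) :
    CTensor ψ' ψ →ₗ[ℂ] CTensor ψ' ψ :=
  (extend ψ' ψ (mk ψ' ψ ∘ₗ (l' c).rTensor E)).toLinearMap

/-- The right action `(x ⊗ y) a = x ⊗ (y a)`. -/
def right (ψ' : F →ₗ[ℂ] (K →L[ℂ] L)) (ψ : E →ₗ[ℂ] (H →L[ℂ] K)) (r : A → E →ₗ[ℂ] E) (a : A) :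
    CTensor ψ' ψ →ₗ[ℂ] CTensor ψ' ψ :=
  (extend ψ' ψ (mk ψ' ψ ∘ₗ (r a).lTensor F)).toLinearMap

theorem compMap_left (hF : IsModChart φB φC l' r' ψ') (c : C) (t : F ⊗[ℂ] E) :
    compMap ψ' ψ ((l' c).rTensor E t) = φC c ∘L compMap ψ' ψ t := by
  induction t with
  | zero => simp
  | tmul x y => simp [hF.map_left, ContinuousLinearMap.comp_assoc]
  | add s t hs ht => simp [hs, ht]

theorem compMap_right (hE : IsModChart φA φB l r ψ) (a : A) (t : F ⊗[ℂ] E) :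
    compMap ψ' ψ ((r a).lTensor F t) = compMap ψ' ψ t ∘L φA a := by
  induction t with
  | zero => simp
  | tmul x y => simp [hE.map_right, ContinuousLinearMap.comp_assoc]
  | add s t hs ht => simp [hs, ht]

theorem left_mk (hF : IsModChart φB φC l' r' ψ') (c : C) (t : F ⊗[ℂ] E) :
    left ψ' ψ l' c (mk ψ' ψ t) = mk ψ' ψ ((l' c).rTensor E t) :=
  extend_mk (c := ‖φC c‖) (fun t => by
    rw [LinearMap.comp_apply, norm_mk, compMap_left hF]
    exact ContinuousLinearMap.opNorm_comp_le _ _) t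

theorem right_mk (hE : IsModChart φA φB l r ψ) (a : A) (t : F ⊗[ℂ] E) :
    right ψ' ψ r a (mk ψ' ψ t) = mk ψ' ψ ((r a).lTensor F t) :=
  extend_mk (c := ‖φA a‖) (fun t => by
    rw [LinearMap.comp_apply, norm_mk, compMap_right hE, mul_comm]
    exact ContinuousLinearMap.opNorm_comp_le _ _) t

/-- The chart `x ⊗ y ↦ ψ₂' x ∘ ψ₂ y` of the completed tensor product. -/
def chart (ψ' : F →ₗ[ℂ] (K →L[ℂ] L)) (ψ : E →ₗ[ℂ] (H →L[ℂ] K))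
    {H₂ K₂ L₂ : Type*} [NormedAddCommGroup H₂] [InnerProductSpace ℂ H₂]
    [NormedAddCommGroup K₂] [InnerProductSpace ℂ K₂]
    [NormedAddCommGroup L₂] [InnerProductSpace ℂ L₂] [CompleteSpace L₂]
    (ψ₂' : F →ₗ[ℂ] (K₂ →L[ℂ] L₂)) (ψ₂ : E →ₗ[ℂ] (H₂ →L[ℂ] K₂)) :
    CTensor ψ' ψ →ₗ[ℂ] (H₂ →L[ℂ] L₂) :=
  (extend ψ' ψ (compMap ψ₂' ψ₂)).toLinearMap

section
variable {H₂ K₂ L₂ : Type*} [NormedAddCommGroup H₂] [InnerProductSpace ℂ H₂]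
    [CompleteSpace H₂] [NormedAddCommGroup K₂] [InnerProductSpace ℂ K₂] [CompleteSpace K₂]
    [NormedAddCommGroup L₂] [InnerProductSpace ℂ L₂] [CompleteSpace L₂]
    [Nontrivial K] [Nontrivial K₂]
    {φA₂ : A →ₗ[ℂ] (H₂ →L[ℂ] H₂)} {φB₂ : B →ₗ[ℂ] (K₂ →L[ℂ] K₂)} {φC₂ : C →ₗ[ℂ] (L₂ →L[ℂ] L₂)}
    {ψ₂ : E →ₗ[ℂ] (H₂ →L[ℂ] K₂)} {ψ₂' : F →ₗ[ℂ] (K₂ →L[ℂ] L₂)}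

theorem chart_mk (hB : IsAlgChart φB) (hE : IsModChart φA φB l r ψ)
    (hF : IsModChart φB φC l' r' ψ') (hB₂ : IsAlgChart φB₂) (hE₂ : IsModChart φA₂ φB₂ l r ψ₂)
    (hF₂ : IsModChart φB₂ φC₂ l' r' ψ₂') (t : F ⊗[ℂ] E) : chart ψ' ψ ψ₂' ψ₂ (mk ψ' ψ t) = compMap ψ₂' ψ₂ t :=
  extend_mk (c := 1) (fun t => by
    rw [one_mul]; exact norm_compMap_le hB hE hF hB₂ hE₂ hF₂ t) t

theorem isModChart (hB : IsAlgChart φB) (hE : IsModChart φA φB l r ψ)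
    (hF : IsModChart φB φC l' r' ψ') (hB₂ : IsAlgChart φB₂) (hE₂ : IsModChart φA₂ φB₂ l r ψ₂)
    (hF₂ : IsModChart φB₂ φC₂ l' r' ψ₂') :
    IsModChart φA₂ φC₂ (left ψ' ψ l') (right ψ' ψ r) (chart ψ' ψ ψ₂' ψ₂) := by
  have hn : ∀ c, ‖chart ψ' ψ ψ₂' ψ₂ c‖ = ‖c‖ := norm_extend fun t =>
    le_antisymm (norm_compMap_le hB hE hF hB₂ hE₂ hF₂ t) (norm_compMap_le hB₂ hE₂ hF₂ hB hE hF t)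
  have hc : Continuous (chart ψ' ψ ψ₂' ψ₂) := (extend ψ' ψ (compMap ψ₂' ψ₂)).continuous
  have hmk := chart_mk hB hE hF hB₂ hE₂ hF₂
  have hL : ∀ c, Continuous (left ψ' ψ l' c) := fun c => ContinuousLinearMap.continuous _
  have hR : ∀ a, Continuous (right ψ' ψ r a) := fun a => ContinuousLinearMap.continuous _
  refine ⟨hn, ?_, fun c z => ?_, fun a z => ?_⟩
  · apply Set.Subset.antisymm
    · rintro _ ⟨z, rfl⟩
      refine denseRange_mk.induction_on (p := fun z => IsCompactOperator (chart ψ' ψ ψ₂' ψ₂ z)) z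
        (isClosed_setOfPred_isCompactOperator.preimage hc) fun t => ?_
      rw [hmk]
      exact compact_compMap hF₂ t
    · intro T hT
      have hiso : Isometry (chart ψ' ψ ψ₂' ψ₂) :=
        AddMonoidHomClass.isometry_of_norm _ hn
      rw [← hiso.isClosedEmbedding.isClosed_range.closure_eq, Metric.mem_closure_iff]
      intro e he
      obtain ⟨n, S, R, hS, hR, hT⟩ := exists_approx (K := K₂) T hT (half_pos he)
      choose x hx using fun i => hF₂.exists_eq (hS i)
      choose y hy using fun i => hE₂.exists_eq (hR i)
      refine ⟨_, ⟨mk ψ' ψ (∑ i, x i ⊗ₜ y i), rfl⟩, ?_⟩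
      rw [hmk, dist_eq_norm, map_sum]
      simp only [compMap_tmul, hx, hy]
      exact hT.trans_lt (half_lt_self he)
  · refine denseRange_mk.induction_on (p := fun z => chart ψ' ψ ψ₂' ψ₂ (left ψ' ψ l' c z) =
      φC₂ c ∘L chart ψ' ψ ψ₂' ψ₂ z) z (isClosed_eq (hc.comp (hL c)) (by fun_prop)) fun t => ?_
    rw [left_mk hF, hmk, hmk, compMap_left hF₂]
  · refine denseRange_mk.induction_on (p := fun z => chart ψ' ψ ψ₂' ψ₂ (right ψ' ψ r a z) =
      chart ψ' ψ ψ₂' ψ₂ z ∘L φA₂ a) z (isClosed_eq (hc.comp (hR a)) (by fun_prop)) fun t => ?_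
    rw [right_mk hE, hmk, hmk, compMap_right hE₂]

end

end CTensor

end Charts

section Continuity

/-- Continuity in one family of charts implies continuity in another one, also for sections over
a space mapping to the base, if this holds for sections over the base. -/
theorem continuousAt_transfer {Y : Type*} [TopologicalSpace Y] {V : Y → Type*}
    [∀ y, NormedAddCommGroup (V y)] [∀ y, NormedSpace ℂ (V y)]
    {G G' : Type*} [NormedAddCommGroup G] [NormedSpace ℂ G] [NormedAddCommGroup G']
    [NormedSpace ℂ G'] (P : ∀ y, V y →ₗ[ℂ] G) (Q : ∀ y, V y →ₗ[ℂ] G') {z : Y} {N : Set Y}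
    (hN : N ∈ 𝓝 z) (hP : ∀ y ∈ N, ∀ v, ‖P y v‖ = ‖v‖) (hQ : ∀ y ∈ N, ∀ v, ‖Q y v‖ = ‖v‖)
    (hr : ∀ y ∈ N, Set.range (P z) ⊆ Set.range (P y))
    (hc : ∀ s : ∀ y, V y, ContinuousAt (fun y => P y (s y)) z → ContinuousAt (fun y => Q y (s y)) z)
    {X : Type*} [TopologicalSpace X] {f : X → Y} {x : X} (hx : f x = z) (hf : ContinuousAt f x)
    (s : ∀ x, V (f x)) (hs : ContinuousAt (fun y => P (f y) (s y)) x) :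
    ContinuousAt (fun y => Q (f y) (s y)) x := by
  classical
  subst hx
  have hex : ∀ y : Y, ∃ v : V y, y ∈ N → P y v = P (f x) (s x) := fun y => by
    by_cases hy : y ∈ N
    · obtain ⟨v, hv⟩ := hr y hy ⟨s x, rfl⟩
      exact ⟨v, fun _ => hv⟩
    · exact ⟨0, fun h => (hy h).elim⟩
  choose t ht using hex
  have h1 : ContinuousAt (fun y => P y (t y)) (f x) :=
    (continuousAt_const (y := P (f x) (s x))).congr (Filter.mem_of_superset hN fun y hy => (ht y hy).symm)
  have h2 : ContinuousAt (fun y => Q (f y) (t (f y))) x :=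
    ContinuousAt.comp (g := fun y => Q y (t y)) (hc t h1) hf
  have hfN : ∀ᶠ y in 𝓝 x, f y ∈ N := hf hN
  refine continuousAt_of_locally_uniform_approx_of_continuousAt fun u hu => ?_
  obtain ⟨r, hr0, hru⟩ := Metric.mem_uniformity_dist.1 hu
  have h3 : ∀ᶠ y in 𝓝 x, dist (P (f y) (s y)) (P (f x) (s x)) < r :=
    hs (Metric.ball_mem_nhds _ hr0)
  refine ⟨_, hfN.and h3, _, h2, fun y hy => hru ?_⟩
  rw [dist_eq_norm, ← map_sub, hQ _ hy.1, ← hP _ hy.1, map_sub, ht _ hy.1, ← dist_eq_norm]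
  exact hy.2

end Continuity

/-- A nonzero separable complex Hilbert space. -/
structure SepHilbert : Type 1 where
  carrier : Type
  [nacg : NormedAddCommGroup carrier]
  [ips : InnerProductSpace ℂ carrier]
  [complete : CompleteSpace carrier]
  [separable : SeparableSpace carrier]
  [nontrivial : Nontrivial carrier]

instance : CoeSort SepHilbert Type := ⟨SepHilbert.carrier⟩

attribute [instance] SepHilbert.nacg SepHilbert.ips SepHilbert.complete SepHilbert.separable
  SepHilbert.nontrivial

/-- A Dixmier-Douady bundle over `X`: a locally trivial bundle of `C⋆`-algebras whose typical fibre
is the algebra of compact operators on a nonzero separable Hilbert space `H`, with structure group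
`Aut K(H) = PU(H)` in the strong topology. As in Mathlib's fibre bundles, the topology is given by
the choice of a local trivialization around every point: the trivialization at `x` is defined over
the open set `base x` and identifies the fibre at `y ∈ base x` with `K(hilb x)` by `chart x y`.
A section is continuous at a point if it is continuous in norm in such a chart. By `compat` this
does not depend on the chart, which means that the transition functions
`y ↦ chart x₁ y ∘ (chart x₀ y)⁻¹` are continuous in the topology of pointwise norm convergence
on `K(H)`, the strong topology of `PU(H)`. -/
structure DDBundle (X : Type u) [TopologicalSpace X] : Type (max u 1) where
  fib : X → Type
  [alg : ∀ x, NonUnitalCStarAlgebra (fib x)]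
  hilb : X → SepHilbert
  base : X → Set X
  isOpen_base : ∀ x, IsOpen (base x)
  mem_base : ∀ x, x ∈ base x
  chart : ∀ x y, fib y →ₗ[ℂ] (hilb x →L[ℂ] hilb x)
  isChart : ∀ x, ∀ y ∈ base x, IsAlgChart (chart x y)
  compat : ∀ x₀ x₁ (s : ∀ y, fib y), ∀ x ∈ base x₀ ∩ base x₁,
    ContinuousAt (fun y => chart x₀ y (s y)) x → ContinuousAt (fun y => chart x₁ y (s y)) x

attribute [instance] DDBundle.alg

variable {X : Type u} [TopologicalSpace X]

/-- A Morita isomorphism `E : A ⇢ B`: a locally trivial bundle of Banach spaces with a left action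
of `B` and a right action of `A`, locally modelled on the compact operators `K(H, H')` with post-
and pre-composition. There is a chosen local trivialization `chart x` around every point `x`,
defined over `base x` and compatible with the actions through the chosen trivializations of `A`
and `B` around `x`. This is no restriction: another local trivialization of `A` differs from the
chosen one by a map to `PU(H)`, which lifts locally to `U(H)` since the projection
`U(H) → PU(H)` has continuous local sections, and such a lift changes the trivializations of `E`.
Completeness of the fibres and the module axioms follow from the existence of charts. -/
structure Morita (A B : DDBundle X) : Type (max u 1) where
  fib : X → Type
  [nacg : ∀ x, NormedAddCommGroup (fib x)]
  [ns : ∀ x, NormedSpace ℂ (fib x)]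
  left : ∀ x, B.fib x → fib x →ₗ[ℂ] fib x
  right : ∀ x, A.fib x → fib x →ₗ[ℂ] fib x
  base : X → Set X
  isOpen_base : ∀ x, IsOpen (base x)
  mem_base : ∀ x, x ∈ base x
  base_subset : ∀ x, base x ⊆ A.base x ∩ B.base x
  chart : ∀ x y, fib y →ₗ[ℂ] (A.hilb x →L[ℂ] B.hilb x)
  isChart : ∀ x, ∀ y ∈ base x,
    IsModChart (A.chart x y) (B.chart x y) (left y) (right y) (chart x y)
  compat : ∀ x₀ x₁ (s : ∀ y, fib y), ∀ x ∈ base x₀ ∩ base x₁,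
    ContinuousAt (fun y => chart x₀ y (s y)) x → ContinuousAt (fun y => chart x₁ y (s y)) x

attribute [instance] Morita.nacg Morita.ns

namespace Morita
variable {A B C D : DDBundle X}

/-- Continuity at `x` of a section of `E`; by `compat` every other chart around `x` gives the same. -/
def ContAt (E : Morita A B) (s : ∀ y, E.fib y) (x : X) : Prop :=
  ContinuousAt (fun y => E.chart x y (s y)) x

theorem base_mem_nhds (E : Morita A B) (x : X) : E.base x ∈ 𝓝 x :=
  (E.isOpen_base x).mem_nhds (E.mem_base x)

theorem isChartA (E : Morita A B) {x y : X} (h : y ∈ E.base x) : IsAlgChart (A.chart x y) :=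
  A.isChart x y (E.base_subset x h).1

theorem isChartB (E : Morita A B) {x y : X} (h : y ∈ E.base x) : IsAlgChart (B.chart x y) :=
  B.isChart x y (E.base_subset x h).2

/-- The identity Morita isomorphism: `A` as a bimodule over itself. -/
def id (A : DDBundle X) : Morita A A where
  fib := A.fib
  left _ b := LinearMap.mulLeft ℂ b
  right _ a := LinearMap.mulRight ℂ a
  base := A.base
  isOpen_base := A.isOpen_base
  mem_base := A.mem_base
  base_subset _ _ h := ⟨h, h⟩
  chart := A.chart
  isChart x y h :=
    ⟨(A.isChart x y h).norm_map, (A.isChart x y h).range_eq, (A.isChart x y h).map_mul,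
      fun a e => (A.isChart x y h).map_mul e a⟩
  compat := A.compat

/-- The composition `F ⊗_B E` of `E : A ⇢ B` and `F : B ⇢ C`: fibrewise the completion of the
algebraic tensor product over `B`, with charts `f ⊗ e ↦ chart f ∘ chart e`. The norm on the fibre
at `y` is computed in the charts at `y`; by `norm_compMap_le` all charts give the same. -/
def comp (E : Morita A B) (F : Morita B C) : Morita A C where
  fib y := CTensor (F.chart y y) (E.chart y y)
  left y := CTensor.left (F.chart y y) (E.chart y y) (F.left y)
  right y := CTensor.right (F.chart y y) (E.chart y y) (E.right y)
  base x := E.base x ∩ F.base x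
  isOpen_base x := (E.isOpen_base x).inter (F.isOpen_base x)
  mem_base x := ⟨E.mem_base x, F.mem_base x⟩
  base_subset x _ h := ⟨(E.base_subset x h.1).1, (F.base_subset x h.2).2⟩
  chart x y := CTensor.chart (F.chart y y) (E.chart y y) (F.chart x y) (E.chart x y)
  isChart x y h :=
    CTensor.isModChart (E.isChartB (E.mem_base y)) (E.isChart y y (E.mem_base y))
      (F.isChart y y (F.mem_base y)) (E.isChartB h.1) (E.isChart x y h.1) (F.isChart x y h.2)
  compat x₀ x₁ s x hx hs := by
    classical
    have hch : ∀ x, ∀ y ∈ E.base x ∩ F.base x, IsModChart (A.chart x y) (C.chart x y)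
        (CTensor.left (F.chart y y) (E.chart y y) (F.left y))
        (CTensor.right (F.chart y y) (E.chart y y) (E.right y))
        (CTensor.chart (F.chart y y) (E.chart y y) (F.chart x y) (E.chart x y)) := fun x y h =>
      CTensor.isModChart (E.isChartB (E.mem_base y)) (E.isChart y y (E.mem_base y))
        (F.isChart y y (F.mem_base y)) (E.isChartB h.1) (E.isChart x y h.1) (F.isChart x y h.2)
    have hmk : ∀ x, ∀ y ∈ E.base x ∩ F.base x, ∀ t,
        CTensor.chart (F.chart y y) (E.chart y y) (F.chart x y) (E.chart x y)
          (CTensor.mk _ _ t) = compMap (F.chart x y) (E.chart x y) t := fun x y h =>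
      CTensor.chart_mk (E.isChartB (E.mem_base y)) (E.isChart y y (E.mem_base y))
        (F.isChart y y (F.mem_base y)) (E.isChartB h.1) (E.isChart x y h.1) (F.isChart x y h.2)
    refine continuousAt_of_locally_uniform_approx_of_continuousAt fun u hu => ?_
    obtain ⟨r, hr0, hru⟩ := Metric.mem_uniformity_dist.1 hu
    obtain ⟨n, S, R, hS, hR, hT⟩ := exists_approx (K := B.hilb x₀) _
      ((hch x₀ x hx.1).compact (s x)) (half_pos hr0)
    have hf : ∀ i, ∀ y, ∃ f : F.fib y, y ∈ F.base x₀ → F.chart x₀ y f = S i := fun i y => by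
      by_cases hy : y ∈ F.base x₀
      · obtain ⟨f, hf⟩ := (F.isChart x₀ y hy).exists_eq (hS i)
        exact ⟨f, fun _ => hf⟩
      · exact ⟨0, fun h => (hy h).elim⟩
    have he : ∀ i, ∀ y, ∃ e : E.fib y, y ∈ E.base x₀ → E.chart x₀ y e = R i := fun i y => by
      by_cases hy : y ∈ E.base x₀
      · obtain ⟨f, hf⟩ := (E.isChart x₀ y hy).exists_eq (hR i)
        exact ⟨f, fun _ => hf⟩
      · exact ⟨0, fun h => (hy h).elim⟩
    choose f hf using hf
    choose e he using he
    have hcf : ∀ i, ContinuousAt (fun y => F.chart x₁ y (f i y)) x := fun i =>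
      F.compat x₀ x₁ (f i) x ⟨hx.1.2, hx.2.2⟩ ((continuousAt_const (y := S i)).congr
        (Filter.mem_of_superset ((F.isOpen_base x₀).mem_nhds hx.1.2) fun y hy => (hf i y hy).symm))
    have hce : ∀ i, ContinuousAt (fun y => E.chart x₁ y (e i y)) x := fun i =>
      E.compat x₀ x₁ (e i) x ⟨hx.1.1, hx.2.1⟩ ((continuousAt_const (y := R i)).congr
        (Filter.mem_of_superset ((E.isOpen_base x₀).mem_nhds hx.1.1) fun y hy => (he i y hy).symm))
    have hG : ContinuousAt (fun y => ∑ i, F.chart x₁ y (f i y) ∘L E.chart x₁ y (e i y)) x :=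
      tendsto_finsetSum _ fun i _ => (hcf i).clm_comp (hce i)
    have hs' := hs (Metric.ball_mem_nhds _ (half_pos hr0))
    have hb₀ : E.base x₀ ∩ F.base x₀ ∈ 𝓝 x :=
      ((E.isOpen_base x₀).inter (F.isOpen_base x₀)).mem_nhds hx.1
    have hb₁ : E.base x₁ ∩ F.base x₁ ∈ 𝓝 x :=
      ((E.isOpen_base x₁).inter (F.isOpen_base x₁)).mem_nhds hx.2
    refine ⟨_, Filter.inter_mem hs' (Filter.inter_mem hb₀ hb₁), _, hG, fun y hy => hru ?_⟩
    obtain ⟨hy, hy₀, hy₁⟩ := hy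
    have e1 : ∑ i, F.chart x₁ y (f i y) ∘L E.chart x₁ y (e i y) =
        CTensor.chart (F.chart y y) (E.chart y y) (F.chart x₁ y) (E.chart x₁ y)
          (CTensor.mk _ _ (∑ i, f i y ⊗ₜ e i y)) := by
      rw [hmk x₁ y hy₁, map_sum]; rfl
    have e0 : ∑ i, S i ∘L R i =
        CTensor.chart (F.chart y y) (E.chart y y) (F.chart x₀ y) (E.chart x₀ y)
          (CTensor.mk _ _ (∑ i, f i y ⊗ₜ e i y)) := by
      rw [hmk x₀ y hy₀, map_sum]
      refine Finset.sum_congr rfl fun i _ => ?_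
      rw [compMap_tmul, hf i y hy₀.2, he i y hy₀.1]
    rw [e1, dist_eq_norm, ← map_sub, (hch x₁ y hy₁).norm_map, ← (hch x₀ y hy₀).norm_map, map_sub,
      ← e0, ← dist_eq_norm]
    calc _ ≤ _ + _ := dist_triangle _ (CTensor.chart (F.chart x x) (E.chart x x) (F.chart x₀ x)
          (E.chart x₀ x) (s x)) _
      _ < r / 2 + r / 2 := add_lt_add_of_lt_of_le hy (by rw [dist_eq_norm]; exact hT)
      _ = r := add_halves r

/-- A `2`-isomorphism: a continuous bundle isomorphism, that is, a family of isomorphisms of the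
fibres that maps continuous sections to continuous sections, compatible with the norms and with
the two actions. (The inverse is then continuous, see `TwoIso.symm`.) -/
@[ext] structure TwoIso (E F : Morita A B) : Type u where
  app : ∀ x, E.fib x ≃ₗᵢ[ℂ] F.fib x
  map_left : ∀ x b e, app x (E.left x b e) = F.left x b (app x e)
  map_right : ∀ x a e, app x (E.right x a e) = F.right x a (app x e)
  contAt : ∀ s x, E.ContAt s x → F.ContAt (fun y => app y (s y)) x
theorem exists_chart_ne_zero (E : Morita A B) {x y : X} (h : y ∈ E.base x) :
    ∃ e, E.chart x y e ≠ 0 := by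
  obtain ⟨p, hp⟩ := exists_ne (0 : A.hilb x)
  obtain ⟨q, hq⟩ := exists_ne (0 : B.hilb x)
  obtain ⟨e, he⟩ := (E.isChart x y h).exists_eq (isCompactOperator_rankOne q p)
  exact ⟨e, by rw [he]; exact InnerProductSpace.rankOne_ne_zero hq hp⟩

namespace TwoIso
variable {E F G : Morita A B}

/-- A `2`-isomorphism is a scalar in every chart. -/
theorem exists_scalar (τ : TwoIso E F) {x y : X} (hE : y ∈ E.base x) (hF : y ∈ F.base x) :
    ∃ c : ℂ, ∀ e, F.chart x y (τ.app y e) = c • E.chart x y e :=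
  schur (E.isChartA hE) (E.isChartB hE) (E.isChart x y hE)
    (F.chart x y ∘ₗ (τ.app y).toLinearEquiv.toLinearMap)
    (fun b e => by simp [τ.map_left, (F.isChart x y hF).map_left])
    (fun a e => by simp [τ.map_right, (F.isChart x y hF).map_right])

open Classical in
/-- The scalar by which a `2`-isomorphism acts at `y` in the charts at `x`. -/
def scalar (τ : TwoIso E F) (x y : X) : ℂ :=
  if h : ∃ c : ℂ, ∀ e, F.chart x y (τ.app y e) = c • E.chart x y e then h.choose else 1

theorem scalar_spec (τ : TwoIso E F) {x y : X} (hE : y ∈ E.base x) (hF : y ∈ F.base x)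
    (e : E.fib y) : F.chart x y (τ.app y e) = τ.scalar x y • E.chart x y e := by
  have h := τ.exists_scalar hE hF
  rw [scalar, dif_pos h]
  exact h.choose_spec e

theorem scalar_eq (τ : TwoIso E F) {x y : X} (hE : y ∈ E.base x) (hF : y ∈ F.base x)
    {c : ℂ} {e : E.fib y} (he : E.chart x y e ≠ 0)
    (h : F.chart x y (τ.app y e) = c • E.chart x y e) : τ.scalar x y = c := by
  rw [τ.scalar_spec hE hF] at h
  exact smul_left_injective ℂ he h

theorem norm_scalar (τ : TwoIso E F) {x y : X} (hE : y ∈ E.base x) (hF : y ∈ F.base x) :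
    ‖τ.scalar x y‖ = 1 := by
  obtain ⟨e, he⟩ := E.exists_chart_ne_zero hE
  have h := congrArg norm (τ.scalar_spec hE hF e)
  rw [(F.isChart x y hF).norm_map, LinearIsometryEquiv.norm_map, norm_smul,
    ← (E.isChart x y hE).norm_map e] at h
  exact (mul_eq_right₀ (norm_ne_zero_iff.2 he)).1 h.symm

theorem continuousAt_scalar (τ : TwoIso E F) (x : X) : ContinuousAt (τ.scalar x) x := by
  obtain ⟨p, hp⟩ := exists_norm_eq (A.hilb x) (zero_le_one (α := ℝ))
  obtain ⟨q, hq⟩ := exists_norm_eq (B.hilb x) (zero_le_one (α := ℝ))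
  have hex : ∀ y, ∃ e : E.fib y, y ∈ E.base x →
      E.chart x y e = InnerProductSpace.rankOne ℂ q p := fun y => by
    by_cases hy : y ∈ E.base x
    · obtain ⟨e, he⟩ := (E.isChart x y hy).exists_eq (isCompactOperator_rankOne q p)
      exact ⟨e, fun _ => he⟩
    · exact ⟨0, fun h => (hy h).elim⟩
  choose s hs using hex
  have h1 : E.ContAt s x :=
    (continuousAt_const (y := InnerProductSpace.rankOne ℂ q p)).congr
      (Filter.mem_of_superset (E.base_mem_nhds x) fun y hy => (hs y hy).symm)
  have h2 : ContinuousAt (fun y => inner ℂ q (F.chart x y (τ.app y (s y)) p)) x :=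
    ContinuousAt.inner (𝕜 := ℂ) continuousAt_const ((τ.contAt s x h1).clm_apply continuousAt_const)
  refine h2.congr ?_
  filter_upwards [E.base_mem_nhds x, F.base_mem_nhds x] with y hE hF
  rw [τ.scalar_spec hE hF, hs y hE]
  simp [hp, hq]

/-- Two `2`-isomorphisms are equal if their scalars at all points are. -/
theorem ext_scalar {τ τ' : TwoIso E F} (h : ∀ y, τ.scalar y y = τ'.scalar y y) : τ = τ' := by
  ext y e
  refine inj_of_norm_map (F.isChart y y (F.mem_base y)).norm_map ?_
  rw [τ.scalar_spec (E.mem_base y) (F.mem_base y), τ'.scalar_spec (E.mem_base y) (F.mem_base y), h]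

/-- A family of linear maps that are scalars in all charts, of modulus one and continuous, is a
`2`-isomorphism. -/
def ofScalar (f : ∀ y, E.fib y →ₗ[ℂ] F.fib y) (c : X → X → ℂ) (hc : ∀ y, ‖c y y‖ = 1)
    (hf : ∀ x, ∀ y ∈ E.base x, y ∈ F.base x → ∀ e, F.chart x y (f y e) = c x y • E.chart x y e)
    (hcont : ∀ x, ContinuousAt (c x) x) : TwoIso E F where
  app y := LinearIsometryEquiv.ofSurjective
    ⟨f y, fun e => by
      rw [← (F.isChart y y (F.mem_base y)).norm_map, hf y y (E.mem_base y) (F.mem_base y),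
        norm_smul, hc, one_mul, (E.isChart y y (E.mem_base y)).norm_map]⟩
    (fun z => by
      have h0 : c y y ≠ 0 := norm_ne_zero_iff.1 (by rw [hc]; exact one_ne_zero)
      obtain ⟨e, he⟩ := (E.isChart y y (E.mem_base y)).exists_eq
        ((F.isChart y y (F.mem_base y)).compact ((c y y)⁻¹ • z))
      refine ⟨e, inj_of_norm_map (F.isChart y y (F.mem_base y)).norm_map ?_⟩
      change F.chart y y (f y e) = _
      rw [hf y y (E.mem_base y) (F.mem_base y), he, map_smul, smul_inv_smul₀ h0])
  map_left y b e := inj_of_norm_map (F.isChart y y (F.mem_base y)).norm_map (by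
    change F.chart y y (f y _) = F.chart y y (F.left y b (f y e))
    rw [hf y y (E.mem_base y) (F.mem_base y), (E.isChart y y (E.mem_base y)).map_left,
      (F.isChart y y (F.mem_base y)).map_left, hf y y (E.mem_base y) (F.mem_base y),
      ContinuousLinearMap.comp_smul])
  map_right y a e := inj_of_norm_map (F.isChart y y (F.mem_base y)).norm_map (by
    change F.chart y y (f y _) = F.chart y y (F.right y a (f y e))
    rw [hf y y (E.mem_base y) (F.mem_base y), (E.isChart y y (E.mem_base y)).map_right,
      (F.isChart y y (F.mem_base y)).map_right, hf y y (E.mem_base y) (F.mem_base y),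
      ContinuousLinearMap.smul_comp])
  contAt s x hs := by
    refine ((hcont x).smul hs).congr ?_
    filter_upwards [E.base_mem_nhds x, F.base_mem_nhds x] with y hE hF
    exact (hf x y hE hF (s y)).symm

@[simp] theorem ofScalar_app (f : ∀ y, E.fib y →ₗ[ℂ] F.fib y) (c : X → X → ℂ) (hc hf hcont) (y : X)
    (e : E.fib y) : (ofScalar f c hc hf hcont).app y e = f y e := rfl

theorem ofScalar_scalar (f : ∀ y, E.fib y →ₗ[ℂ] F.fib y) (c : X → X → ℂ) (hc hf hcont) {x y : X}
    (hE : y ∈ E.base x) (hF : y ∈ F.base x) : (ofScalar f c hc hf hcont).scalar x y = c x y := by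
  obtain ⟨e, he⟩ := E.exists_chart_ne_zero hE
  exact scalar_eq _ hE hF he (hf x y hE hF e)

/-- The identity. -/
@[simps] def refl (E : Morita A B) : TwoIso E E where
  app _ := LinearIsometryEquiv.refl ℂ _
  map_left _ _ _ := rfl
  map_right _ _ _ := rfl
  contAt _ _ h := h

/-- Vertical composition. -/
@[simps] def trans (τ : TwoIso E F) (σ : TwoIso F G) : TwoIso E G where
  app x := (τ.app x).trans (σ.app x)
  map_left x b e := by simp [τ.map_left, σ.map_left]
  map_right x b e := by simp [τ.map_right, σ.map_right]
  contAt s x h := σ.contAt _ x (τ.contAt s x h)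

/-- The inverse. -/
@[simps] def symm (τ : TwoIso E F) : TwoIso F E where
  app x := (τ.app x).symm
  map_left x b e := (τ.app x).injective (by simp [τ.map_left])
  map_right x b e := (τ.app x).injective (by simp [τ.map_right])
  contAt s x h := by
    have h0 : τ.scalar x x ≠ 0 := norm_ne_zero_iff.1 (by
      rw [τ.norm_scalar (E.mem_base x) (F.mem_base x)]; exact one_ne_zero)
    refine (((τ.continuousAt_scalar x).inv₀ h0).smul h).congr ?_
    filter_upwards [E.base_mem_nhds x, F.base_mem_nhds x] with y hE hF
    have h1 := τ.scalar_spec hE hF ((τ.app y).symm (s y))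
    rw [LinearIsometryEquiv.apply_symm_apply] at h1
    have h2 : τ.scalar x y ≠ 0 := norm_ne_zero_iff.1 (by
      rw [τ.norm_scalar hE hF]; exact one_ne_zero)
    simp only [Pi.smul_apply', Pi.inv_apply, h1, inv_smul_smul₀ h2]

theorem scalar_refl (y : X) : (refl E).scalar y y = 1 := by
  obtain ⟨e, he⟩ := E.exists_chart_ne_zero (E.mem_base y)
  exact scalar_eq _ (E.mem_base y) (E.mem_base y) he (by simp)

theorem scalar_trans (τ : TwoIso E F) (σ : TwoIso F G) (y : X) :
    (τ.trans σ).scalar y y = τ.scalar y y * σ.scalar y y := by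
  obtain ⟨e, he⟩ := E.exists_chart_ne_zero (E.mem_base y)
  refine scalar_eq _ (E.mem_base y) (G.mem_base y) he ?_
  simp only [trans_app, LinearIsometryEquiv.trans_apply]
  rw [σ.scalar_spec (F.mem_base y) (G.mem_base y), τ.scalar_spec (E.mem_base y) (F.mem_base y),
    smul_smul, mul_comm]

end TwoIso

instance (A B : DDBundle X) : Category (Morita A B) where
  Hom := TwoIso
  id := TwoIso.refl
  comp := TwoIso.trans

/-- A `2`-isomorphism as an isomorphism. -/
def TwoIso.toIso {E F : Morita A B} (τ : TwoIso E F) : E ≅ F where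
  hom := τ
  inv := τ.symm
  hom_inv_id := by
    apply TwoIso.ext; funext x; exact LinearIsometryEquiv.self_trans_symm _
  inv_hom_id := by
    apply TwoIso.ext; funext x; exact LinearIsometryEquiv.symm_trans_self _

/-- The bicategorical composition in a chart. -/
theorem comp_chart_mk (E : Morita A B) (F : Morita B C) {x y : X} (hE : y ∈ E.base x)
    (hF : y ∈ F.base x) (t : F.fib y ⊗[ℂ] E.fib y) :
    (E.comp F).chart x y (CTensor.mk (F.chart y y) (E.chart y y) t) =
      compMap (F.chart x y) (E.chart x y) t :=
  CTensor.chart_mk (E.isChartB (E.mem_base y)) (E.isChart y y (E.mem_base y))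
    (F.isChart y y (F.mem_base y)) (E.isChartB hE) (E.isChart x y hE) (F.isChart x y hF) t

theorem continuous_comp_chart (E : Morita A B) (F : Morita B C) (x y : X) :
    Continuous ((E.comp F).chart x y) :=
  (CTensor.extend (F.chart y y) (E.chart y y) (compMap (F.chart x y) (E.chart x y))).continuous

/-- The elementary tensor `f ⊗ e` in `F ⊗_B E`. -/
def tmul (E : Morita A B) (F : Morita B C) {y : X} (f : F.fib y) (e : E.fib y) :
    (E.comp F).fib y := CTensor.mk (F.chart y y) (E.chart y y) (f ⊗ₜ e)

theorem chart_tmul (E : Morita A B) (F : Morita B C) {x y : X} (hE : y ∈ E.base x)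
    (hF : y ∈ F.base x) (f : F.fib y) (e : E.fib y) :
    (E.comp F).chart x y (tmul E F f e) = F.chart x y f ∘L E.chart x y e :=
  comp_chart_mk E F hE hF _

section whisker

theorem compMap_lTensor {E E' : Morita A B} (η : TwoIso E E') (F : Morita B C) {x y : X}
    (hE : y ∈ E.base x) (hE' : y ∈ E'.base x) (t : F.fib y ⊗[ℂ] E.fib y) :
    compMap (F.chart x y) (E'.chart x y) ((η.app y).toLinearEquiv.toLinearMap.lTensor (F.fib y) t) =
      η.scalar x y • compMap (F.chart x y) (E.chart x y) t := by
  induction t with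
  | zero => simp
  | tmul f e => simp [η.scalar_spec hE hE']
  | add s t hs ht => simp [hs, ht]

theorem compMap_rTensor (E : Morita A B) {F F' : Morita B C} (η : TwoIso F F') {x y : X}
    (hF : y ∈ F.base x) (hF' : y ∈ F'.base x) (t : F.fib y ⊗[ℂ] E.fib y) :
    compMap (F'.chart x y) (E.chart x y) ((η.app y).toLinearEquiv.toLinearMap.rTensor (E.fib y) t) =
      η.scalar x y • compMap (F.chart x y) (E.chart x y) t := by
  induction t with
  | zero => simp
  | tmul f e => simp [η.scalar_spec hF hF']
  | add s t hs ht => simp [hs, ht]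

/-- The map `f ⊗ e ↦ f ⊗ η e`. -/
def whiskerRightMap {E E' : Morita A B} (η : TwoIso E E') (F : Morita B C) (y : X) :
    CTensor (F.chart y y) (E.chart y y) →L[ℂ] CTensor (F.chart y y) (E'.chart y y) :=
  CTensor.extend (F.chart y y) (E.chart y y) (CTensor.mk (F.chart y y) (E'.chart y y) ∘ₗ
    (η.app y).toLinearEquiv.toLinearMap.lTensor (F.fib y))

/-- The map `f ⊗ e ↦ η f ⊗ e`. -/
def whiskerLeftMap (E : Morita A B) {F F' : Morita B C} (η : TwoIso F F') (y : X) :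
    CTensor (F.chart y y) (E.chart y y) →L[ℂ] CTensor (F'.chart y y) (E.chart y y) :=
  CTensor.extend (F.chart y y) (E.chart y y) (CTensor.mk (F'.chart y y) (E.chart y y) ∘ₗ
    (η.app y).toLinearEquiv.toLinearMap.rTensor (E.fib y))

/-- Whiskering `f ⊗ e ↦ f ⊗ η e`. -/
def whiskerRight {E E' : Morita A B} (η : TwoIso E E') (F : Morita B C) :
    TwoIso (E.comp F) (E'.comp F) :=
  TwoIso.ofScalar
    (fun y => (whiskerRightMap η F y).toLinearMap)
    η.scalar (fun y => η.norm_scalar (E.mem_base y) (E'.mem_base y))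
    (fun x y h h' z => by
      refine CTensor.denseRange_mk.induction_on (p := fun z => (E'.comp F).chart x y
        (whiskerRightMap η F y z) = η.scalar x y • (E.comp F).chart x y z) z
        (isClosed_eq ?_ ?_) fun t => ?_
      · exact (continuous_comp_chart E' F x y).comp (whiskerRightMap η F y).continuous
      · exact (continuous_comp_chart E F x y).const_smul (η.scalar x y)
      · rw [whiskerRightMap, CTensor.extend_mk (c := 1), LinearMap.comp_apply, comp_chart_mk _ _ h'.1 h'.2,
          comp_chart_mk _ _ h.1 h.2, compMap_lTensor η F h.1 h'.1]
        intro t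
        rw [LinearMap.comp_apply, CTensor.norm_mk,
          compMap_lTensor η F (E.mem_base y) (E'.mem_base y), norm_smul,
          η.norm_scalar (E.mem_base y) (E'.mem_base y)])
    η.continuousAt_scalar

/-- Whiskering `f ⊗ e ↦ η f ⊗ e`. -/
def whiskerLeft (E : Morita A B) {F F' : Morita B C} (η : TwoIso F F') :
    TwoIso (E.comp F) (E.comp F') :=
  TwoIso.ofScalar
    (fun y => (whiskerLeftMap E η y).toLinearMap)
    η.scalar (fun y => η.norm_scalar (F.mem_base y) (F'.mem_base y))
    (fun x y h h' z => by
      refine CTensor.denseRange_mk.induction_on (p := fun z => (E.comp F').chart x y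
        (whiskerLeftMap E η y z) = η.scalar x y • (E.comp F).chart x y z) z
        (isClosed_eq ?_ ?_) fun t => ?_
      · exact (continuous_comp_chart E F' x y).comp (whiskerLeftMap E η y).continuous
      · exact (continuous_comp_chart E F x y).const_smul (η.scalar x y)
      · rw [whiskerLeftMap, CTensor.extend_mk (c := 1), LinearMap.comp_apply, comp_chart_mk _ _ h'.1 h'.2,
          comp_chart_mk _ _ h.1 h.2, compMap_rTensor E η h.2 h'.2]
        intro t
        rw [LinearMap.comp_apply, CTensor.norm_mk,
          compMap_rTensor E η (F.mem_base y) (F'.mem_base y), norm_smul,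
          η.norm_scalar (F.mem_base y) (F'.mem_base y)])
    η.continuousAt_scalar

theorem scalar_whiskerRight {E E' : Morita A B} (η : TwoIso E E') (F : Morita B C) (y : X) :
    (whiskerRight η F).scalar y y = η.scalar y y :=
  TwoIso.ofScalar_scalar _ _ _ _ _ ((E.comp F).mem_base y) ((E'.comp F).mem_base y)

theorem scalar_whiskerLeft (E : Morita A B) {F F' : Morita B C} (η : TwoIso F F') (y : X) :
    (whiskerLeft E η).scalar y y = η.scalar y y :=
  TwoIso.ofScalar_scalar _ _ _ _ _ ((E.comp F).mem_base y) ((E.comp F').mem_base y)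

end whisker

section canonical

/-- The linear isomorphism between fibres that is the identity in the charts centred at the point.
The unitors and the associator are of this form; see `leftUnitor_tmul`, `rightUnitor_tmul` and
`associator_tmul` for their values on elementary tensors. -/
def centralMap (E F : Morita A B) (y : X) : E.fib y →ₗ[ℂ] F.fib y :=
  have h : ∀ e, ∃ f, F.chart y y f = E.chart y y e := fun e =>
    (F.isChart y y (F.mem_base y)).exists_eq ((E.isChart y y (E.mem_base y)).compact e)
  { toFun := fun e => (h e).choose
    map_add' := fun e e' => inj_of_norm_map (F.isChart y y (F.mem_base y)).norm_map
      ((h (e + e')).choose_spec.trans (by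
        rw [map_add, map_add, (h e).choose_spec, (h e').choose_spec]))
    map_smul' := fun c e => inj_of_norm_map (F.isChart y y (F.mem_base y)).norm_map
      ((h (c • e)).choose_spec.trans (by
        rw [map_smul, map_smul, (h e).choose_spec, RingHom.id_apply])) }

theorem chart_centralMap (E F : Morita A B) (y : X) (e : E.fib y) :
    F.chart y y (centralMap E F y e) = E.chart y y e :=
  ((F.isChart y y (F.mem_base y)).exists_eq ((E.isChart y y (E.mem_base y)).compact e)).choose_spec

theorem centralMap_eq {E F : Morita A B} {y : X} {e : E.fib y} {f : F.fib y}
    (h : F.chart y y f = E.chart y y e) : centralMap E F y e = f :=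
  inj_of_norm_map (F.isChart y y (F.mem_base y)).norm_map (by rw [chart_centralMap, h])

/-- If `centralMap` is compatible with all charts on one nonzero vector, then it is a
`2`-isomorphism. -/
def canonical (E F : Morita A B) (h : ∀ x, ∀ y ∈ E.base x, y ∈ F.base x → ∃ e : E.fib y,
    E.chart x y e ≠ 0 ∧ F.chart x y (centralMap E F y e) = E.chart x y e) : TwoIso E F :=
  TwoIso.ofScalar (centralMap E F) (fun _ _ => 1) (fun _ => norm_one)
    (fun x y hE hF e => by
      obtain ⟨c, hc⟩ := schur (E.isChartA hE) (E.isChartB hE) (E.isChart x y hE)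
        (F.chart x y ∘ₗ centralMap E F y)
        (fun b e => by
          have : centralMap E F y (E.left y b e) = F.left y b (centralMap E F y e) :=
            centralMap_eq (by
              rw [(E.isChart y y (E.mem_base y)).map_left, (F.isChart y y (F.mem_base y)).map_left,
                chart_centralMap])
          simp [this, (F.isChart x y hF).map_left])
        (fun a e => by
          have : centralMap E F y (E.right y a e) = F.right y a (centralMap E F y e) :=
            centralMap_eq (by
              rw [(E.isChart y y (E.mem_base y)).map_right,
                (F.isChart y y (F.mem_base y)).map_right, chart_centralMap])
          simp [this, (F.isChart x y hF).map_right])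
      obtain ⟨e₀, h0, h1⟩ := h x y hE hF
      have h2 := hc e₀
      rw [LinearMap.comp_apply, h1] at h2
      have h3 : c = 1 := smul_left_injective ℂ h0 (by simpa using h2.symm)
      rw [h3] at hc
      exact hc e)
    (fun _ => continuousAt_const)

theorem scalar_canonical (E F : Morita A B) (h) (y : X) : (canonical E F h).scalar y y = 1 :=
  TwoIso.ofScalar_scalar _ _ _ _ _ (E.mem_base y) (F.mem_base y)

theorem centralMap_leftUnitor (E : Morita A B) {y : X} (e : E.fib y) (a : (Morita.id A).fib y) :
    centralMap ((Morita.id A).comp E) E y (tmul (Morita.id A) E e a) = E.right y a e :=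
  centralMap_eq (((E.isChart y y (E.mem_base y)).map_right a e).trans
    (chart_tmul (Morita.id A) E ((Morita.id A).mem_base y) (E.mem_base y) e a).symm)

theorem centralMap_rightUnitor (E : Morita A B) {y : X} (b : (Morita.id B).fib y) (e : E.fib y) :
    centralMap (E.comp (Morita.id B)) E y (tmul E (Morita.id B) b e) = E.left y b e :=
  centralMap_eq (((E.isChart y y (E.mem_base y)).map_left b e).trans
    (chart_tmul E (Morita.id B) (E.mem_base y) ((Morita.id B).mem_base y) b e).symm)

theorem centralMap_associator (E : Morita A B) (F : Morita B C) (G : Morita C D) {y : X}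
    (g : G.fib y) (f : F.fib y) (e : E.fib y) :
    centralMap ((E.comp F).comp G) (E.comp (F.comp G)) y (tmul (E.comp F) G g (tmul E F f e)) =
      tmul E (F.comp G) (tmul F G g f) e :=
  centralMap_eq (by
    rw [chart_tmul _ _ (E.mem_base y) ((F.comp G).mem_base y),
      chart_tmul _ _ (F.mem_base y) (G.mem_base y),
      chart_tmul _ _ ((E.comp F).mem_base y) (G.mem_base y),
      chart_tmul _ _ (E.mem_base y) (F.mem_base y)]; rfl)

/-- The left unitor `e ⊗ a ↦ e a`. -/
def leftUnitor (E : Morita A B) : TwoIso ((Morita.id A).comp E) E :=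
  canonical _ _ fun x y h hE => by
    obtain ⟨p, hp⟩ := exists_norm_eq (A.hilb x) (zero_le_one (α := ℝ))
    obtain ⟨q, hq⟩ := exists_norm_eq (B.hilb x) (zero_le_one (α := ℝ))
    obtain ⟨e, he⟩ := (E.isChart x y hE).exists_eq (isCompactOperator_rankOne q p)
    obtain ⟨a, ha⟩ := ((Morita.id A).isChart x y h.1).exists_eq (isCompactOperator_rankOne p p)
    refine ⟨tmul (Morita.id A) E e a, ?_, ?_⟩
    · rw [chart_tmul _ _ h.1 h.2, he]
      rw [ha]
      intro h0
      simpa [hp, norm_ne_zero_iff.1 (hq.trans_ne one_ne_zero)] using congrArg (fun T => T p) h0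
    · rw [centralMap_leftUnitor]
      exact ((E.isChart x y hE).map_right a e).trans (chart_tmul _ _ h.1 h.2 e a).symm

/-- The right unitor `b ⊗ e ↦ b e`. -/
def rightUnitor (E : Morita A B) : TwoIso (E.comp (Morita.id B)) E :=
  canonical _ _ fun x y h hE => by
    obtain ⟨p, hp⟩ := exists_norm_eq (A.hilb x) (zero_le_one (α := ℝ))
    obtain ⟨q, hq⟩ := exists_norm_eq (B.hilb x) (zero_le_one (α := ℝ))
    obtain ⟨e, he⟩ := (E.isChart x y hE).exists_eq (isCompactOperator_rankOne q p)
    obtain ⟨b, hb⟩ := ((Morita.id B).isChart x y h.2).exists_eq (isCompactOperator_rankOne q q)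
    refine ⟨tmul E (Morita.id B) b e, ?_, ?_⟩
    · rw [chart_tmul _ _ h.1 h.2, he]
      rw [hb]
      intro h0
      simpa [hp, hq, norm_ne_zero_iff.1 (hq.trans_ne one_ne_zero)] using
        congrArg (fun T => T p) h0
    · rw [centralMap_rightUnitor]
      exact ((E.isChart x y hE).map_left b e).trans (chart_tmul _ _ h.1 h.2 b e).symm

/-- The associator `g ⊗ (f ⊗ e) ↦ (g ⊗ f) ⊗ e`. -/
def associator (E : Morita A B) (F : Morita B C) (G : Morita C D) :
    TwoIso ((E.comp F).comp G) (E.comp (F.comp G)) :=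
  canonical _ _ fun x y h h' => by
    obtain ⟨p, hp⟩ := exists_norm_eq (A.hilb x) (zero_le_one (α := ℝ))
    obtain ⟨q, hq⟩ := exists_norm_eq (B.hilb x) (zero_le_one (α := ℝ))
    obtain ⟨r, hr⟩ := exists_norm_eq (C.hilb x) (zero_le_one (α := ℝ))
    obtain ⟨s, hs⟩ := exists_norm_eq (D.hilb x) (zero_le_one (α := ℝ))
    obtain ⟨e, he⟩ := (E.isChart x y h.1.1).exists_eq (isCompactOperator_rankOne q p)
    obtain ⟨f, hf⟩ := (F.isChart x y h.1.2).exists_eq (isCompactOperator_rankOne r q)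
    obtain ⟨g, hg⟩ := (G.isChart x y h.2).exists_eq (isCompactOperator_rankOne s r)
    have h1 : ((E.comp F).comp G).chart x y (tmul (E.comp F) G g (tmul E F f e)) =
        G.chart x y g ∘L F.chart x y f ∘L E.chart x y e := by
      rw [chart_tmul _ _ h.1 h.2, chart_tmul _ _ h.1.1 h.1.2]
    refine ⟨tmul (E.comp F) G g (tmul E F f e), ?_, ?_⟩
    · rw [h1, he, hf, hg]
      intro h0
      simpa [hp, hq, hr, norm_ne_zero_iff.1 (hs.trans_ne one_ne_zero)] using
        congrArg (fun T => T p) h0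
    · rw [centralMap_associator, h1, chart_tmul _ _ h.1.1 h'.2, chart_tmul _ _ h.1.2 h.2]; rfl

theorem leftUnitor_tmul (E : Morita A B) {y : X} (e : E.fib y) (a : (Morita.id A).fib y) :
    (leftUnitor E).app y (tmul (Morita.id A) E e a) = E.right y a e :=
  centralMap_leftUnitor E e a

theorem rightUnitor_tmul (E : Morita A B) {y : X} (b : (Morita.id B).fib y) (e : E.fib y) :
    (rightUnitor E).app y (tmul E (Morita.id B) b e) = E.left y b e :=
  centralMap_rightUnitor E b e

theorem associator_tmul (E : Morita A B) (F : Morita B C) (G : Morita C D) {y : X}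
    (g : G.fib y) (f : F.fib y) (e : E.fib y) :
    (associator E F G).app y (tmul (E.comp F) G g (tmul E F f e)) =
      tmul E (F.comp G) (tmul F G g f) e :=
  centralMap_associator E F G g f e

end canonical

/-- The scalar by which a `2`-isomorphism acts in the charts centred at `y`. -/
def ph {E F : Morita A B} (τ : E ⟶ F) (y : X) : ℂ := TwoIso.scalar τ y y

theorem hom_ext {E F : Morita A B} {τ σ : E ⟶ F} (h : ∀ y, ph τ y = ph σ y) : τ = σ :=
  TwoIso.ext_scalar h

@[simp] theorem ph_id (E : Morita A B) (y : X) : ph (𝟙 E) y = 1 := TwoIso.scalar_refl y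

@[simp] theorem ph_comp {E F G : Morita A B} (τ : E ⟶ F) (σ : F ⟶ G) (y : X) :
    ph (τ ≫ σ) y = ph τ y * ph σ y := TwoIso.scalar_trans τ σ y

theorem ph_ne_zero {E F : Morita A B} (τ : E ⟶ F) (y : X) : ph τ y ≠ 0 :=
  norm_ne_zero_iff.1 (by
    rw [ph, TwoIso.norm_scalar τ (E.mem_base y) (F.mem_base y)]; exact one_ne_zero)

theorem ph_inv {E F : Morita A B} (τ : E ≅ F) (y : X) : ph τ.inv y = (ph τ.hom y)⁻¹ := by
  exact eq_inv_of_mul_eq_one_left (by rw [← ph_comp, τ.inv_hom_id, ph_id])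

@[simp] theorem ph_whiskerLeft (E : Morita A B) {F F' : Morita B C} (η : F ⟶ F') (y : X) :
    ph (E := E.comp F) (F := E.comp F') (whiskerLeft E η) y = ph η y := scalar_whiskerLeft E η y

@[simp] theorem ph_whiskerRight {E E' : Morita A B} (η : E ⟶ E') (F : Morita B C) (y : X) :
    ph (E := E.comp F) (F := E'.comp F) (whiskerRight η F) y = ph η y := scalar_whiskerRight η F y

@[simp] theorem ph_associator (E : Morita A B) (F : Morita B C) (G : Morita C D) (y : X) :
    ph (associator E F G).toIso.hom y = 1 := by
  change TwoIso.scalar (associator E F G) y y = 1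
  rw [associator]
  apply scalar_canonical

@[simp] theorem ph_leftUnitor (E : Morita A B) (y : X) : ph (leftUnitor E).toIso.hom y = 1 := by
  change TwoIso.scalar (leftUnitor E) y y = 1
  rw [leftUnitor]
  apply scalar_canonical

@[simp] theorem ph_rightUnitor (E : Morita A B) (y : X) : ph (rightUnitor E).toIso.hom y = 1 := by
  change TwoIso.scalar (rightUnitor E) y y = 1
  rw [rightUnitor]
  apply scalar_canonical

end Morita

/-- The bicategory of DD-bundles over `X`, Morita isomorphisms and `2`-isomorphisms. The composition
`E ≫ F` is `F ⊗_B E`. -/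
instance : Bicategory (DDBundle X) where
  Hom := Morita
  id := Morita.id
  comp := Morita.comp
  homCategory A B := inferInstanceAs (Category (Morita A B))
  whiskerLeft E _ _ η := Morita.whiskerLeft E η
  whiskerRight η F := Morita.whiskerRight η F
  associator E F G := (Morita.associator E F G).toIso
  leftUnitor E := (Morita.leftUnitor E).toIso
  rightUnitor E := (Morita.rightUnitor E).toIso
  whiskerLeft_id := by intros; exact Morita.hom_ext fun y => by simp [Morita.ph_inv, mul_comm]
  whiskerLeft_comp := by intros; exact Morita.hom_ext fun y => by simp [Morita.ph_inv, mul_comm]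
  id_whiskerLeft := by intros; exact Morita.hom_ext fun y => by simp [Morita.ph_inv, mul_comm]
  comp_whiskerLeft := by intros; exact Morita.hom_ext fun y => by simp [Morita.ph_inv, mul_comm]
  id_whiskerRight := by intros; exact Morita.hom_ext fun y => by simp [Morita.ph_inv, mul_comm]
  comp_whiskerRight := by intros; exact Morita.hom_ext fun y => by simp [Morita.ph_inv, mul_comm]
  whiskerRight_id := by intros; exact Morita.hom_ext fun y => by simp [Morita.ph_inv, mul_comm]
  whiskerRight_comp := by intros; exact Morita.hom_ext fun y => by simp [Morita.ph_inv, mul_comm]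
  whisker_assoc := by intros; exact Morita.hom_ext fun y => by simp [Morita.ph_inv, mul_comm]
  whisker_exchange := by intros; exact Morita.hom_ext fun y => by simp [Morita.ph_inv, mul_comm]
  pentagon := by intros; exact Morita.hom_ext fun y => by simp [Morita.ph_inv, mul_comm]
  triangle := by intros; exact Morita.hom_ext fun y => by simp [Morita.ph_inv, mul_comm]

namespace DDBundle
variable {A B C D : DDBundle X}

/-- The scalar by which a `2`-isomorphism acts in the charts centred at `y`. -/
def ph {E F : A ⟶ B} (τ : E ⟶ F) (y : X) : ℂ := Morita.ph τ y

theorem hom_ext {E F : A ⟶ B} {τ σ : E ⟶ F} (h : ∀ y, ph τ y = ph σ y) : τ = σ :=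
  Morita.hom_ext h

@[simp] theorem ph_id (E : A ⟶ B) (y : X) : ph (𝟙 E) y = 1 := Morita.ph_id E y

@[simp] theorem ph_comp {E F G : A ⟶ B} (τ : E ⟶ F) (σ : F ⟶ G) (y : X) :
    ph (τ ≫ σ) y = ph τ y * ph σ y := Morita.ph_comp τ σ y

theorem ph_ne_zero {E F : A ⟶ B} (τ : E ⟶ F) (y : X) : ph τ y ≠ 0 := Morita.ph_ne_zero τ y

@[simp] theorem ph_inv {E F : A ⟶ B} (τ : E ≅ F) (y : X) : ph τ.inv y = (ph τ.hom y)⁻¹ :=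
  Morita.ph_inv τ y

@[simp] theorem ph_whiskerLeft (E : A ⟶ B) {F F' : B ⟶ C} (η : F ⟶ F') (y : X) :
    ph (E ◁ η) y = ph η y := Morita.ph_whiskerLeft E η y

@[simp] theorem ph_whiskerRight {E E' : A ⟶ B} (η : E ⟶ E') (F : B ⟶ C) (y : X) :
    ph (η ▷ F) y = ph η y := Morita.ph_whiskerRight η F y

@[simp] theorem ph_associator (E : A ⟶ B) (F : B ⟶ C) (G : C ⟶ D) (y : X) :
    ph (α_ E F G).hom y = 1 := Morita.ph_associator E F G y

@[simp] theorem ph_leftUnitor (E : A ⟶ B) (y : X) : ph (λ_ E).hom y = 1 :=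
  Morita.ph_leftUnitor E y

@[simp] theorem ph_rightUnitor (E : A ⟶ B) (y : X) : ph (ρ_ E).hom y = 1 :=
  Morita.ph_rightUnitor E y

end DDBundle

/-! ### Pullback -/

section Pullback

variable {Y : Type v} [TopologicalSpace Y]

/-- The pullback of a DD-bundle along a continuous map. -/
def DDBundle.pullback (f : C(Y, X)) (A : DDBundle X) : DDBundle Y where
  fib y := A.fib (f y)
  hilb y := A.hilb (f y)
  base y := f ⁻¹' A.base (f y)
  isOpen_base y := (A.isOpen_base (f y)).preimage f.continuous
  mem_base y := A.mem_base (f y)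
  chart x y := A.chart (f x) (f y)
  isChart x y h := A.isChart (f x) (f y) h
  compat x₀ x₁ s x hx hs := continuousAt_transfer (A.chart (f x₀)) (A.chart (f x₁))
    (((A.isOpen_base (f x₀)).inter (A.isOpen_base (f x₁))).mem_nhds hx)
    (fun y hy => (A.isChart (f x₀) y hy.1).norm_map) (fun y hy => (A.isChart (f x₁) y hy.2).norm_map)
    (fun y hy => by rw [(A.isChart (f x₀) _ hx.1).range_eq, (A.isChart (f x₀) y hy.1).range_eq])
    (fun t => A.compat (f x₀) (f x₁) t (f x) hx) rfl f.continuous.continuousAt s hs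

namespace Morita
variable {A B C : DDBundle X}

/-- The pullback of a Morita isomorphism along a continuous map. -/
def pullback (f : C(Y, X)) (E : Morita A B) : Morita (A.pullback f) (B.pullback f) where
  fib y := E.fib (f y)
  left y := E.left (f y)
  right y := E.right (f y)
  base y := f ⁻¹' E.base (f y)
  isOpen_base y := (E.isOpen_base (f y)).preimage f.continuous
  mem_base y := E.mem_base (f y)
  base_subset y _ h := E.base_subset (f y) h
  chart x y := E.chart (f x) (f y)
  isChart x y h := E.isChart (f x) (f y) h
  compat x₀ x₁ s x hx hs := continuousAt_transfer (E.chart (f x₀)) (E.chart (f x₁))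
    (((E.isOpen_base (f x₀)).inter (E.isOpen_base (f x₁))).mem_nhds hx)
    (fun y hy => (E.isChart (f x₀) y hy.1).norm_map) (fun y hy => (E.isChart (f x₁) y hy.2).norm_map)
    (fun y hy => by rw [(E.isChart (f x₀) _ hx.1).range_eq, (E.isChart (f x₀) y hy.1).range_eq])
    (fun t => E.compat (f x₀) (f x₁) t (f x) hx) rfl f.continuous.continuousAt s hs

/-- The pullback of a `2`-isomorphism along a continuous map. -/
def TwoIso.pullback (f : C(Y, X)) {E F : Morita A B} (τ : TwoIso E F) :
    TwoIso (E.pullback f) (F.pullback f) where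
  app y := τ.app (f y)
  map_left y := τ.map_left (f y)
  map_right y := τ.map_right (f y)
  contAt s x h := by
    have hc : ContinuousAt (fun y => τ.scalar (f x) (f y)) x :=
      ContinuousAt.comp (g := τ.scalar (f x)) (τ.continuousAt_scalar (f x))
        f.continuous.continuousAt
    refine (hc.smul h).congr ?_
    filter_upwards [f.continuous.continuousAt (E.base_mem_nhds (f x)),
      f.continuous.continuousAt (F.base_mem_nhds (f x))] with y hE hF
    exact (τ.scalar_spec hE hF (s y)).symm

theorem TwoIso.scalar_pullback (f : C(Y, X)) {E F : Morita A B} (τ : TwoIso E F) (y : Y) :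
    (τ.pullback f).scalar y y = τ.scalar (f y) (f y) := rfl

end Morita

namespace DDBundle
variable {A B C : DDBundle X}

/-- The pullback of a Morita isomorphism, as a `1`-morphism. -/
def pullbackHom (f : C(Y, X)) (E : A ⟶ B) : A.pullback f ⟶ B.pullback f := Morita.pullback f E

/-- The pullback of a `2`-isomorphism, as a `2`-morphism. -/
def pullbackHom₂ (f : C(Y, X)) {E F : A ⟶ B} (τ : E ⟶ F) : pullbackHom f E ⟶ pullbackHom f F :=
  Morita.TwoIso.pullback f τ

/-- Pullback commutes with the identity Morita isomorphisms. -/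
def pullbackId (f : C(Y, X)) (A : DDBundle X) :
    pullbackHom f (𝟙 A) ≅ 𝟙 (A.pullback f) :=
  Iso.refl (Morita.id (A.pullback f))

/-- Pullback commutes with composition. -/
def pullbackComp (f : C(Y, X)) (E : A ⟶ B) (F : B ⟶ C) :
    pullbackHom f (E ≫ F) ≅ pullbackHom f E ≫ pullbackHom f F :=
  Iso.refl (Morita.comp (Morita.pullback f E) (Morita.pullback f F))

@[simp] theorem ph_pullbackId (f : C(Y, X)) (A : DDBundle X) (y : Y) :
    ph (pullbackId f A).hom y = 1 := Morita.ph_id _ y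

@[simp] theorem ph_pullbackComp (f : C(Y, X)) (E : A ⟶ B) (F : B ⟶ C) (y : Y) :
    ph (pullbackComp f E F).hom y = 1 :=
  Morita.ph_id (Morita.comp (Morita.pullback f E) (Morita.pullback f F)) y

@[simp] theorem ph_pullback (f : C(Y, X)) {E F : A ⟶ B} (τ : E ⟶ F) (y : Y) :
    ph (pullbackHom₂ f τ) y = ph τ (f y) := rfl

end DDBundle

/-- Restriction along a continuous map, from the bicategory of DD-bundles over `X` to the one
over `Y`. -/
def pullback (f : C(Y, X)) : DDBundle X ⥤ᵖ DDBundle Y where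
  obj A := A.pullback f
  map E := DDBundle.pullbackHom f E
  map₂ τ := DDBundle.pullbackHom₂ f τ
  mapId A := DDBundle.pullbackId f A
  mapComp E F := DDBundle.pullbackComp f E F
  map₂_id _ := rfl
  map₂_comp _ _ := rfl
  map₂_whisker_left := by intros; exact DDBundle.hom_ext fun y => by simp
  map₂_whisker_right := by intros; exact DDBundle.hom_ext fun y => by simp
  map₂_associator := by intros; exact DDBundle.hom_ext fun y => by simp
  map₂_left_unitor := by intros; exact DDBundle.hom_ext fun y => by simp
  map₂_right_unitor := by intros; exact DDBundle.hom_ext fun y => by simp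

end Pullback

/-- Pullback along the identity is the identity, strictly. -/
theorem pullback_id : pullback (ContinuousMap.id X) = Pseudofunctor.id (DDBundle X) := rfl

/-- Pullback along a composition is the composition of the pullbacks, strictly. -/
theorem pullback_comp {Y Z : Type*} [TopologicalSpace Y] [TopologicalSpace Z] (f : C(Y, X))
    (g : C(Z, Y)) :
    (pullback (f.comp g)).toPrelaxFunctor.toPrelaxFunctorStruct =
     ((pullback f).comp (pullback g)).toPrelaxFunctor.toPrelaxFunctorStruct := rfl

/-! ### The nerve of the Čech groupoid of an open cover

A point of the `k`-th space is a point of `M` together with `k + 1` indices of open sets that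
contain it; the maps between these spaces are the projections onto the indicated entries, so that
the first and the second entry of a `1`-simplex are its source and target. -/

namespace Cech
variable {M : Type u} [TopologicalSpace M] {I : Type v} (U : I → Opens M)

abbrev Γ₀ := Σ i : I, U i
abbrev Γ₁ := Σ i : I × I, (U i.1 ⊓ U i.2 : Opens M)
abbrev Γ₂ := Σ i : I × I × I, (U i.1 ⊓ (U i.2.1 ⊓ U i.2.2) : Opens M)
abbrev Γ₃ := Σ i : I × I × I × I, (U i.1 ⊓ (U i.2.1 ⊓ (U i.2.2.1 ⊓ U i.2.2.2)) : Opens M)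

/-- The projection from the disjoint union of the open sets to `M`. -/
def proj : C(Γ₀ U, M) where
  toFun z := z.2.1
  continuous_toFun := continuous_sigma fun _ => continuous_subtype_val

/-- The map of disjoint unions given by a map of index sets and inclusions. -/
def reindex {J K : Type*} {V : J → Opens M} {W : K → Opens M} (g : J → K) (h : ∀ j, V j ≤ W (g j)) :
    C(Σ j, V j, Σ k, W k) where
  toFun z := ⟨g z.1, z.2.1, h z.1 z.2.2⟩
  continuous_toFun := continuous_sigma fun j =>
    (continuous_sigmaMk (i := g j)).comp (continuous_inclusion (h j))

def v₀ : C(Γ₁ U, Γ₀ U) := reindex (fun i => i.1) fun _ _ h => h.1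
def v₁ : C(Γ₁ U, Γ₀ U) := reindex (fun i => i.2) fun _ _ h => h.2
def e₀₁ : C(Γ₂ U, Γ₁ U) := reindex (fun i => (i.1, i.2.1)) fun _ _ h => ⟨h.1, h.2.1⟩
def e₁₂ : C(Γ₂ U, Γ₁ U) := reindex (fun i => (i.2.1, i.2.2)) fun _ _ h => h.2
def e₀₂ : C(Γ₂ U, Γ₁ U) := reindex (fun i => (i.1, i.2.2)) fun _ _ h => ⟨h.1, h.2.2⟩
def t₀₁₂ : C(Γ₃ U, Γ₂ U) :=
  reindex (fun i => (i.1, i.2.1, i.2.2.1)) fun _ _ h => ⟨h.1, h.2.1, h.2.2.1⟩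
def t₀₁₃ : C(Γ₃ U, Γ₂ U) :=
  reindex (fun i => (i.1, i.2.1, i.2.2.2)) fun _ _ h => ⟨h.1, h.2.1, h.2.2.2⟩
def t₀₂₃ : C(Γ₃ U, Γ₂ U) :=
  reindex (fun i => (i.1, i.2.2.1, i.2.2.2)) fun _ _ h => ⟨h.1, h.2.2⟩
def t₁₂₃ : C(Γ₃ U, Γ₂ U) :=
  reindex (fun i => (i.2.1, i.2.2.1, i.2.2.2)) fun _ _ h => h.2

/-! The vertices of a `2`-simplex and the vertices and edges of a `3`-simplex. -/

def w₀ : C(Γ₂ U, Γ₀ U) := (v₀ U).comp (e₀₁ U)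
def w₁ : C(Γ₂ U, Γ₀ U) := (v₁ U).comp (e₀₁ U)
def w₂ : C(Γ₂ U, Γ₀ U) := (v₁ U).comp (e₁₂ U)
def x₀ : C(Γ₃ U, Γ₀ U) := (w₀ U).comp (t₀₁₂ U)
def x₁ : C(Γ₃ U, Γ₀ U) := (w₁ U).comp (t₀₁₂ U)
def x₂ : C(Γ₃ U, Γ₀ U) := (w₂ U).comp (t₀₁₂ U)
def x₃ : C(Γ₃ U, Γ₀ U) := (w₂ U).comp (t₁₂₃ U)
def f₀₁ : C(Γ₃ U, Γ₁ U) := (e₀₁ U).comp (t₀₁₂ U)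
def f₀₂ : C(Γ₃ U, Γ₁ U) := (e₀₂ U).comp (t₀₁₂ U)
def f₀₃ : C(Γ₃ U, Γ₁ U) := (e₀₂ U).comp (t₀₁₃ U)
def f₁₂ : C(Γ₃ U, Γ₁ U) := (e₁₂ U).comp (t₀₁₂ U)
def f₁₃ : C(Γ₃ U, Γ₁ U) := (e₁₂ U).comp (t₀₁₃ U)
def f₂₃ : C(Γ₃ U, Γ₁ U) := (e₁₂ U).comp (t₀₂₃ U)

/-! The simplicial identities, which hold by definition and are used tacitly below. -/

theorem proj_v : (proj U).comp (v₀ U) = (proj U).comp (v₁ U) := rfl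
theorem w₀_eq : (v₀ U).comp (e₀₂ U) = w₀ U := rfl
theorem w₁_eq : (v₀ U).comp (e₁₂ U) = w₁ U := rfl
theorem w₂_eq : (v₁ U).comp (e₀₂ U) = w₂ U := rfl
theorem f₀₁_eq : (e₀₁ U).comp (t₀₁₃ U) = f₀₁ U := rfl
theorem f₀₂_eq : (e₀₁ U).comp (t₀₂₃ U) = f₀₂ U := rfl
theorem f₀₃_eq : (e₀₂ U).comp (t₀₂₃ U) = f₀₃ U := rfl
theorem f₁₂_eq : (e₀₁ U).comp (t₁₂₃ U) = f₁₂ U := rfl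
theorem f₁₃_eq : (e₀₂ U).comp (t₁₂₃ U) = f₁₃ U := rfl
theorem f₂₃_eq : (e₁₂ U).comp (t₁₂₃ U) = f₂₃ U := rfl

variable {U} {A A' A'' A''' : DDBundle (Γ₀ U)}

/-! Pullbacks of a `1`-morphism `E : v₀^* A ⟶ v₁^* A` to the edges of `2`- and `3`-simplices. -/

section Edges
variable (E : A.pullback (v₀ U) ⟶ A.pullback (v₁ U))

def hom₀₁ : A.pullback (w₀ U) ⟶ A.pullback (w₁ U) := DDBundle.pullbackHom (e₀₁ U) E
def hom₁₂ : A.pullback (w₁ U) ⟶ A.pullback (w₂ U) := DDBundle.pullbackHom (e₁₂ U) E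
def hom₀₂ : A.pullback (w₀ U) ⟶ A.pullback (w₂ U) := DDBundle.pullbackHom (e₀₂ U) E
def edge₀₁ : A.pullback (x₀ U) ⟶ A.pullback (x₁ U) := DDBundle.pullbackHom (f₀₁ U) E
def edge₀₂ : A.pullback (x₀ U) ⟶ A.pullback (x₂ U) := DDBundle.pullbackHom (f₀₂ U) E
def edge₀₃ : A.pullback (x₀ U) ⟶ A.pullback (x₃ U) := DDBundle.pullbackHom (f₀₃ U) E
def edge₁₂ : A.pullback (x₁ U) ⟶ A.pullback (x₂ U) := DDBundle.pullbackHom (f₁₂ U) E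
def edge₁₃ : A.pullback (x₁ U) ⟶ A.pullback (x₃ U) := DDBundle.pullbackHom (f₁₃ U) E
def edge₂₃ : A.pullback (x₂ U) ⟶ A.pullback (x₃ U) := DDBundle.pullbackHom (f₂₃ U) E

/-! Pullbacks of a `2`-morphism `τ` to the faces of `3`-simplices. -/

variable {E} (τ : hom₀₁ E ≫ hom₁₂ E ⟶ hom₀₂ E)

def face₀₁₂ : edge₀₁ E ≫ edge₁₂ E ⟶ edge₀₂ E := DDBundle.pullbackHom₂ (t₀₁₂ U) τ
def face₀₁₃ : edge₀₁ E ≫ edge₁₃ E ⟶ edge₀₃ E := DDBundle.pullbackHom₂ (t₀₁₃ U) τ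
def face₀₂₃ : edge₀₂ E ≫ edge₂₃ E ⟶ edge₀₃ E := DDBundle.pullbackHom₂ (t₀₂₃ U) τ
def face₁₂₃ : edge₁₂ E ≫ edge₂₃ E ⟶ edge₁₃ E := DDBundle.pullbackHom₂ (t₁₂₃ U) τ

theorem coh_iff : face₀₁₂ τ ▷ edge₂₃ E ≫ face₀₂₃ τ =
    (α_ (edge₀₁ E) (edge₁₂ E) (edge₂₃ E)).hom ≫ edge₀₁ E ◁ face₁₂₃ τ ≫ face₀₁₃ τ ↔
    ∀ z, DDBundle.ph τ (t₀₁₂ U z) * DDBundle.ph τ (t₀₂₃ U z) =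
      DDBundle.ph τ (t₁₂₃ U z) * DDBundle.ph τ (t₀₁₃ U z) := by
  have h1 z : DDBundle.ph (face₀₁₂ τ) z = DDBundle.ph τ (t₀₁₂ U z) := rfl
  have h2 z : DDBundle.ph (face₀₁₃ τ) z = DDBundle.ph τ (t₀₁₃ U z) := rfl
  have h3 z : DDBundle.ph (face₀₂₃ τ) z = DDBundle.ph τ (t₀₂₃ U z) := rfl
  have h4 z : DDBundle.ph (face₁₂₃ τ) z = DDBundle.ph τ (t₁₂₃ U z) := rfl
  refine ⟨fun h z => ?_, fun h => DDBundle.hom_ext fun z => ?_⟩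
  · simpa [h1, h2, h3, h4] using congrArg (fun σ => DDBundle.ph σ z) h
  · simpa [h1, h2, h3, h4] using h z

end Edges

/-! Pullbacks of a `2`-morphism over `Γ₁` to the edges of `2`-simplices. -/

section Squares
variable {E : A.pullback (v₀ U) ⟶ A.pullback (v₁ U)} {E' : A'.pullback (v₀ U) ⟶ A'.pullback (v₁ U)}
  {F : A ⟶ A'} (α : DDBundle.pullbackHom (v₀ U) F ≫ E' ⟶ E ≫ DDBundle.pullbackHom (v₁ U) F)

def sq₀₁ : DDBundle.pullbackHom (w₀ U) F ≫ hom₀₁ E' ⟶ hom₀₁ E ≫ DDBundle.pullbackHom (w₁ U) F :=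
  DDBundle.pullbackHom₂ (e₀₁ U) α
def sq₁₂ : DDBundle.pullbackHom (w₁ U) F ≫ hom₁₂ E' ⟶ hom₁₂ E ≫ DDBundle.pullbackHom (w₂ U) F :=
  DDBundle.pullbackHom₂ (e₁₂ U) α
def sq₀₂ : DDBundle.pullbackHom (w₀ U) F ≫ hom₀₂ E' ⟶ hom₀₂ E ≫ DDBundle.pullbackHom (w₂ U) F :=
  DDBundle.pullbackHom₂ (e₀₂ U) α

@[simp] theorem ph_sq₀₁ (z) : DDBundle.ph (sq₀₁ α) z = DDBundle.ph α (e₀₁ U z) := rfl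
@[simp] theorem ph_sq₁₂ (z) : DDBundle.ph (sq₁₂ α) z = DDBundle.ph α (e₁₂ U z) := rfl
@[simp] theorem ph_sq₀₂ (z) : DDBundle.ph (sq₀₂ α) z = DDBundle.ph α (e₀₂ U z) := rfl

theorem sq_coh_iff (τ : hom₀₁ E ≫ hom₁₂ E ⟶ hom₀₂ E) (τ' : hom₀₁ E' ≫ hom₁₂ E' ⟶ hom₀₂ E') :
    sq₀₁ α ▷ hom₁₂ E' ≫ (α_ (hom₀₁ E) (DDBundle.pullbackHom (w₁ U) F) (hom₁₂ E')).hom ≫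
      hom₀₁ E ◁ sq₁₂ α ≫ (α_ (hom₀₁ E) (hom₁₂ E) (DDBundle.pullbackHom (w₂ U) F)).inv ≫
        τ ▷ DDBundle.pullbackHom (w₂ U) F =
    (α_ (DDBundle.pullbackHom (w₀ U) F) (hom₀₁ E') (hom₁₂ E')).hom ≫
      DDBundle.pullbackHom (w₀ U) F ◁ τ' ≫ sq₀₂ α ↔
    ∀ z, DDBundle.ph α (e₀₁ U z) * (DDBundle.ph α (e₁₂ U z) * DDBundle.ph τ z) =
      DDBundle.ph τ' z * DDBundle.ph α (e₀₂ U z) := by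
  refine ⟨fun h z => ?_, fun h => DDBundle.hom_ext fun z => ?_⟩
  · simpa using congrArg (fun σ => DDBundle.ph σ z) h
  · simpa using h z

end Squares

end Cech

open Cech

/-- An object of the descent bicategory of the cover `U`: a DD-bundle `A` on the disjoint union of
the open sets with a Morita isomorphism `E` between its two pullbacks to double intersections and
a `2`-isomorphism `τ` over triple intersections that is coherent over quadruple intersections. -/
structure Desc {M : Type u} [TopologicalSpace M] {I : Type v} (U : I → Opens M) where
  A : DDBundle (Γ₀ U)
  E : A.pullback (v₀ U) ⟶ A.pullback (v₁ U)
  τ : hom₀₁ E ≫ hom₁₂ E ⟶ hom₀₂ E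
  coh : face₀₁₂ τ ▷ edge₂₃ E ≫ face₀₂₃ τ =
    (α_ (edge₀₁ E) (edge₁₂ E) (edge₂₃ E)).hom ≫ edge₀₁ E ◁ face₁₂₃ τ ≫ face₀₁₃ τ

namespace Desc
variable {M : Type u} [TopologicalSpace M] {I : Type v} {U : I → Opens M}

/-- A `1`-morphism `(F, α)` of the descent bicategory: `F` over the open sets and `α` over double
intersections, compatible with `τ` over triple intersections. -/
structure Hom₁ (P Q : Desc U) where
  F : P.A ⟶ Q.A
  α : DDBundle.pullbackHom (v₀ U) F ≫ Q.E ⟶ P.E ≫ DDBundle.pullbackHom (v₁ U) F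
  coh : sq₀₁ α ▷ hom₁₂ Q.E ≫ (α_ (hom₀₁ P.E) (DDBundle.pullbackHom (w₁ U) F) (hom₁₂ Q.E)).hom ≫
      hom₀₁ P.E ◁ sq₁₂ α ≫ (α_ (hom₀₁ P.E) (hom₁₂ P.E) (DDBundle.pullbackHom (w₂ U) F)).inv ≫
        P.τ ▷ DDBundle.pullbackHom (w₂ U) F =
    (α_ (DDBundle.pullbackHom (w₀ U) F) (hom₀₁ Q.E) (hom₁₂ Q.E)).hom ≫
      DDBundle.pullbackHom (w₀ U) F ◁ Q.τ ≫ sq₀₂ α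

/-- A `2`-morphism of the descent bicategory: a `2`-morphism over the open sets that commutes with
`α` over double intersections. -/
@[ext] structure Hom₂ {P Q : Desc U} (f g : Hom₁ P Q) where
  β : f.F ⟶ g.F
  comm : DDBundle.pullbackHom₂ (v₀ U) β ▷ Q.E ≫ g.α = f.α ≫ P.E ◁ DDBundle.pullbackHom₂ (v₁ U) β

theorem Hom₁.ph_coh {P Q : Desc U} (f : Hom₁ P Q) (z : Γ₂ U) :
    DDBundle.ph f.α (e₀₁ U z) * (DDBundle.ph f.α (e₁₂ U z) * DDBundle.ph P.τ z) =
      DDBundle.ph Q.τ z * DDBundle.ph f.α (e₀₂ U z) :=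
  (sq_coh_iff f.α P.τ Q.τ).1 f.coh z

theorem Hom₂.ph_comm {P Q : Desc U} {f g : Hom₁ P Q} (b : Hom₂ f g) (z : Γ₁ U) :
    DDBundle.ph b.β (v₀ U z) * DDBundle.ph g.α z =
      DDBundle.ph f.α z * DDBundle.ph b.β (v₁ U z) := by
  simpa using congrArg (fun σ => DDBundle.ph σ z) b.comm

instance (P Q : Desc U) : Category (Hom₁ P Q) where
  Hom := Hom₂
  id f := ⟨𝟙 f.F, DDBundle.hom_ext fun z => by simp⟩
  comp b c := ⟨b.β ≫ c.β, DDBundle.hom_ext fun z => by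
    have h1 := b.ph_comm z
    have h2 := c.ph_comm z
    simp
    linear_combination (DDBundle.ph b.β (v₀ U z)) * h2 + (DDBundle.ph c.β (v₁ U z)) * h1⟩
  id_comp b := Hom₂.ext (Category.id_comp b.β)
  comp_id b := Hom₂.ext (Category.comp_id b.β)
  assoc b c d := Hom₂.ext (Category.assoc b.β c.β d.β)

/-- The identity `1`-morphism. -/
def id₁ (P : Desc U) : Hom₁ P P where
  F := 𝟙 P.A
  α := (DDBundle.pullbackId (v₀ U) P.A).hom ▷ P.E ≫ (λ_ P.E).hom ≫ (ρ_ P.E).inv ≫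
    P.E ◁ (DDBundle.pullbackId (v₁ U) P.A).inv
  coh := DDBundle.hom_ext fun z => by simp

/-- Composition of `1`-morphisms. -/
def comp₁ {P Q R : Desc U} (f : Hom₁ P Q) (g : Hom₁ Q R) : Hom₁ P R where
  F := f.F ≫ g.F
  α := (DDBundle.pullbackComp (v₀ U) f.F g.F).hom ▷ R.E ≫
    (α_ (DDBundle.pullbackHom (v₀ U) f.F) (DDBundle.pullbackHom (v₀ U) g.F) R.E).hom ≫
    DDBundle.pullbackHom (v₀ U) f.F ◁ g.α ≫
    (α_ (DDBundle.pullbackHom (v₀ U) f.F) Q.E (DDBundle.pullbackHom (v₁ U) g.F)).inv ≫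
    f.α ▷ DDBundle.pullbackHom (v₁ U) g.F ≫
    (α_ P.E (DDBundle.pullbackHom (v₁ U) f.F) (DDBundle.pullbackHom (v₁ U) g.F)).hom ≫
    P.E ◁ (DDBundle.pullbackComp (v₁ U) f.F g.F).inv
  coh := DDBundle.hom_ext fun z => by
    have h1 := f.ph_coh z
    have h2 := g.ph_coh z
    simp
    linear_combination (DDBundle.ph g.α (e₀₁ U z) * DDBundle.ph g.α (e₁₂ U z)) * h1 +
      DDBundle.ph f.α (e₀₂ U z) * h2

@[simp] theorem ph_id₁ (P : Desc U) (z : Γ₁ U) : DDBundle.ph (id₁ P).α z = 1 := by simp [id₁]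

@[simp] theorem ph_comp₁ {P Q R : Desc U} (f : Hom₁ P Q) (g : Hom₁ Q R) (z : Γ₁ U) :
    DDBundle.ph (comp₁ f g).α z = DDBundle.ph g.α z * DDBundle.ph f.α z := by simp [comp₁]

/-- The commutation relation in terms of scalars. -/
def Hom₂.ofPh {P Q : Desc U} {f g : Hom₁ P Q} (b : f.F ⟶ g.F) {c₀ c₁ d d' : Γ₁ U → ℂ}
    (h₀ : ∀ z, DDBundle.ph b (v₀ U z) = c₀ z) (h₁ : ∀ z, DDBundle.ph b (v₁ U z) = c₁ z)
    (hf : ∀ z, DDBundle.ph f.α z = d z) (hg : ∀ z, DDBundle.ph g.α z = d' z)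
    (h : ∀ z, c₀ z * d' z = d z * c₁ z) : Hom₂ f g :=
  ⟨b, DDBundle.hom_ext fun z => by simp [h₀, h₁, hf, hg, h]⟩

/-- A `2`-morphism is invertible, since the underlying `2`-isomorphism is. -/
def mkIso {P Q : Desc U} {f g : Hom₁ P Q} (b : f.F ≅ g.F) (c : Hom₂ f g) (h : c.β = b.hom) :
    f ≅ g where
  hom := c
  inv := ⟨b.inv, DDBundle.hom_ext fun z => by
    have hc := c.ph_comm z
    rw [h] at hc
    have h0 := DDBundle.ph_ne_zero b.hom (v₀ U z)
    have h1 := DDBundle.ph_ne_zero b.hom (v₁ U z)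
    simp
    field_simp
    linear_combination - hc⟩
  hom_inv_id := Hom₂.ext ((congrArg (· ≫ b.inv) h).trans b.hom_inv_id)
  inv_hom_id := Hom₂.ext ((congrArg (b.inv ≫ ·) h).trans b.inv_hom_id)

/-- Whiskering. -/
def whiskerLeft {P Q R : Desc U} (f : Hom₁ P Q) {g g' : Hom₁ Q R} (b : Hom₂ g g') :
    Hom₂ (comp₁ f g) (comp₁ f g') :=
  Hom₂.ofPh (f.F ◁ b.β) (fun _ => DDBundle.ph_whiskerLeft _ _ _)
    (fun _ => DDBundle.ph_whiskerLeft _ _ _) (ph_comp₁ f g) (ph_comp₁ f g')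
    (fun z => by linear_combination DDBundle.ph f.α z * b.ph_comm z)

/-- Whiskering. -/
def whiskerRight {P Q R : Desc U} {f f' : Hom₁ P Q} (b : Hom₂ f f') (g : Hom₁ Q R) :
    Hom₂ (comp₁ f g) (comp₁ f' g) :=
  Hom₂.ofPh (b.β ▷ g.F) (fun _ => DDBundle.ph_whiskerRight _ _ _)
    (fun _ => DDBundle.ph_whiskerRight _ _ _) (ph_comp₁ f g) (ph_comp₁ f' g)
    (fun z => by linear_combination DDBundle.ph g.α z * b.ph_comm z)

/-- The associator. -/
def associator {P Q R S : Desc U} (f : Hom₁ P Q) (g : Hom₁ Q R) (h : Hom₁ R S) :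
    comp₁ (comp₁ f g) h ≅ comp₁ f (comp₁ g h) :=
  mkIso (f := comp₁ (comp₁ f g) h) (g := comp₁ f (comp₁ g h)) (α_ f.F g.F h.F)
    (Hom₂.ofPh (f := comp₁ (comp₁ f g) h) (g := comp₁ f (comp₁ g h)) (α_ f.F g.F h.F).hom
      (fun _ => DDBundle.ph_associator _ _ _ _) (fun _ => DDBundle.ph_associator _ _ _ _)
      (ph_comp₁ (comp₁ f g) h) (ph_comp₁ f (comp₁ g h))
      (fun z => by rw [ph_comp₁, ph_comp₁]; ring)) rfl

/-- The left unitor. -/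
def leftUnitor {P Q : Desc U} (f : Hom₁ P Q) : comp₁ (id₁ P) f ≅ f :=
  mkIso (f := comp₁ (id₁ P) f) (g := f) (λ_ f.F)
    (Hom₂.ofPh (f := comp₁ (id₁ P) f) (g := f) (λ_ f.F).hom
      (fun _ => DDBundle.ph_leftUnitor _ _) (fun _ => DDBundle.ph_leftUnitor _ _)
      (ph_comp₁ (id₁ P) f) (fun _ => rfl) (fun z => by rw [ph_id₁]; ring)) rfl

/-- The right unitor. -/
def rightUnitor {P Q : Desc U} (f : Hom₁ P Q) : comp₁ f (id₁ Q) ≅ f :=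
  mkIso (f := comp₁ f (id₁ Q)) (g := f) (ρ_ f.F)
    (Hom₂.ofPh (f := comp₁ f (id₁ Q)) (g := f) (ρ_ f.F).hom
      (fun _ => DDBundle.ph_rightUnitor _ _) (fun _ => DDBundle.ph_rightUnitor _ _)
      (ph_comp₁ f (id₁ Q)) (fun _ => rfl) (fun z => by rw [ph_id₁]; ring)) rfl

/-- The descent bicategory. -/
instance : Bicategory (Desc U) where
  Hom := Hom₁
  id := id₁
  comp := comp₁
  homCategory P Q := inferInstanceAs (Category (Hom₁ P Q))
  whiskerLeft f _ _ b := whiskerLeft f b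
  whiskerRight b g := whiskerRight b g
  associator := associator
  leftUnitor := leftUnitor
  rightUnitor := rightUnitor
  whiskerLeft_id f g := Hom₂.ext (Bicategory.whiskerLeft_id f.F g.F)
  whiskerLeft_comp f _ _ _ b c := Hom₂.ext (Bicategory.whiskerLeft_comp f.F b.β c.β)
  id_whiskerLeft b := Hom₂.ext (Bicategory.id_whiskerLeft b.β)
  comp_whiskerLeft f g _ _ b := Hom₂.ext (Bicategory.comp_whiskerLeft f.F g.F b.β)
  id_whiskerRight f g := Hom₂.ext (Bicategory.id_whiskerRight f.F g.F)
  comp_whiskerRight b c g := Hom₂.ext (Bicategory.comp_whiskerRight b.β c.β g.F)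
  whiskerRight_id b := Hom₂.ext (Bicategory.whiskerRight_id b.β)
  whiskerRight_comp b g h := Hom₂.ext (Bicategory.whiskerRight_comp b.β g.F h.F)
  whisker_assoc f _ _ b h := Hom₂.ext (Bicategory.whisker_assoc f.F b.β h.F)
  whisker_exchange b c := Hom₂.ext (Bicategory.whisker_exchange b.β c.β)
  pentagon f g h i := Hom₂.ext (Bicategory.pentagon f.F g.F h.F i.F)
  triangle f g := Hom₂.ext (Bicategory.triangle f.F g.F)

end Desc

/-! ### Restriction to an open cover -/

section Restriction
variable {M : Type u} [TopologicalSpace M] {I : Type v} (U : I → Opens M)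

/-- The restriction `(π^* A, 𝟙, 𝟙 ≫ 𝟙 ≅ 𝟙)` of a DD-bundle over `M`, where
`π ∘ v₀ = π ∘ v₁`. -/
def restrictObj (A : DDBundle M) : Desc U where
  A := A.pullback (proj U)
  E := 𝟙 ((A.pullback (proj U)).pullback (v₀ U))
  τ := (λ_ (𝟙 ((A.pullback (proj U)).pullback (w₀ U)))).hom
  coh := (coh_iff _).2 fun z => by
    have h : ∀ z, DDBundle.ph (λ_ (𝟙 ((A.pullback (proj U)).pullback (w₀ U)))).hom z = 1 :=
      DDBundle.ph_leftUnitor _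
    exact (congrArg₂ (· * ·) (h _) (h _)).trans (congrArg₂ (· * ·) (h _) (h _)).symm

theorem ph_restrictObj (A : DDBundle M) (z : Γ₂ U) : DDBundle.ph (restrictObj U A).τ z = 1 :=
  DDBundle.ph_leftUnitor (𝟙 ((A.pullback (proj U)).pullback (w₀ U))) z

/-- The restriction `(π^* E, π^* E ≫ 𝟙 ≅ 𝟙 ≫ π^* E)` of a Morita isomorphism over `M`. -/
def restrictHom {A B : DDBundle M} (E : A ⟶ B) : Desc.Hom₁ (restrictObj U A) (restrictObj U B) where
  F := DDBundle.pullbackHom (proj U) E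
  α := (ρ_ (DDBundle.pullbackHom (v₀ U) (DDBundle.pullbackHom (proj U) E))).hom ≫
    (λ_ (DDBundle.pullbackHom (v₀ U) (DDBundle.pullbackHom (proj U) E))).inv
  coh := (sq_coh_iff _ (restrictObj U A).τ (restrictObj U B).τ).2 fun z => by
    have h : ∀ z, DDBundle.ph ((ρ_ (DDBundle.pullbackHom (v₀ U) (DDBundle.pullbackHom (proj U) E))).hom ≫
        (λ_ (DDBundle.pullbackHom (v₀ U) (DDBundle.pullbackHom (proj U) E))).inv) z = 1 := by
      intro z; simp
    rw [ph_restrictObj, ph_restrictObj, mul_one, one_mul]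
    exact ((congrArg₂ (· * ·) (h _) (h _)).trans (one_mul 1)).trans (h _).symm

theorem ph_restrictHom {A B : DDBundle M} (E : A ⟶ B) (z : Γ₁ U) :
    DDBundle.ph (restrictHom U E).α z = 1 := by
  have h : DDBundle.ph ((ρ_ (DDBundle.pullbackHom (v₀ U) (DDBundle.pullbackHom (proj U) E))).hom ≫
      (λ_ (DDBundle.pullbackHom (v₀ U) (DDBundle.pullbackHom (proj U) E))).inv) z = 1 := by simp
  exact h

/-- The restriction of a `2`-isomorphism. -/
def restrictHom₂ {A B : DDBundle M} {E F : A ⟶ B} (τ : E ⟶ F) :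
    Desc.Hom₂ (restrictHom U E) (restrictHom U F) :=
  Desc.Hom₂.ofPh (f := restrictHom U E) (g := restrictHom U F) (DDBundle.pullbackHom₂ (proj U) τ)
    (fun _ => DDBundle.ph_pullback _ _ _) (fun _ => DDBundle.ph_pullback _ _ _)
    (ph_restrictHom U E) (ph_restrictHom U F) (fun z => by rw [mul_one, one_mul]; rfl)

/-- Restriction commutes with identities. -/
def restrictId (A : DDBundle M) : restrictHom U (𝟙 A) ≅ Desc.id₁ (restrictObj U A) :=
  Desc.mkIso (f := restrictHom U (𝟙 A)) (g := Desc.id₁ (restrictObj U A))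
    (DDBundle.pullbackId (proj U) A)
    (Desc.Hom₂.ofPh (f := restrictHom U (𝟙 A)) (g := Desc.id₁ (restrictObj U A))
      (DDBundle.pullbackId (proj U) A).hom (fun _ => DDBundle.ph_pullbackId _ _ _)
      (fun _ => DDBundle.ph_pullbackId _ _ _) (ph_restrictHom U _) (Desc.ph_id₁ _)
      (fun _ => rfl)) rfl

/-- Restriction commutes with composition. -/
def restrictComp {A B C : DDBundle M} (E : A ⟶ B) (F : B ⟶ C) :
    restrictHom U (E ≫ F) ≅ Desc.comp₁ (restrictHom U E) (restrictHom U F) :=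
  Desc.mkIso (f := restrictHom U (E ≫ F)) (g := Desc.comp₁ (restrictHom U E) (restrictHom U F))
    (DDBundle.pullbackComp (proj U) E F)
    (Desc.Hom₂.ofPh (f := restrictHom U (E ≫ F))
      (g := Desc.comp₁ (restrictHom U E) (restrictHom U F))
      (DDBundle.pullbackComp (proj U) E F).hom (fun _ => DDBundle.ph_pullbackComp _ _ _ _)
      (fun _ => DDBundle.ph_pullbackComp _ _ _ _) (ph_restrictHom U _) (Desc.ph_comp₁ _ _)
      (fun _ => by rw [ph_restrictHom, ph_restrictHom, one_mul])) rfl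

/-- The restriction pseudofunctor from DD-bundles over `M` to the descent bicategory. -/
def restriction : DDBundle M ⥤ᵖ Desc U where
  obj := restrictObj U
  map := restrictHom U
  map₂ := restrictHom₂ U
  mapId := restrictId U
  mapComp := restrictComp U
  map₂_id _ := rfl
  map₂_comp _ _ := rfl
  map₂_whisker_left E _ _ η := Desc.Hom₂.ext ((pullback (proj U)).map₂_whisker_left E η)
  map₂_whisker_right η F := Desc.Hom₂.ext ((pullback (proj U)).map₂_whisker_right η F)
  map₂_associator E F G := Desc.Hom₂.ext ((pullback (proj U)).map₂_associator E F G)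
  map₂_left_unitor E := Desc.Hom₂.ext ((pullback (proj U)).map₂_left_unitor E)
  map₂_right_unitor E := Desc.Hom₂.ext ((pullback (proj U)).map₂_right_unitor E)

end Restriction

/-- A pseudofunctor is an equivalence of bicategories if it is an equivalence on all categories
of `1`-morphisms and every object of the target is equivalent to one in the image. -/
def IsBiequivalence {B : Type*} [Bicategory B] {C : Type*} [Bicategory C] (F : B ⥤ᵖ C) : Prop :=
  (∀ a b : B, (F.mapFunctor a b).IsEquivalence) ∧
    ∀ c : C, ∃ b : B, Nonempty (Bicategory.Equivalence (F.obj b) c)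

end DixmierDouady
end

open scoped Manifold ContDiff

set_option linter.unusedSectionVars false
set_option linter.unusedSimpArgs false

noncomputable section

namespace DixmierDouady

open CategoryTheory Bicategory TopologicalSpace UniformSpace Topology
open scoped TensorProduct InnerProduct

/-! By Schur's lemma a bimodule map between copies of `K(H, H')` is a scalar. A 2-arrow over X is
therefore a function from X to the circle (its scalars `ph` in the charts centred at the points)
subject to a continuity condition, and every equation between 2-arrows is an equation between such
functions, in which all structural 2-arrows count as 1. The continuity condition is recorded by
`chartPhase`: arbitrarily chosen, in general discontinuous unitaries `implement` compare each chart
of a DD-bundle with the chart centred at the point, and a chart of a Morita isomorphism differs from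
the conjugation by them in a circle factor. A function s belongs to a 2-arrow from E to F exactly if
s · chartPhase F x / chartPhase E x is continuous at x for every x (`TwoIso.ofPhase`,
`TwoIso.continuousAt_phase`).

2-arrows: between restrictions, the condition over double overlaps says that the scalars agree on
all sheets over a point of M, so they descend.

1-arrows: choose one sheet `idx x` over each point x. The cocycle condition makes α a pointwise
coboundary: its value on an edge is the quotient of the values of `gauge` at the two ends, where
`gauge` is α on the edge from the chosen sheet. Changing the charts of F by `gauge` glues F to a
Morita isomorphism over M (`descend`), and `gauge` is the scalar function of the comparison with F.

Objects: one level up, τ is the coboundary of its values on triangles with a vertex on the chosen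
sheet. With this normalization the fibres of E become spaces of compact operators and τ becomes
composition, but with discontinuous phases. The functions that repair continuity (`Good`) are the
local unit sections of line bundles L(p, p') with products L(p', p'') ⊗ L(p, p') → L(p, p''), a
twisted line bundle on M. A Hilbert bundle W twisted in the same way has an honest bundle of compact
operators, because phases disappear under conjugation, and the compact operators from W to A form a
Morita isomorphism from the pullback of K(W) to A (`descMorita`).

Existence of W (`nonempty_twistedFrames`): take the direct sum of infinitely many copies of the
lines attached to countably many local data, each only over its own domain. The dimension of a
summand jumps at the boundary of its domain, but the sum is locally trivial: near a point one
summand with its infinite multiplicity is present throughout, and Gram-Schmidt applied to the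
sections η m + 2⁻ʲ e j, with e j in this summand and η m running infinitely often through the
cut-off sections of the others, gives a continuous orthonormal basis.

Finally, every 1-arrow of the descent bicategory is an equivalence (`Desc.equivalence`), so a
1-arrow out of a restricted bundle is all that is needed. -/

section
-- Compact operators, unitary operators and conjugation
section CompactOperators
variable {H K L : Type*} [NormedAddCommGroup H] [InnerProductSpace ℂ H] [CompleteSpace H]
  [NormedAddCommGroup K] [InnerProductSpace ℂ K] [CompleteSpace K]
  [NormedAddCommGroup L] [InnerProductSpace ℂ L] [CompleteSpace L]

/-- The adjoint of a compact operator between Hilbert spaces is compact. -/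
theorem isCompactOperator_adjoint {T : H →L[ℂ] K} (hT : IsCompactOperator T) :
    IsCompactOperator (ContinuousLinearMap.adjoint T) := by
  have hcl : IsClosed {S : H →L[ℂ] K | IsCompactOperator (ContinuousLinearMap.adjoint S)} :=
    isClosed_setOfPred_isCompactOperator.preimage
      (ContinuousLinearMap.adjoint (𝕜 := ℂ) (E := H) (F := K)).continuous
  have hmem : T ∈ closure {S : H →L[ℂ] K | IsCompactOperator (ContinuousLinearMap.adjoint S)} := by
    rw [Metric.mem_closure_iff]
    intro e he
    -- Factoring through `ℂ` gives finite-rank approximations, whose adjoints again factor through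
    -- `ℂ`.
    obtain ⟨n, S, R, hS, hR, h⟩ := exists_approx (K := ℂ) T hT (half_pos he)
    refine ⟨∑ i, S i ∘L R i, ?_, by rw [dist_eq_norm]; exact h.trans_lt (half_lt_self he)⟩
    rw [Set.mem_ofPred_eq, map_sum]
    have : ∀ s : Finset (Fin n), IsCompactOperator
        (∑ i ∈ s, ContinuousLinearMap.adjoint (S i ∘L R i) : K →L[ℂ] H) := by
      intro s
      induction s using Finset.cons_induction with
      | empty => simpa using isCompactOperator_zero
      | cons i s hi ih =>
        rw [Finset.sum_cons]
        refine IsCompactOperator.add ?_ ih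
        rw [ContinuousLinearMap.adjoint_comp]
        exact (isCompactOperator_of_locallyCompactSpace_rng
          (ContinuousLinearMap.adjoint (R i))).comp_clm (ContinuousLinearMap.adjoint (S i))
    exact this _
  rwa [hcl.closure_eq] at hmem

variable (H) in
/-- The `C⋆`-algebra of compact operators on a Hilbert space. -/
def compactAlgebra : NonUnitalStarSubalgebra ℂ (H →L[ℂ] H) where
  carrier := {T | IsCompactOperator T}
  add_mem' := IsCompactOperator.add
  zero_mem' := isCompactOperator_zero
  mul_mem' := fun {_ T} hS _ => hS.comp_clm T
  smul_mem' := fun c _ hT => hT.smul c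
  star_mem' := isCompactOperator_adjoint

instance : IsClosed (compactAlgebra H : Set (H →L[ℂ] H)) := isClosed_setOfPred_isCompactOperator

/-- A unitary operator between Hilbert spaces. -/
structure IsUnitaryMap (u : H →L[ℂ] K) : Prop where
  adjoint_comp : ContinuousLinearMap.adjoint u ∘L u = ContinuousLinearMap.id ℂ H
  comp_adjoint : u ∘L ContinuousLinearMap.adjoint u = ContinuousLinearMap.id ℂ K

namespace IsUnitaryMap

theorem adjoint_apply {u : H →L[ℂ] K} (h : IsUnitaryMap u) (x : H) :
    ContinuousLinearMap.adjoint u (u x) = x := congrArg (fun T => T x) h.adjoint_comp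

theorem apply_adjoint {u : H →L[ℂ] K} (h : IsUnitaryMap u) (x : K) :
    u (ContinuousLinearMap.adjoint u x) = x := congrArg (fun T => T x) h.comp_adjoint

theorem of_equiv (e : H ≃ₗᵢ[ℂ] K) : IsUnitaryMap (e.toContinuousLinearEquiv : H →L[ℂ] K) := by
  have h : ContinuousLinearMap.adjoint (e.toContinuousLinearEquiv : H →L[ℂ] K) =
      (e.symm.toContinuousLinearEquiv : K →L[ℂ] H) := by
    symm
    rw [ContinuousLinearMap.eq_adjoint_iff]
    intro x y
    change inner ℂ (e.symm x) y = inner ℂ x (e y)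
    rw [← e.inner_map_map, e.apply_symm_apply]
  constructor
  · rw [h]; ext x; simp
  · rw [h]; ext x; simp

theorem symm {u : H →L[ℂ] K} (h : IsUnitaryMap u) : IsUnitaryMap (ContinuousLinearMap.adjoint u) :=
  ⟨by rw [ContinuousLinearMap.adjoint_adjoint]; exact h.comp_adjoint,
    by rw [ContinuousLinearMap.adjoint_adjoint]; exact h.adjoint_comp⟩

theorem inner_map {u : H →L[ℂ] K} (h : IsUnitaryMap u) (x y : H) :
    inner ℂ (u x) (u y) = inner ℂ x y := by
  rw [← ContinuousLinearMap.adjoint_inner_right, h.adjoint_apply]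

theorem norm_map {u : H →L[ℂ] K} (h : IsUnitaryMap u) (x : H) : ‖u x‖ = ‖x‖ := by
  rw [@norm_eq_sqrt_re_inner ℂ, @norm_eq_sqrt_re_inner ℂ, h.inner_map]

theorem norm_le {u : H →L[ℂ] K} (h : IsUnitaryMap u) : ‖u‖ ≤ 1 :=
  ContinuousLinearMap.opNorm_le_bound _ zero_le_one fun x => by rw [h.norm_map, one_mul]

theorem comp {u : H →L[ℂ] K} {w : K →L[ℂ] L} (hw : IsUnitaryMap w) (hu : IsUnitaryMap u) :
    IsUnitaryMap (w ∘L u) := by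
  constructor
  · ext x; simp [ContinuousLinearMap.adjoint_comp, hu.adjoint_apply, hw.adjoint_apply]
  · ext x; simp [ContinuousLinearMap.adjoint_comp, hu.apply_adjoint, hw.apply_adjoint]

theorem smul {u : H →L[ℂ] K} (h : IsUnitaryMap u) (c : Circle) : IsUnitaryMap ((c : ℂ) • u) := by
  have hc : (c : ℂ) * (starRingEnd ℂ) (c : ℂ) = 1 := by
    rw [← Circle.coe_inv_eq_conj, ← Circle.coe_mul, mul_inv_cancel, Circle.coe_one]
  constructor
  · ext x; simp [map_smulₛₗ, h.adjoint_apply, smul_smul, hc]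
  · ext x; simp [map_smulₛₗ, h.apply_adjoint, smul_smul, mul_comm _ (c : ℂ), hc]

theorem norm_comp {u : K →L[ℂ] L} (h : IsUnitaryMap u) (T : H →L[ℂ] K) : ‖u ∘L T‖ = ‖T‖ := by
  refine le_antisymm ?_ ?_
  · exact ContinuousLinearMap.opNorm_le_bound _ (norm_nonneg _) fun x => by
      rw [ContinuousLinearMap.comp_apply, h.norm_map]; exact T.le_opNorm x
  · exact ContinuousLinearMap.opNorm_le_bound _ (norm_nonneg _) fun x => by
      rw [← h.norm_map]; exact (u ∘L T).le_opNorm x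

theorem norm_comp_adjoint {u : H →L[ℂ] L} (h : IsUnitaryMap u) (T : H →L[ℂ] K) :
    ‖T ∘L ContinuousLinearMap.adjoint u‖ = ‖T‖ := by
  rw [← ContinuousLinearMap.adjoint.norm_map, ContinuousLinearMap.adjoint_comp,
    ContinuousLinearMap.adjoint_adjoint, h.norm_comp, ContinuousLinearMap.adjoint.norm_map]

end IsUnitaryMap

/-- The operator `T ↦ u T w⋆`. -/
def conjMap {H' K' : Type*} [NormedAddCommGroup H'] [InnerProductSpace ℂ H'] [CompleteSpace H']
    [NormedAddCommGroup K'] [InnerProductSpace ℂ K'] (u : K →L[ℂ] K') (w : H →L[ℂ] H') :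
    (H →L[ℂ] K) →ₗ[ℂ] (H' →L[ℂ] K') where
  toFun T := u ∘L T ∘L ContinuousLinearMap.adjoint w
  map_add' S T := by ext x; simp
  map_smul' c T := by ext x; simp

section
variable {H' K' : Type*} [NormedAddCommGroup H'] [InnerProductSpace ℂ H'] [CompleteSpace H']
    [NormedAddCommGroup K'] [InnerProductSpace ℂ K'] [CompleteSpace K']
    {H'' K'' : Type*} [NormedAddCommGroup H''] [InnerProductSpace ℂ H''] [CompleteSpace H'']
    [NormedAddCommGroup K''] [InnerProductSpace ℂ K''] [CompleteSpace K'']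
    {L' : Type*} [NormedAddCommGroup L'] [InnerProductSpace ℂ L'] [CompleteSpace L']

theorem conjMap_apply (u : K →L[ℂ] K') (w : H →L[ℂ] H') (T : H →L[ℂ] K) :
    conjMap u w T = u ∘L T ∘L ContinuousLinearMap.adjoint w := rfl

theorem norm_conjMap {u : K →L[ℂ] K'} {w : H →L[ℂ] H'} (hu : IsUnitaryMap u) (hw : IsUnitaryMap w)
    (T : H →L[ℂ] K) : ‖conjMap u w T‖ = ‖T‖ := by
  rw [conjMap_apply, hu.norm_comp, hw.norm_comp_adjoint]

theorem conjMap_comp {w : K →L[ℂ] K'} (hw : IsUnitaryMap w) (u : L →L[ℂ] L') (t : H →L[ℂ] H')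
    (S : K →L[ℂ] L) (T : H →L[ℂ] K) : conjMap u w S ∘L conjMap w t T = conjMap u t (S ∘L T) := by
  ext x; simp [conjMap_apply, hw.adjoint_apply]

theorem conjMap_adjoint (u : K →L[ℂ] K') (w : H →L[ℂ] H') (T : H →L[ℂ] K) :
    ContinuousLinearMap.adjoint (conjMap u w T) =
      conjMap w u (ContinuousLinearMap.adjoint T) := by
  simp [conjMap_apply, ContinuousLinearMap.adjoint_comp, ContinuousLinearMap.comp_assoc]

theorem conjMap_conjMap (u : K →L[ℂ] K') (w : H →L[ℂ] H') (u' : K' →L[ℂ] K'') (w' : H' →L[ℂ] H'')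
    (T : H →L[ℂ] K) : conjMap u' w' (conjMap u w T) = conjMap (u' ∘L u) (w' ∘L w) T := by
  simp [conjMap_apply, ContinuousLinearMap.adjoint_comp, ContinuousLinearMap.comp_assoc]

theorem conjMap_adjoint_conjMap {u : K →L[ℂ] K'} {w : H →L[ℂ] H'} (hu : IsUnitaryMap u)
    (hw : IsUnitaryMap w) (T : H →L[ℂ] K) :
    conjMap (ContinuousLinearMap.adjoint u) (ContinuousLinearMap.adjoint w) (conjMap u w T) = T := by
  rw [conjMap_conjMap, hu.adjoint_comp, hw.adjoint_comp]
  ext x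
  simp [conjMap_apply, ContinuousLinearMap.adjoint_id]

theorem conjMap_conjMap_adjoint {u : K →L[ℂ] K'} {w : H →L[ℂ] H'} (hu : IsUnitaryMap u)
    (hw : IsUnitaryMap w) (T : H' →L[ℂ] K') :
    conjMap u w (conjMap (ContinuousLinearMap.adjoint u) (ContinuousLinearMap.adjoint w) T) = T := by
  rw [conjMap_conjMap, hu.comp_adjoint, hw.comp_adjoint]
  ext x
  simp [conjMap_apply, ContinuousLinearMap.adjoint_id]

theorem conjMap_smul_smul (c d : ℂ) (u : K →L[ℂ] K') (w : H →L[ℂ] H') (T : H →L[ℂ] K) :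
    conjMap (c • u) (d • w) T = (c * (starRingEnd ℂ) d) • conjMap u w T := by
  ext x; simp [conjMap_apply, map_smulₛₗ, smul_smul, mul_comm]

theorem isCompactOperator_conjMap (u : K →L[ℂ] K') (w : H →L[ℂ] H') {T : H →L[ℂ] K}
    (hT : IsCompactOperator T) : IsCompactOperator (conjMap u w T) :=
  (hT.comp_clm (ContinuousLinearMap.adjoint w)).clm_comp u

end

/-! ### Strongly continuous families of operators -/

section Strong
variable {Y : Type*} [TopologicalSpace Y]

/-- Strong continuity at a point of a family of operators. -/
def StrongContAt (g : Y → H →L[ℂ] K) (z : Y) : Prop := ∀ v, ContinuousAt (fun y => g y v) z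

/-- On a compact operator, strong continuity improves to norm continuity. If T z is replaced by a
finite-rank operator, only finitely many vectors g y (S i 1) matter, and the bound on g makes the
error uniform in y. -/
theorem StrongContAt.comp_compact {g : Y → K →L[ℂ] L} {T : Y → H →L[ℂ] K} {z : Y}
    (hg : StrongContAt g z) (hb : ∀ᶠ y in 𝓝 z, ‖g y‖ ≤ 1) (hT : ContinuousAt T z)
    (hc : IsCompactOperator (T z)) : ContinuousAt (fun y => g y ∘L T y) z := by
  refine continuousAt_of_locally_uniform_approx_of_continuousAt fun t ht => ?_
  obtain ⟨r, hr0, hr⟩ := Metric.mem_uniformity_dist.1 ht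
  obtain ⟨n, S, R, -, -, h⟩ := exists_approx (K := ℂ) (T z) hc (half_pos hr0)
  have hT' : ∀ᶠ y in 𝓝 z, dist (T y) (T z) < r / 2 := hT (Metric.ball_mem_nhds _ (half_pos hr0))
  have hcont : ContinuousAt (fun y => ∑ i, ContinuousLinearMap.toSpanSingleton ℂ (g y (S i 1)) ∘L R i)
      z :=
    tendsto_finsetSum _ fun i _ =>
      (((ContinuousLinearMap.toSpanSingletonCLE (𝕜 := ℂ) (E := L)).continuous.continuousAt).comp
        (hg (S i 1))).clm_comp continuousAt_const
  refine ⟨_, hb.and hT', _, hcont, fun y hy => hr ?_⟩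
  have e : ∑ i, ContinuousLinearMap.toSpanSingleton ℂ (g y (S i 1)) ∘L R i =
      g y ∘L ∑ i, S i ∘L R i := by
    ext x
    simp only [sum_apply, ContinuousLinearMap.comp_apply, map_sum]
    refine Finset.sum_congr rfl fun i _ => ?_
    rw [ContinuousLinearMap.toSpanSingleton_apply, ← map_smul, ← map_smul, smul_eq_mul, mul_one]
  rw [e, dist_eq_norm, ← ContinuousLinearMap.comp_sub]
  refine (ContinuousLinearMap.opNorm_comp_le _ _).trans_lt ?_
  have h1 : ‖T y - ∑ i, S i ∘L R i‖ < r := by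
    rw [← dist_eq_norm]
    calc _ ≤ dist (T y) (T z) + dist (T z) (∑ i, S i ∘L R i) := dist_triangle _ _ _
      _ < r / 2 + r / 2 := add_lt_add_of_lt_of_le hy.2 (by rw [dist_eq_norm]; exact h)
      _ = r := add_halves r
  calc _ ≤ 1 * ‖T y - ∑ i, S i ∘L R i‖ := by gcongr; exact hy.1
    _ < r := by rwa [one_mul]

theorem continuousAt_adjoint {T : Y → H →L[ℂ] K} {z : Y} (hT : ContinuousAt T z) :
    ContinuousAt (fun y => ContinuousLinearMap.adjoint (T y)) z :=
  (ContinuousLinearMap.adjoint (𝕜 := ℂ) (E := H) (F := K)).continuous.continuousAt.comp hT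

/-- Since g T h⋆ is the adjoint of h (g T)⋆, two applications of the one-sided statement suffice,
and strong continuity of h⋆ is never needed. -/
theorem StrongContAt.conjMap {H' K' : Type*} [NormedAddCommGroup H'] [InnerProductSpace ℂ H']
    [CompleteSpace H'] [NormedAddCommGroup K'] [InnerProductSpace ℂ K'] [CompleteSpace K']
    {g : Y → K →L[ℂ] K'} {h : Y → H →L[ℂ] H'} {T : Y → H →L[ℂ] K} {z : Y}
    (hg : StrongContAt g z) (hgb : ∀ᶠ y in 𝓝 z, ‖g y‖ ≤ 1)
    (hh : StrongContAt h z) (hhb : ∀ᶠ y in 𝓝 z, ‖h y‖ ≤ 1) (hT : ContinuousAt T z)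
    (hc : IsCompactOperator (T z)) : ContinuousAt (fun y => conjMap (g y) (h y) (T y)) z := by
  have h1 := continuousAt_adjoint (hg.comp_compact hgb hT hc)
  have h2 := hh.comp_compact hhb h1 (isCompactOperator_adjoint (hc.clm_comp (g z)))
  refine (continuousAt_adjoint h2).congr (Filter.Eventually.of_forall fun y => ?_)
  simp [conjMap_apply, ContinuousLinearMap.adjoint_comp, ContinuousLinearMap.comp_assoc]

/-- A family of contractions is strongly continuous if its matrix coefficients with respect to
total families of continuous vectors are continuous and it consists of isometries. -/
theorem strongContAt_of_inner {ι ι' : Type*} {g : Y → H →L[ℂ] K} {z : Y} {N : Set Y} (hN : N ∈ 𝓝 z)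
    (hg : ∀ y ∈ N, IsUnitaryMap (g y)) (a : ι → Y → H) (b : ι' → Y → K)
    (ha : ∀ i, ContinuousAt (a i) z) (hb : ∀ i, ContinuousAt (b i) z)
    (hat : (Submodule.span ℂ (Set.range fun i => a i z)).topologicalClosure = ⊤)
    (hbt : (Submodule.span ℂ (Set.range fun i => b i z)).topologicalClosure = ⊤)
    (h : ∀ i j, ContinuousAt (fun y => inner ℂ (b j y) (g y (a i y))) z) : StrongContAt g z := by
  have hnorm : ∀ y ∈ N, ∀ v, ‖g y v‖ = ‖v‖ := fun y hy => (hg y hy).norm_map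
  have hz := mem_of_mem_nhds hN
  -- vectors at which the family is strongly continuous
  have step : ∀ v, (∀ w, ContinuousAt (fun y => inner ℂ w (g y v)) z) →
      ContinuousAt (fun y => g y v) z := by
    intro v hv
    rw [ContinuousAt, tendsto_iff_norm_sub_tendsto_zero]
    -- For isometries weak convergence is norm convergence: the expression below equals ‖g y v - g z
    -- v‖² near z.
    have h1 : Filter.Tendsto (fun y => 2 * ‖v‖ ^ 2 - 2 * (inner ℂ (g z v) (g y v)).re) (𝓝 z)
        (𝓝 (2 * ‖v‖ ^ 2 - 2 * (inner ℂ (g z v) (g z v)).re)) :=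
      (((Complex.continuous_re.continuousAt.comp (hv (g z v))).const_mul 2).const_sub _)
    have h2 : 2 * ‖v‖ ^ 2 - 2 * (inner ℂ (g z v) (g z v)).re = 0 := by
      have : (inner ℂ (g z v) (g z v)).re = ‖g z v‖ ^ 2 := by
        rw [inner_self_eq_norm_sq_to_K]; norm_cast
      rw [this, hnorm z hz]; ring
    rw [h2] at h1
    have h3 := (Real.continuous_sqrt.tendsto 0).comp h1
    rw [Real.sqrt_zero] at h3
    refine h3.congr' ?_
    filter_upwards [hN] with y hy
    have h4 : ‖g y v - g z v‖ ^ 2 = 2 * ‖v‖ ^ 2 - 2 * (inner ℂ (g z v) (g y v)).re := by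
      rw [@norm_sub_sq ℂ, hnorm y hy, hnorm z hz, ← inner_conj_symm]
      simp only [RCLike.conj_re, RCLike.re_eq_complex_re]
      ring
    rw [Function.comp_apply, ← h4, Real.sqrt_sq (norm_nonneg _)]
  -- constant vectors on the right
  have h5 : ∀ i w, ContinuousAt (fun y => inner ℂ w (g y (a i y))) z := by
    intro i w
    let P : K → Prop := fun w => ContinuousAt (fun y => inner ℂ w (g y (a i y))) z
    have hbd : ∀ᶠ y in 𝓝 z, ‖g y (a i y)‖ ≤ ‖a i z‖ + 1 := by
      have h6 : ∀ᶠ y in 𝓝 z, ‖a i y‖ < ‖a i z‖ + 1 :=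
        (ha i).norm.eventually (gt_mem_nhds (lt_add_one _))
      filter_upwards [hN, h6] with y hy h7
      rw [hnorm y hy]; exact h7.le
    have hPb : ∀ j, P (b j z) := by
      intro j
      have h6 : Filter.Tendsto (fun y => inner ℂ (b j z - b j y) (g y (a i y))) (𝓝 z) (𝓝 0) := by
        have h8 : Filter.Tendsto (fun y => ‖b j z - b j y‖ * (‖a i z‖ + 1)) (𝓝 z) (𝓝 0) := by
          have := ((hb j).const_sub (b j z)).norm.mul_const (‖a i z‖ + 1)
          simpa [ContinuousAt] using this
        refine squeeze_zero_norm' ?_ h8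
        filter_upwards [hbd] with y hy
        exact (norm_inner_le_norm _ _).trans (by gcongr)
      have h7 := h6.add (h i j)
      simp only [← inner_add_left, sub_add_cancel, zero_add] at h7
      exact h7
    have hPs : ∀ w ∈ Submodule.span ℂ (Set.range fun j => b j z), P w := by
      intro w hw
      induction hw using Submodule.span_induction with
      | mem w hw => obtain ⟨j, rfl⟩ := hw; exact hPb j
      | zero => simp only [P, inner_zero_left]; exact continuousAt_const
      | add w w' _ _ h1 h2 => simp only [P, inner_add_left]; exact h1.add h2
      | smul c w _ h1 =>
        simp only [P, inner_smul_left]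
        exact h1.const_mul _
    have hw : w ∈ closure (Submodule.span ℂ (Set.range fun j => b j z) : Set K) := by
      rw [← Submodule.topologicalClosure_coe, hbt]; trivial
    refine continuousAt_of_locally_uniform_approx_of_continuousAt fun t ht => ?_
    obtain ⟨r, hr0, hr⟩ := Metric.mem_uniformity_dist.1 ht
    have hpos : 0 < ‖a i z‖ + 1 := by positivity
    obtain ⟨w', hw', hd⟩ := Metric.mem_closure_iff.1 hw (r / (‖a i z‖ + 1)) (by positivity)
    refine ⟨_, hbd, _, hPs w' hw', fun y hy => hr ?_⟩
    rw [dist_eq_norm, ← inner_sub_left]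
    refine (norm_inner_le_norm _ _).trans_lt ?_
    rw [dist_eq_norm] at hd
    calc _ ≤ ‖w - w'‖ * (‖a i z‖ + 1) := by gcongr; exact hy
      _ < r / (‖a i z‖ + 1) * (‖a i z‖ + 1) := by gcongr
      _ = r := by field_simp
  have h6 : ∀ i, ContinuousAt (fun y => g y (a i z)) z := by
    intro i
    refine step _ fun w => ?_
    -- Replacing the moving vector a i y by a i z costs at most ‖w‖ ‖a i z - a i y‖, since g y is
    -- isometric.
    have h7 : Filter.Tendsto (fun y => inner ℂ w (g y (a i z - a i y))) (𝓝 z) (𝓝 0) := by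
      have h8 : Filter.Tendsto (fun y => ‖w‖ * ‖a i z - a i y‖) (𝓝 z) (𝓝 0) := by
        have := ((ha i).const_sub (a i z)).norm.const_mul ‖w‖
        simpa [ContinuousAt] using this
      refine squeeze_zero_norm' ?_ h8
      filter_upwards [hN] with y hy
      refine (norm_inner_le_norm _ _).trans ?_
      rw [hnorm y hy]
    have h8 := h7.add (h5 i w)
    simp only [← inner_add_right, ← map_add, sub_add_cancel, zero_add] at h8
    exact h8
  have h7 : ∀ v ∈ Submodule.span ℂ (Set.range fun i => a i z), ContinuousAt (fun y => g y v) z := by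
    intro v hv
    induction hv using Submodule.span_induction with
    | mem w hw => obtain ⟨j, rfl⟩ := hw; exact h6 j
    | zero => simp only [map_zero]; exact continuousAt_const
    | add w w' _ _ h1 h2 => simp only [map_add]; exact h1.add h2
    | smul c w _ h1 =>
      simp only [map_smul]
      exact h1.const_smul c
  intro v
  have hv : v ∈ closure (Submodule.span ℂ (Set.range fun i => a i z) : Set H) := by
    rw [← Submodule.topologicalClosure_coe, hat]; trivial
  refine continuousAt_of_locally_uniform_approx_of_continuousAt fun t ht => ?_
  obtain ⟨r, hr0, hr⟩ := Metric.mem_uniformity_dist.1 ht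
  obtain ⟨v', hv', hd⟩ := Metric.mem_closure_iff.1 hv r hr0
  refine ⟨N, hN, _, h7 v' hv', fun y hy => hr ?_⟩
  rw [dist_eq_norm, ← map_sub, hnorm y hy, ← dist_eq_norm]
  exact hd

end Strong

end CompactOperators

end

section
-- Unitary operators implementing changes of chart, and their local lifts
section Implementation
variable {A : Type*} [NonUnitalCStarAlgebra A]
  {H K : Type*} [NormedAddCommGroup H] [InnerProductSpace ℂ H] [CompleteSpace H]
  [NormedAddCommGroup K] [InnerProductSpace ℂ K] [CompleteSpace K]

/-- Two identifications of a `C⋆`-algebra with algebras of compact operators differ by conjugation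
with a unitary operator. -/
theorem IsAlgChart.exists_unitary [Nontrivial H] {φ : A →ₗ[ℂ] (H →L[ℂ] H)}
    {φ' : A →ₗ[ℂ] (K →L[ℂ] K)} (h : IsAlgChart φ) (h' : IsAlgChart φ') :
    ∃ u : H →L[ℂ] K, IsUnitaryMap u ∧ ∀ a, φ' a = conjMap u u (φ a) := by
  obtain ⟨p, hp⟩ := exists_norm_eq H (zero_le_one (α := ℝ))
  -- The elements a v form the column of matrix units over p; a p is a minimal projection of the
  -- algebra, and its image under φ' has a fixed unit vector q.
  choose a ha using fun v : H => h.exists_eq (isCompactOperator_rankOne v p)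
  have hinj : ∀ {b c : A}, φ b = φ c → b = c := fun hbc => inj_of_norm_map h.norm_map hbc
  have hpp : inner ℂ p p = 1 := by rw [inner_self_eq_norm_sq_to_K, hp]; simp
  have hadd : ∀ v w, a (v + w) = a v + a w := fun v w => hinj (by
    rw [map_add, ha, ha, ha]; ext x; simp [smul_add])
  have hsmul : ∀ (c : ℂ) v, a (c • v) = c • a v := fun c v => hinj (by
    rw [map_smul, ha, ha]; ext x; simp [smul_smul, mul_comm])
  have hmul : ∀ b v, b * a v = a (φ b v) := fun b v => hinj (by
    rw [h.map_mul, ha, ha]; ext x; simp)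
  have hstar : ∀ v w, star (a v) * a w = (inner ℂ v w : ℂ) • a p := fun v w => hinj (by
    rw [h.map_mul, h.map_star, map_smul, ha, ha, ha, InnerProductSpace.adjoint_rankOne]
    ext x; simp [smul_smul, mul_comm])
  have hidem : a p * a p = a p := by rw [hmul, ha]; simp [hp]
  have hne : φ' (a p) ≠ 0 := by
    rw [← norm_ne_zero_iff, h'.norm_map, ← h.norm_map, ha, InnerProductSpace.norm_rankOne, hp]
    norm_num
  obtain ⟨w, hw⟩ : ∃ w, φ' (a p) w ≠ 0 := by
    by_contra! hc
    exact hne (ContinuousLinearMap.ext hc)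
  obtain ⟨q, hq, hq1⟩ : ∃ q, φ' (a p) q = q ∧ ‖q‖ = 1 := by
    refine ⟨((‖φ' (a p) w‖⁻¹ : ℝ) : ℂ) • φ' (a p) w, ?_, ?_⟩
    · rw [map_smul, ← ContinuousLinearMap.comp_apply, ← h'.map_mul, hidem]
    · rw [norm_smul, Complex.norm_real, norm_inv, norm_norm, inv_mul_cancel₀ (norm_ne_zero_iff.2 hw)]
  have hqq : inner ℂ q q = 1 := by rw [inner_self_eq_norm_sq_to_K, hq1]; simp
  -- The intertwiner sends v to the vector obtained by applying its column element to q. It is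
  -- isometric because (a v)⋆ (a w) = ⟨v, w⟩ a p.
  let f : H →ₗ[ℂ] K :=
    { toFun := fun v => φ' (a v) q
      map_add' := fun v w => by rw [hadd, map_add]; rfl
      map_smul' := fun c v => by rw [hsmul, map_smul]; rfl }
  have hf : ∀ v w, inner ℂ (f v) (f w) = inner ℂ v w := fun v w => by
    change inner ℂ (φ' (a v) q) (φ' (a w) q) = _
    rw [← ContinuousLinearMap.adjoint_inner_right, ← h'.map_star, ← ContinuousLinearMap.comp_apply,
      ← h'.map_mul, hstar, map_smul, smul_apply, hq, inner_smul_right, hqq,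
      mul_one]
  have hsurj : Function.Surjective (f.isometryOfInner hf) := fun z => by
    obtain ⟨b, hb⟩ := h'.exists_eq (isCompactOperator_rankOne z q)
    -- If φ' b maps q to z, then b · a p = a (φ b p) and a p fixes q, so this preimage works.
    refine ⟨φ b p, ?_⟩
    change φ' (a (φ b p)) q = z
    rw [← hmul, h'.map_mul, ContinuousLinearMap.comp_apply, hq, hb]
    simp [hq1]
  let e := LinearIsometryEquiv.ofSurjective (f.isometryOfInner hf) hsurj
  have he : IsUnitaryMap (e.toContinuousLinearEquiv : H →L[ℂ] K) := IsUnitaryMap.of_equiv e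
  refine ⟨_, he, fun b => ?_⟩
  have h1 : φ' b ∘L (e.toContinuousLinearEquiv : H →L[ℂ] K) =
      (e.toContinuousLinearEquiv : H →L[ℂ] K) ∘L φ b := by
    ext v
    change φ' b (φ' (a v) q) = φ' (a (φ b v)) q
    rw [← ContinuousLinearMap.comp_apply, ← h'.map_mul, hmul]
  rw [conjMap_apply, ← ContinuousLinearMap.comp_assoc, ← h1, ContinuousLinearMap.comp_assoc,
    he.comp_adjoint, ContinuousLinearMap.comp_id]

end Implementation

variable {X : Type u} [TopologicalSpace X]

namespace DDBundle
variable (A : DDBundle X)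

theorem base_mem_nhds {x y : X} (h : y ∈ A.base x) : A.base x ∈ 𝓝 y :=
  (A.isOpen_base x).mem_nhds h

theorem exists_implement {x y : X} (h : y ∈ A.base x) :
    ∃ u : A.hilb y →L[ℂ] A.hilb x, IsUnitaryMap u ∧
      ∀ a, A.chart x y a = conjMap u u (A.chart y y a) :=
  (A.isChart y y (A.mem_base y)).exists_unitary (A.isChart x y h)

open Classical in
/-- A unitary operator that implements the chart at `x` on the fibre at `y`, relative to the chart
centred at `y`. It is unique up to a scalar. -/
def implement (x y : X) : A.hilb y →L[ℂ] A.hilb x :=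
  if h : y ∈ A.base x then (A.exists_implement h).choose else 0

theorem isUnitaryMap_implement {x y : X} (h : y ∈ A.base x) : IsUnitaryMap (A.implement x y) := by
  rw [implement, dif_pos h]
  exact (A.exists_implement h).choose_spec.1

theorem chart_eq {x y : X} (h : y ∈ A.base x) (a : A.fib y) :
    A.chart x y a = conjMap (A.implement x y) (A.implement x y) (A.chart y y a) := by
  rw [implement, dif_pos h]
  exact (A.exists_implement h).choose_spec.2 a

/-- The transition operator between the charts at `x` and `x'`, on the fibre at `y`. -/
def transition (x x' y : X) : A.hilb x →L[ℂ] A.hilb x' :=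
  A.implement x' y ∘L ContinuousLinearMap.adjoint (A.implement x y)

theorem isUnitaryMap_transition {x x' y : X} (h : y ∈ A.base x) (h' : y ∈ A.base x') :
    IsUnitaryMap (A.transition x x' y) :=
  (A.isUnitaryMap_implement h').comp (A.isUnitaryMap_implement h).symm

theorem transition_comp_implement {x x' y : X} (h : y ∈ A.base x) :
    A.transition x x' y ∘L A.implement x y = A.implement x' y := by
  rw [transition, ContinuousLinearMap.comp_assoc, (A.isUnitaryMap_implement h).adjoint_comp,
    ContinuousLinearMap.comp_id]

/-- This is `compat` for the section that is constantly T in the chart at x. The transition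
operators themselves depend on the choice of `implement`; only their conjugations are continuous. -/
theorem continuousAt_conj_transition {x x' z : X} (h : z ∈ A.base x) (h' : z ∈ A.base x')
    {T : A.hilb x →L[ℂ] A.hilb x} (hT : IsCompactOperator T) :
    ContinuousAt (fun y => conjMap (A.transition x x' y) (A.transition x x' y) T) z := by
  have hex : ∀ y, ∃ a : A.fib y, y ∈ A.base x → A.chart x y a = T := fun y => by
    by_cases hy : y ∈ A.base x
    · obtain ⟨a, ha⟩ := (A.isChart x y hy).exists_eq hT
      exact ⟨a, fun _ => ha⟩
    · exact ⟨0, fun h => (hy h).elim⟩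
  choose s hs using hex
  have h1 : ContinuousAt (fun y => A.chart x y (s y)) z :=
    (continuousAt_const (y := T)).congr
      (Filter.mem_of_superset (A.base_mem_nhds h) fun y hy => (hs y hy).symm)
  refine (A.compat x x' s z ⟨h, h'⟩ h1).congr ?_
  filter_upwards [A.base_mem_nhds h, A.base_mem_nhds h'] with y hy hy'
  rw [A.chart_eq hy', ← hs y hy, A.chart_eq hy, conjMap_conjMap, A.transition_comp_implement hy]

open Classical in
/-- The phase of a complex number, with value `1` at `0`. -/
def phase (c : ℂ) : Circle :=
  if h : c = 0 then 1 else ⟨c / ‖c‖, show c / ‖c‖ ∈ Submonoid.unitSphere ℂ from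
    mem_sphere_zero_iff_norm.2 (by
      rw [norm_div, Complex.norm_real, norm_norm, div_self (norm_ne_zero_iff.2 h)])⟩

theorem coe_phase {c : ℂ} (h : c ≠ 0) : (phase c : ℂ) = c / ‖c‖ :=
  congrArg (fun z : Circle => (z : ℂ)) (dif_neg h)

theorem phase_eq {c : ℂ} (h : ‖c‖ = 1) : (phase c : ℂ) = c := by
  rw [coe_phase (norm_ne_zero_iff.1 (by rw [h]; exact one_ne_zero)), h]
  simp

/-- Transition operators become strongly continuous after multiplication with suitable scalars:
the projection from the unitary to the projective unitary group has local sections. -/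
theorem exists_lift {x x' z : X} (h : z ∈ A.base x) (h' : z ∈ A.base x') :
    ∃ ρ : X → Circle, ∀ᶠ w in 𝓝 z,
      StrongContAt (fun y => (ρ y : ℂ) • A.transition x x' y) w := by
  obtain ⟨p, hp⟩ := exists_norm_eq (A.hilb x) (zero_le_one (α := ℝ))
  set g := A.transition x x' with hg
  set b := g z p with hb
  -- Normalize g y so that the product of b and g y p becomes positive. Since g y |v⟩⟨p| (g y)⋆ b =
  -- f y • g y v, the vector (f y / |f y|) • g y v is |f y|⁻¹ times a continuous one, and |f y|² is
  -- itself a matrix coefficient of a conjugated rank-one operator.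
  set f : X → ℂ := fun y => inner ℂ (g y p) b with hf
  have hfc : ∀ w ∈ A.base x ∩ A.base x', ContinuousAt (fun y => ‖f y‖) w := by
    intro w hw
    have h1 := A.continuousAt_conj_transition hw.1 hw.2 (isCompactOperator_rankOne p p)
    have h2 : ContinuousAt (fun y => Real.sqrt ‖inner ℂ b
        ((conjMap (g y) (g y) (InnerProductSpace.rankOne ℂ p p)) b)‖) w :=
      (ContinuousAt.inner (𝕜 := ℂ) continuousAt_const
        (h1.clm_apply continuousAt_const)).norm.sqrt
    refine h2.congr (Filter.Eventually.of_forall fun y => ?_)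
    simp only [conjMap_apply, ContinuousLinearMap.comp_apply, InnerProductSpace.rankOne_apply,
      ContinuousLinearMap.adjoint_inner_right, map_smul, inner_smul_right, norm_mul, hf]
    rw [norm_inner_symm b, Real.sqrt_mul_self (norm_nonneg _)]
  have hfz : f z ≠ 0 := by
    simp only [hf, ← hb, inner_self_eq_norm_sq_to_K]
    rw [hb, (A.isUnitaryMap_transition h h').norm_map, hp]
    simp
  have hev : ∀ᶠ w in 𝓝 z, w ∈ A.base x ∩ A.base x' ∧ f w ≠ 0 := by
    have h1 : ∀ᶠ w in 𝓝 z, 0 < ‖f w‖ :=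
      (hfc z ⟨h, h'⟩).eventually (lt_mem_nhds (norm_pos_iff.2 hfz))
    filter_upwards [A.base_mem_nhds h, A.base_mem_nhds h', h1] with w h2 h3 h4
    exact ⟨⟨h2, h3⟩, norm_pos_iff.1 h4⟩
  refine ⟨fun y => phase (f y), ?_⟩
  filter_upwards [hev.eventually_nhds] with w hw v
  have hw0 := hw.self_of_nhds
  have h1 := A.continuousAt_conj_transition hw0.1.1 hw0.1.2 (isCompactOperator_rankOne v p)
  have h2 : ContinuousAt (fun y => (((‖f y‖⁻¹ : ℝ) : ℂ)) •
      (conjMap (g y) (g y) (InnerProductSpace.rankOne ℂ v p)) b) w :=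
    (Complex.continuous_ofReal.continuousAt.comp
      ((hfc w hw0.1).inv₀ (norm_ne_zero_iff.2 hw0.2))).smul (h1.clm_apply continuousAt_const)
  refine h2.congr ?_
  filter_upwards [hw] with y hy
  simp only [conjMap_apply, ContinuousLinearMap.comp_apply, InnerProductSpace.rankOne_apply,
    ContinuousLinearMap.adjoint_inner_right, map_smul, smul_apply, smul_smul]
  rw [coe_phase hy.2, Complex.ofReal_inv, div_eq_mul_inv, mul_comm]

end DDBundle

/-! ### Chart phases: the topology of a Morita isomorphism as circle-valued functions -/

namespace Morita
variable {A B C : DDBundle X}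

/-- Conjugated back by the implementing unitaries, the chart at x is a bimodule map for the same
actions as the chart centred at y, hence a scalar multiple of it by `schur`. Both are isometric, so
the scalar has modulus one. -/
theorem exists_phase (E : Morita A B) {x y : X} (h : y ∈ E.base x) :
    ∃ c : Circle, ∀ e, E.chart x y e =
      (c : ℂ) • conjMap (B.implement x y) (A.implement x y) (E.chart y y e) := by
  have hA := (E.base_subset x h).1
  have hB := (E.base_subset x h).2
  obtain ⟨c, hc⟩ := schur (E.isChartA (E.mem_base y)) (E.isChartB (E.mem_base y))
    (E.isChart y y (E.mem_base y))
    (conjMap (ContinuousLinearMap.adjoint (B.implement x y))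
      (ContinuousLinearMap.adjoint (A.implement x y)) ∘ₗ E.chart x y)
    (fun b e => by
      rw [LinearMap.comp_apply, LinearMap.comp_apply, (E.isChart x y h).map_left, B.chart_eq hB,
        ← conjMap_comp (B.isUnitaryMap_implement hB).symm,
        conjMap_adjoint_conjMap (B.isUnitaryMap_implement hB) (B.isUnitaryMap_implement hB)])
    (fun a e => by
      rw [LinearMap.comp_apply, LinearMap.comp_apply, (E.isChart x y h).map_right, A.chart_eq hA,
        ← conjMap_comp (A.isUnitaryMap_implement hA).symm,
        conjMap_adjoint_conjMap (A.isUnitaryMap_implement hA) (A.isUnitaryMap_implement hA)])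
  have hc' : ∀ e, E.chart x y e =
      c • conjMap (B.implement x y) (A.implement x y) (E.chart y y e) := fun e => by
    rw [← map_smul, ← hc, LinearMap.comp_apply,
      conjMap_conjMap_adjoint (B.isUnitaryMap_implement hB) (A.isUnitaryMap_implement hA)]
  obtain ⟨e, he⟩ := E.exists_chart_ne_zero (E.mem_base y)
  have h1 := congrArg norm (hc' e)
  rw [norm_smul, norm_conjMap (B.isUnitaryMap_implement hB) (A.isUnitaryMap_implement hA),
    (E.isChart x y h).norm_map, ← (E.isChart y y (E.mem_base y)).norm_map] at h1
  have h2 : ‖c‖ = 1 := (mul_eq_right₀ (norm_ne_zero_iff.2 he)).1 h1.symm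
  exact ⟨DDBundle.phase c, fun e => by rw [DDBundle.phase_eq h2]; exact hc' e⟩

open Classical in
/-- The scalar that relates the chart at `x` of a Morita isomorphism on the fibre at `y` with the
chart centred at `y`, after conjugation with the implementing unitary operators. -/
def chartPhase (E : Morita A B) (x y : X) : Circle :=
  if h : y ∈ E.base x then (E.exists_phase h).choose else 1

theorem chart_eq (E : Morita A B) {x y : X} (h : y ∈ E.base x) (e : E.fib y) :
    E.chart x y e = (E.chartPhase x y : ℂ) •
      conjMap (B.implement x y) (A.implement x y) (E.chart y y e) := by
  rw [chartPhase, dif_pos h]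
  exact (E.exists_phase h).choose_spec e

/-- Continuity at `z` may be tested in every chart around `z`. -/
theorem contAt_iff (E : Morita A B) (s : ∀ y, E.fib y) {x z : X} (h : z ∈ E.base x) :
    E.ContAt s z ↔ ContinuousAt (fun y => E.chart x y (s y)) z :=
  ⟨E.compat z x s z ⟨E.mem_base z, h⟩, E.compat x z s z ⟨h, E.mem_base z⟩⟩

/-- There is a continuous section through every compact operator in a chart. -/
theorem exists_contAt (E : Morita A B) (x : X) {T : A.hilb x →L[ℂ] B.hilb x}
    (hT : IsCompactOperator T) : ∃ s : ∀ y, E.fib y, (∀ y ∈ E.base x, E.chart x y (s y) = T) ∧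
      ∀ y ∈ E.base x, E.ContAt s y := by
  have hex : ∀ y, ∃ e : E.fib y, y ∈ E.base x → E.chart x y e = T := fun y => by
    by_cases hy : y ∈ E.base x
    · obtain ⟨a, ha⟩ := (E.isChart x y hy).exists_eq hT
      exact ⟨a, fun _ => ha⟩
    · exact ⟨0, fun h => (hy h).elim⟩
  choose s hs using hex
  refine ⟨s, hs, fun y hy => (E.contAt_iff s hy).2 ?_⟩
  exact (continuousAt_const (y := T)).congr
    (Filter.mem_of_superset ((E.isOpen_base x).mem_nhds hy) fun y hy => (hs y hy).symm)

/-- Elementary tensors of continuous sections are continuous. -/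
theorem contAt_tmul (E : Morita A B) (F : Morita B C) {f : ∀ y, F.fib y} {e : ∀ y, E.fib y} {x : X}
    (hf : F.ContAt f x) (he : E.ContAt e x) :
    (E.comp F).ContAt (fun y => tmul E F (f y) (e y)) x := by
  refine (ContinuousAt.clm_comp hf he).congr ?_
  filter_upwards [E.base_mem_nhds x, F.base_mem_nhds x] with y hE hF
  exact (chart_tmul E F hE hF _ _).symm

/-- Extracts continuity of a phase from continuity of sections: a functional that does not vanish at
T z turns both families into numbers, and the phase is their quotient near z. -/
theorem continuousAt_of_smul {Y V : Type*} [TopologicalSpace Y] [NormedAddCommGroup V]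
    [NormedSpace ℂ V] {c : Y → ℂ} {T : Y → V} {z : Y} (hT : ContinuousAt T z) (h0 : T z ≠ 0)
    (h : ContinuousAt (fun y => c y • T y) z) : ContinuousAt c z := by
  obtain ⟨f, -, hf⟩ := exists_dual_vector ℂ (T z) (norm_ne_zero_iff.2 h0)
  have hfz : f (T z) ≠ 0 := by
    rw [hf]; simpa using h0
  have h1 : ContinuousAt (fun y => f (T y)) z := f.continuous.continuousAt.comp hT
  have h2 : ContinuousAt (fun y => f (c y • T y)) z := f.continuous.continuousAt.comp h
  refine (h2.div h1 hfz).congr ?_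
  filter_upwards [h1.eventually_ne hfz] with y hy
  simp [hy]

theorem chartPhase_eq (E : Morita A B) {x y : X} (h : y ∈ E.base x) {c : Circle} {e : E.fib y}
    (he : E.chart x y e ≠ 0)
    (hc : E.chart x y e = (c : ℂ) • conjMap (B.implement x y) (A.implement x y) (E.chart y y e)) :
    E.chartPhase x y = c := by
  have h1 : conjMap (B.implement x y) (A.implement x y) (E.chart y y e) ≠ 0 := fun h0 =>
    he (by rw [hc, h0, smul_zero])
  have h2 := E.chart_eq h e
  rw [hc] at h2
  exact Circle.coe_injective (smul_left_injective ℂ h1 h2).symm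

/-- The implementing unitaries are the same for E and F and drop out, so that passing from the
centred charts to the charts at x only multiplies by the quotient of the two phases. This is the
source of the continuity condition in `TwoIso.ofPhase`. -/
theorem chart_smul_centralMap (E F : Morita A B) (c : Circle) {x y : X} (hE : y ∈ E.base x)
    (hF : y ∈ F.base x) (e : E.fib y) : F.chart x y ((c : ℂ) • centralMap E F y e) =
      ((c * F.chartPhase x y * (E.chartPhase x y)⁻¹ : Circle) : ℂ) • E.chart x y e := by
  rw [map_smul, F.chart_eq hF, chart_centralMap, E.chart_eq hE, smul_smul, smul_smul,
    ← Circle.coe_mul, ← Circle.coe_mul, inv_mul_cancel_right]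

/-- The `2`-isomorphism that acts by given scalars in the charts centred at the points. -/
def TwoIso.ofPhase (E F : Morita A B) (s : X → Circle)
    (h : ∀ x, ContinuousAt (fun y => s y * F.chartPhase x y * (E.chartPhase x y)⁻¹) x) :
    TwoIso E F :=
  TwoIso.ofScalar (fun y => (s y : ℂ) • centralMap E F y)
    (fun x y => (s y * F.chartPhase x y * (E.chartPhase x y)⁻¹ : Circle))
    (fun _ => Circle.norm_coe _)
    (fun _ _ hE hF e => chart_smul_centralMap E F _ hE hF e)
    (fun x => (continuous_subtype_val (p := (· ∈ Submonoid.unitSphere ℂ))).continuousAt.comp (h x))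

theorem TwoIso.scalar_ofPhase (E F : Morita A B) (s : X → Circle) (h) (y : X) :
    (TwoIso.ofPhase E F s h).scalar y y = s y := by
  obtain ⟨e, he⟩ := E.exists_chart_ne_zero (E.mem_base y)
  refine TwoIso.scalar_eq _ (E.mem_base y) (F.mem_base y) he ?_
  change F.chart y y ((s y : ℂ) • centralMap E F y e) = _
  rw [map_smul, chart_centralMap]

theorem chartPhase_id {x y : X} (h : y ∈ A.base x) : (Morita.id A).chartPhase x y = 1 := by
  obtain ⟨e, he⟩ := (Morita.id A).exists_chart_ne_zero (x := x) (y := y) h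
  refine chartPhase_eq _ h he ?_
  rw [Circle.coe_one, one_smul]
  exact A.chart_eq h e

/-- The implementing unitary of the middle bundle cancels in the product of operators. One nonzero
elementary tensor decides the scalar; the two rank-one factors share the vector q so that their
product does not vanish. -/
theorem chartPhase_comp (E : Morita A B) (F : Morita B C) {x y : X} (hE : y ∈ E.base x)
    (hF : y ∈ F.base x) : (E.comp F).chartPhase x y = F.chartPhase x y * E.chartPhase x y := by
  obtain ⟨p, hp⟩ := exists_norm_eq (A.hilb x) (zero_le_one (α := ℝ))
  obtain ⟨q, hq⟩ := exists_norm_eq (B.hilb x) (zero_le_one (α := ℝ))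
  obtain ⟨r, hr⟩ := exists_norm_eq (C.hilb x) (zero_le_one (α := ℝ))
  obtain ⟨e, he⟩ := (E.isChart x y hE).exists_eq (isCompactOperator_rankOne q p)
  obtain ⟨f, hf⟩ := (F.isChart x y hF).exists_eq (isCompactOperator_rankOne r q)
  refine chartPhase_eq (E.comp F) ⟨hE, hF⟩ (e := tmul E F f e) ?_ ?_
  · rw [chart_tmul E F hE hF, he, hf]
    intro h0
    simpa [hp, hq, norm_ne_zero_iff.1 (hr.trans_ne one_ne_zero)] using congrArg (fun T => T p) h0
  · rw [chart_tmul E F hE hF, chart_tmul E F (E.mem_base y) (F.mem_base y), E.chart_eq hE,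
      F.chart_eq hF, ContinuousLinearMap.comp_smul, ContinuousLinearMap.smul_comp,
      conjMap_comp (B.isUnitaryMap_implement (E.base_subset x hE).2), smul_smul, Circle.coe_mul,
      mul_comm]

theorem chartPhase_pullback {Y : Type v} [TopologicalSpace Y] (f : C(Y, X)) (E : Morita A B)
    {x y : Y} (h : f y ∈ E.base (f x)) :
    (E.pullback f).chartPhase x y = E.chartPhase (f x) (f y) := by
  obtain ⟨e, he⟩ := E.exists_chart_ne_zero h
  exact chartPhase_eq (E.pullback f) h he (E.chart_eq h e)

end Morita

/-! ### Morita isomorphisms made of compact operators, and inverses -/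

section CompactMaps
variable {H K : Type*} [NormedAddCommGroup H] [InnerProductSpace ℂ H]
  [NormedAddCommGroup K] [InnerProductSpace ℂ K]

variable (H K) in
/-- The Banach space of compact operators. -/
abbrev CompactMap := compactOperator (RingHom.id ℂ) H K

/-- Post-composition of compact operators with a bounded operator. -/
def compactLeft (S : K →L[ℂ] K) : CompactMap H K →ₗ[ℂ] CompactMap H K where
  toFun T := ⟨S ∘L T.1, IsCompactOperator.clm_comp T.2 S⟩
  map_add' _ _ := Subtype.ext (ContinuousLinearMap.comp_add _ _ _)
  map_smul' _ _ := Subtype.ext (ContinuousLinearMap.comp_smul _ _ _)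

/-- Pre-composition of compact operators with a bounded operator. -/
def compactRight (S : H →L[ℂ] H) : CompactMap H K →ₗ[ℂ] CompactMap H K where
  toFun T := ⟨T.1 ∘L S, IsCompactOperator.comp_clm T.2 S⟩
  map_add' _ _ := Subtype.ext (ContinuousLinearMap.add_comp _ _ _)
  map_smul' _ _ := Subtype.ext (ContinuousLinearMap.smul_comp _ _ _)

/-- The map `T ↦ c • u T w⋆` on compact operators. -/
def conjChart {H' K' : Type*} [NormedAddCommGroup H'] [InnerProductSpace ℂ H'] [CompleteSpace H']
    [NormedAddCommGroup K'] [InnerProductSpace ℂ K'] [CompleteSpace H] (c : Circle)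
    (u : K →L[ℂ] K') (w : H →L[ℂ] H') : CompactMap H K →ₗ[ℂ] (H' →L[ℂ] K') :=
  (c : ℂ) • (conjMap u w ∘ₗ (CompactMap H K).subtype)

theorem conjChart_apply {H' K' : Type*} [NormedAddCommGroup H'] [InnerProductSpace ℂ H']
    [CompleteSpace H'] [NormedAddCommGroup K'] [InnerProductSpace ℂ K'] [CompleteSpace H]
    (c : Circle) (u : K →L[ℂ] K') (w : H →L[ℂ] H') (T : CompactMap H K) :
    conjChart c u w T = (c : ℂ) • conjMap u w T.1 := rfl

/-- Every Morita isomorphism built by hand below (`Morita.inv`, `Morita.ofChartPhase`,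
`Desc.descMorita`) has spaces of compact operators as fibres and charts T ↦ c • u T w⋆; this settles
their algebraic part, and only `compat` remains to be checked. -/
theorem isModChart_conjChart [CompleteSpace H] [CompleteSpace K] {A B : Type*}
    [NonUnitalCStarAlgebra A] [NonUnitalCStarAlgebra B]
    {H' K' : Type*} [NormedAddCommGroup H'] [InnerProductSpace ℂ H'] [CompleteSpace H']
    [NormedAddCommGroup K'] [InnerProductSpace ℂ K'] [CompleteSpace K']
    {φA : A →ₗ[ℂ] (H' →L[ℂ] H')} {φB : B →ₗ[ℂ] (K' →L[ℂ] K')} {ψA : A → H →L[ℂ] H}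
    {ψB : B → K →L[ℂ] K} (c : Circle) {u : K →L[ℂ] K'} {w : H →L[ℂ] H'} (hu : IsUnitaryMap u)
    (hw : IsUnitaryMap w) (hA : ∀ a, φA a = conjMap w w (ψA a))
    (hB : ∀ b, φB b = conjMap u u (ψB b)) :
    IsModChart (E := CompactMap H K) φA φB (fun b => compactLeft (ψB b)) (fun a => compactRight (ψA a))
      (conjChart c u w) where
  norm_map T := by
    rw [conjChart_apply, norm_smul, Circle.norm_coe, one_mul, norm_conjMap hu hw]; rfl
  range_eq := by
    apply Set.Subset.antisymm
    · rintro _ ⟨T, rfl⟩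
      exact (isCompactOperator_conjMap u w T.2).smul (c : ℂ)
    · intro T hT
      refine ⟨⟨conjMap (ContinuousLinearMap.adjoint u) (ContinuousLinearMap.adjoint w)
        (((c⁻¹ : Circle) : ℂ) • T), isCompactOperator_conjMap _ _ (IsCompactOperator.smul hT _)⟩, ?_⟩
      rw [conjChart_apply, conjMap_conjMap_adjoint hu hw, smul_smul, ← Circle.coe_mul,
        mul_inv_cancel, Circle.coe_one, one_smul]
  map_left b T := by
    rw [conjChart_apply, conjChart_apply, hB, ContinuousLinearMap.comp_smul, conjMap_comp hu]; rfl
  map_right a T := by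
    rw [conjChart_apply, conjChart_apply, hA, ContinuousLinearMap.smul_comp, conjMap_comp hw]; rfl

end CompactMaps

namespace Morita
variable {A B C : DDBundle X}

theorem adjoint_smul_conjMap {H K H' K' : Type*} [NormedAddCommGroup H] [InnerProductSpace ℂ H]
    [CompleteSpace H] [NormedAddCommGroup K] [InnerProductSpace ℂ K] [CompleteSpace K]
    [NormedAddCommGroup H'] [InnerProductSpace ℂ H'] [CompleteSpace H']
    [NormedAddCommGroup K'] [InnerProductSpace ℂ K'] [CompleteSpace K']
    (c : Circle) (u : K →L[ℂ] K') (w : H →L[ℂ] H') (T : H →L[ℂ] K) :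
    ContinuousLinearMap.adjoint ((c : ℂ) • conjMap u w T) =
      ((c⁻¹ : Circle) : ℂ) • conjMap w u (ContinuousLinearMap.adjoint T) := by
  rw [map_smulₛₗ, conjMap_adjoint, Circle.coe_inv_eq_conj]

/-- The inverse of a Morita isomorphism, fibrewise the compact operators in the opposite direction
in the chart centred at the point. -/
def inv (E : Morita A B) : Morita B A where
  fib y := CompactMap (B.hilb y) (A.hilb y)
  left y a := compactLeft (A.chart y y a)
  right y b := compactRight (B.chart y y b)
  base := E.base
  isOpen_base := E.isOpen_base
  mem_base := E.mem_base
  base_subset x _ h := ⟨(E.base_subset x h).2, (E.base_subset x h).1⟩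
  chart x y := conjChart (E.chartPhase x y)⁻¹ (A.implement x y) (B.implement x y)
  isChart x y h := isModChart_conjChart _ (A.isUnitaryMap_implement (E.base_subset x h).1)
    (B.isUnitaryMap_implement (E.base_subset x h).2) (B.chart_eq (E.base_subset x h).2)
    (A.chart_eq (E.base_subset x h).1)
  compat x₀ x₁ s x hx hs := by
    -- A section s of the inverse corresponds to the section e of E given by the adjoints of s in
    -- the centred charts. Taking adjoints inverts the chart phase, so s and e are adjoint in every
    -- chart and `compat` passes from E to its inverse.
    choose e he using fun y => (E.isChart y y (E.mem_base y)).exists_eq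
      (isCompactOperator_adjoint (s y).2)
    have h1 : ∀ x, ∀ y ∈ E.base x, conjChart (E.chartPhase x y)⁻¹ (A.implement x y)
        (B.implement x y) (s y) = ContinuousLinearMap.adjoint (E.chart x y (e y)) := fun x y hy => by
      rw [E.chart_eq hy, he, adjoint_smul_conjMap, ContinuousLinearMap.adjoint_adjoint]; rfl
    have h2 : ContinuousAt (fun y => E.chart x₀ y (e y)) x := by
      refine (continuousAt_adjoint hs).congr ?_
      filter_upwards [(E.isOpen_base x₀).mem_nhds hx.1] with y hy
      rw [h1 x₀ y hy, ContinuousLinearMap.adjoint_adjoint]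
    refine (continuousAt_adjoint (E.compat x₀ x₁ e x hx h2)).congr ?_
    filter_upwards [(E.isOpen_base x₁).mem_nhds hx.2] with y hy
    rw [h1 x₁ y hy]

/-- Neither `implement y y` nor `chartPhase y y` needs to be trivial, but their effects cancel: this
is the adjoint of `Morita.chart_eq` for E at x = y. -/
theorem chart_self_inv (E : Morita A B) (y : X) (T : E.inv.fib y) : E.inv.chart y y T = T.1 := by
  obtain ⟨e, he⟩ := (E.isChart y y (E.mem_base y)).exists_eq (isCompactOperator_adjoint T.2)
  have h := E.chart_eq (E.mem_base y) e
  rw [he] at h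
  have h' := congrArg ContinuousLinearMap.adjoint h
  rw [adjoint_smul_conjMap, ContinuousLinearMap.adjoint_adjoint] at h'
  exact h'.symm

theorem chartPhase_inv (E : Morita A B) {x y : X} (h : y ∈ E.base x) :
    E.inv.chartPhase x y = (E.chartPhase x y)⁻¹ := by
  obtain ⟨e, he⟩ := E.inv.exists_chart_ne_zero (x := x) (y := y) h
  refine chartPhase_eq E.inv h he ?_
  rw [chart_self_inv]
  rfl

/-- The pairing `E⁻¹ ⊗ E ≅ 𝟙`. -/
def compInv (E : Morita A B) : TwoIso (E.comp E.inv) (Morita.id A) :=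
  TwoIso.ofPhase _ _ (fun _ => 1) fun x => by
    refine (continuousAt_const (y := (1 : Circle))).congr ?_
    filter_upwards [E.base_mem_nhds x] with y hy
    rw [chartPhase_comp E E.inv hy hy, chartPhase_inv E hy, chartPhase_id (E.base_subset x hy).1]
    simp

/-- The pairing `E ⊗ E⁻¹ ≅ 𝟙`. -/
def invComp (E : Morita A B) : TwoIso (E.inv.comp E) (Morita.id B) :=
  TwoIso.ofPhase _ _ (fun _ => 1) fun x => by
    refine (continuousAt_const (y := (1 : Circle))).congr ?_
    filter_upwards [E.base_mem_nhds x] with y hy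
    rw [chartPhase_comp E.inv E hy hy, chartPhase_inv E hy, chartPhase_id (E.base_subset x hy).2]
    simp

end Morita

namespace DDBundle
variable {A B : DDBundle X}

/-- The inverse of a Morita isomorphism, as a `1`-morphism. -/
def invHom (E : A ⟶ B) : B ⟶ A := Morita.inv E

/-- A Morita isomorphism composed with its inverse is the identity. -/
def compInv (E : A ⟶ B) : E ≫ invHom E ≅ 𝟙 A := (Morita.compInv E).toIso

/-- The inverse of a Morita isomorphism composed with it is the identity. -/
def invComp (E : A ⟶ B) : invHom E ≫ E ≅ 𝟙 B := (Morita.invComp E).toIso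

@[simp] theorem ph_compInv (E : A ⟶ B) (y : X) : ph (compInv E).hom y = 1 := by
  change Morita.TwoIso.scalar (Morita.compInv E) y y = 1
  rw [Morita.compInv, Morita.TwoIso.scalar_ofPhase, Circle.coe_one]

@[simp] theorem ph_invComp (E : A ⟶ B) (y : X) : ph (invComp E).hom y = 1 := by
  change Morita.TwoIso.scalar (Morita.invComp E) y y = 1
  rw [Morita.invComp, Morita.TwoIso.scalar_ofPhase, Circle.coe_one]

end DDBundle

end

/-! ### Invertibility of the 1-arrows of the descent bicategory -/

section
open Cech

variable {M : Type u} [TopologicalSpace M] {I : Type v} {U : I → Opens M}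

namespace DDBundle
variable {X : Type u} [TopologicalSpace X] {Y : Type v} [TopologicalSpace Y] {A B : DDBundle X}

/-- Every `2`-morphism is invertible. -/
def isoOfHom {E F : A ⟶ B} (τ : E ⟶ F) : E ≅ F := Morita.TwoIso.toIso τ

@[simp] theorem isoOfHom_hom {E F : A ⟶ B} (τ : E ⟶ F) : (isoOfHom τ).hom = τ := rfl

theorem ph_compInv_inv (E : A ⟶ B) (x : X) : ph (compInv E).inv x = 1 := by simp

/-- The pullback of `compInv`. -/
def pullbackCompInv (f : C(Y, X)) (E : A ⟶ B) :
    pullbackHom f E ≫ pullbackHom f (invHom E) ≅ 𝟙 (A.pullback f) :=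
  (pullbackComp f E (invHom E)).symm ≪≫ isoOfHom (pullbackHom₂ f (compInv E).hom) ≪≫ pullbackId f A

/-- The pullback of `invComp`. -/
def pullbackInvComp (f : C(Y, X)) (E : A ⟶ B) :
    pullbackHom f (invHom E) ≫ pullbackHom f E ≅ 𝟙 (B.pullback f) :=
  (pullbackComp f (invHom E) E).symm ≪≫ isoOfHom (pullbackHom₂ f (invComp E).hom) ≪≫ pullbackId f B

@[simp] theorem ph_pullbackCompInv (f : C(Y, X)) (E : A ⟶ B) (y : Y) :
    ph (pullbackCompInv f E).hom y = 1 := by simp [pullbackCompInv]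

@[simp] theorem ph_pullbackInvComp (f : C(Y, X)) (E : A ⟶ B) (y : Y) :
    ph (pullbackInvComp f E).hom y = 1 := by simp [pullbackInvComp]

end DDBundle

namespace Desc

/-- The structure `2`-morphism of the inverse of a `1`-morphism of the descent bicategory. -/
def invα {P Q : Desc U} (f : Hom₁ P Q) :
    DDBundle.pullbackHom (v₀ U) (DDBundle.invHom f.F) ≫ P.E ⟶
      Q.E ≫ DDBundle.pullbackHom (v₁ U) (DDBundle.invHom f.F) :=
  (whiskerLeftIso (DDBundle.pullbackHom (v₀ U) (DDBundle.invHom f.F))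
    ((ρ_ P.E).symm ≪≫ whiskerLeftIso P.E (DDBundle.pullbackCompInv (v₁ U) f.F).symm ≪≫
      (α_ P.E (DDBundle.pullbackHom (v₁ U) f.F)
        (DDBundle.pullbackHom (v₁ U) (DDBundle.invHom f.F))).symm ≪≫
      whiskerRightIso (DDBundle.isoOfHom f.α).symm
        (DDBundle.pullbackHom (v₁ U) (DDBundle.invHom f.F)) ≪≫
      α_ (DDBundle.pullbackHom (v₀ U) f.F) Q.E
        (DDBundle.pullbackHom (v₁ U) (DDBundle.invHom f.F))) ≪≫
    (α_ (DDBundle.pullbackHom (v₀ U) (DDBundle.invHom f.F)) (DDBundle.pullbackHom (v₀ U) f.F)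
      (Q.E ≫ DDBundle.pullbackHom (v₁ U) (DDBundle.invHom f.F))).symm ≪≫
    whiskerRightIso (DDBundle.pullbackInvComp (v₀ U) f.F)
      (Q.E ≫ DDBundle.pullbackHom (v₁ U) (DDBundle.invHom f.F)) ≪≫ λ_ _).hom

/-- All other cells in the pasting have scalar 1. Coherence of the inverse is thereby reduced to
inverting the cocycle identity of f. -/
theorem ph_invα {P Q : Desc U} (f : Hom₁ P Q) (z : Γ₁ U) :
    DDBundle.ph (invα f) z = (DDBundle.ph f.α z)⁻¹ := by simp [invα]

/-- The inverse of a `1`-morphism of the descent bicategory. -/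
def inv₁ {P Q : Desc U} (f : Hom₁ P Q) : Hom₁ Q P where
  F := DDBundle.invHom f.F
  α := invα f
  coh := (sq_coh_iff (invα f) Q.τ P.τ).2 fun z => by
    have h := f.ph_coh z
    have h0 := DDBundle.ph_ne_zero f.α (e₀₁ U z)
    have h1 := DDBundle.ph_ne_zero f.α (e₁₂ U z)
    have h2 := DDBundle.ph_ne_zero f.α (e₀₂ U z)
    simp only [ph_invα]
    field_simp
    linear_combination - h

/-- Every `1`-morphism of the descent bicategory is an equivalence. -/
def equivalence {P Q : Desc U} (f : P ⟶ Q) : Bicategory.Equivalence P Q :=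
  -- The counit is corrected to satisfy the triangle identity, so invertibility of unit and counit
  -- is all that has to be supplied.
  Bicategory.Equivalence.mkOfAdjointifyCounit (f := f) (g := inv₁ f)
    (mkIso (f := id₁ P) (g := comp₁ f (inv₁ f)) (DDBundle.compInv (Hom₁.F f)).symm
      (Hom₂.ofPh (f := id₁ P) (g := comp₁ f (inv₁ f)) (DDBundle.compInv (Hom₁.F f)).inv
        (c₀ := 1) (c₁ := 1) (fun _ => DDBundle.ph_compInv_inv _ _)
        (fun _ => DDBundle.ph_compInv_inv _ _)
        (ph_id₁ P) (ph_comp₁ f (inv₁ f)) (fun z => by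
          have := DDBundle.ph_ne_zero (Hom₁.α f) z
          change 1 * (DDBundle.ph (invα f) z * _) = 1 * 1
          rw [ph_invα, inv_mul_cancel₀ this, one_mul])) rfl)
    (mkIso (f := comp₁ (inv₁ f) f) (g := id₁ Q) (DDBundle.invComp (Hom₁.F f))
      (Hom₂.ofPh (f := comp₁ (inv₁ f) f) (g := id₁ Q) (DDBundle.invComp (Hom₁.F f)).hom
        (c₀ := 1) (c₁ := 1) (fun _ => DDBundle.ph_invComp _ _) (fun _ => DDBundle.ph_invComp _ _)
        (ph_comp₁ (inv₁ f) f) (ph_id₁ Q) (fun z => by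
          have := DDBundle.ph_ne_zero (Hom₁.α f) z
          change 1 * 1 = _ * DDBundle.ph (invα f) z * 1
          rw [ph_invα, mul_inv_cancel₀ this, one_mul])) rfl)

end Desc

end

/-! ### 2-isomorphisms as circle-valued functions, and the local topology of a cover -/

section
open Cech

theorem continuousAt_coe_circle {Y : Type*} [TopologicalSpace Y] {c : Y → Circle} {z : Y} :
    ContinuousAt (fun y => (c y : ℂ)) z ↔ ContinuousAt c z :=
  (Topology.IsInducing.subtypeVal (t := {z : ℂ | z ∈ Submonoid.unitSphere ℂ})).continuousAt_iff.symm

namespace Morita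
variable {X : Type u} [TopologicalSpace X] {A B : DDBundle X}

/-- The scalar by which a `2`-isomorphism acts in the charts centred at `y`. -/
def TwoIso.phase {E F : Morita A B} (τ : TwoIso E F) (y : X) : Circle :=
  DDBundle.phase (τ.scalar y y)

theorem TwoIso.coe_phase {E F : Morita A B} (τ : TwoIso E F) (y : X) :
    (τ.phase y : ℂ) = τ.scalar y y :=
  DDBundle.phase_eq (τ.norm_scalar (E.mem_base y) (F.mem_base y))

theorem TwoIso.scalar_eq_phase {E F : Morita A B} (τ : TwoIso E F) {x y : X} (hE : y ∈ E.base x)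
    (hF : y ∈ F.base x) :
    τ.scalar x y = (τ.phase y * F.chartPhase x y * (E.chartPhase x y)⁻¹ : Circle) := by
  obtain ⟨e, he⟩ := E.exists_chart_ne_zero hE
  refine TwoIso.scalar_eq _ hE hF he ?_
  rw [F.chart_eq hF, τ.scalar_spec (E.mem_base y) (F.mem_base y), ← τ.coe_phase, E.chart_eq hE,
    map_smul, smul_smul, smul_smul, ← Circle.coe_mul, ← Circle.coe_mul, inv_mul_cancel_right,
    mul_comm]

/-- The converse of `TwoIso.ofPhase`: near x the displayed product is the scalar of τ in the charts
at x, which is continuous at x although the individual factors need not be. -/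
theorem TwoIso.continuousAt_phase {E F : Morita A B} (τ : TwoIso E F) (x : X) :
    ContinuousAt (fun y => τ.phase y * F.chartPhase x y * (E.chartPhase x y)⁻¹) x := by
  rw [← continuousAt_coe_circle]
  refine (τ.continuousAt_scalar x).congr ?_
  filter_upwards [E.base_mem_nhds x, F.base_mem_nhds x] with y hE hF
  exact τ.scalar_eq_phase hE hF

/-- The Morita isomorphism with fibres the compact operators between the Hilbert spaces of the
charts centred at the points, whose charts are given by scalars. -/
def ofChartPhase (base : X → Set X) (isOpen_base : ∀ x, IsOpen (base x))
    (mem_base : ∀ x, x ∈ base x) (base_subset : ∀ x, base x ⊆ A.base x ∩ B.base x)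
    (c : X → X → Circle)
    (compat : ∀ x₀ x₁ (s : ∀ y, CompactMap (A.hilb y) (B.hilb y)), ∀ x ∈ base x₀ ∩ base x₁,
      ContinuousAt (fun y => conjChart (c x₀ y) (B.implement x₀ y) (A.implement x₀ y) (s y)) x →
      ContinuousAt (fun y => conjChart (c x₁ y) (B.implement x₁ y) (A.implement x₁ y) (s y)) x) :
    Morita A B where
  fib y := CompactMap (A.hilb y) (B.hilb y)
  left y b := compactLeft (B.chart y y b)
  right y a := compactRight (A.chart y y a)
  base := base
  isOpen_base := isOpen_base
  mem_base := mem_base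
  base_subset := base_subset
  chart x y := conjChart (c x y) (B.implement x y) (A.implement x y)
  isChart x _ h := isModChart_conjChart _ (B.isUnitaryMap_implement (base_subset x h).2)
    (A.isUnitaryMap_implement (base_subset x h).1) (A.chart_eq (base_subset x h).1)
    (B.chart_eq (base_subset x h).2)
  compat := compat

end Morita

namespace Cech
variable {M : Type u} [TopologicalSpace M] {I : Type v} {U : I → Opens M}

/-- The projection to M is a local homeomorphism. Functions that come from M therefore have the same
germs upstairs and downstairs, and continuity can be moved in both directions. -/
theorem map_nhds_sigma {J : Type*} {V : J → Opens M} (q : Σ j, V j) :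
    Filter.map (fun q : Σ j, V j => (q.2 : M)) (𝓝 q) = 𝓝 (q.2 : M) := by
  obtain ⟨j, y⟩ := q
  rw [Sigma.nhds_mk, Filter.map_map]
  exact (V j).isOpen.isOpenEmbedding_subtypeVal.map_nhds_eq y

theorem continuousAt_sigma_iff {J Z : Type*} [TopologicalSpace Z] {V : J → Opens M} {f : M → Z}
    {q : Σ j, V j} : ContinuousAt (fun q' : Σ j, V j => f q'.2) q ↔ ContinuousAt f (q.2 : M) := by
  rw [ContinuousAt, ContinuousAt, ← map_nhds_sigma q, Filter.tendsto_map'_iff]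
  rfl

theorem eventually_sigma_iff {J : Type*} {V : J → Opens M} {p : M → Prop} {q : Σ j, V j} :
    (∀ᶠ q' : Σ j, V j in 𝓝 q, p q'.2) ↔ ∀ᶠ y in 𝓝 (q.2 : M), p y := by
  rw [← map_nhds_sigma q, Filter.eventually_map]

theorem eventually_fst_eq {J : Type*} {V : J → Opens M} (q : Σ j, V j) :
    ∀ᶠ q' : Σ j, V j in 𝓝 q, q'.1 = q.1 := by
  obtain ⟨j, y⟩ := q
  rw [Sigma.nhds_mk, Filter.eventually_map]
  exact Filter.Eventually.of_forall fun _ => rfl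

/-- The subset of `M` over which a subset of the disjoint union lies, in one component. -/
def slice {J : Type*} {V : J → Opens M} (j : J) (S : Set (Σ j, V j)) : Set M :=
  {y | ∃ h : y ∈ V j, (⟨j, y, h⟩ : Σ j, V j) ∈ S}

theorem isOpen_slice {J : Type*} {V : J → Opens M} (j : J) {S : Set (Σ j, V j)} (hS : IsOpen S) :
    IsOpen (slice j S) := by
  have h : slice j S = Subtype.val '' ((fun y : V j => (⟨j, y⟩ : Σ j, V j)) ⁻¹' S) := by
    ext y
    constructor
    · rintro ⟨h, hy⟩; exact ⟨⟨y, h⟩, hy, rfl⟩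
    · rintro ⟨⟨y, h⟩, hy, rfl⟩; exact ⟨h, hy⟩
  rw [h]
  exact (V j).isOpen.isOpenEmbedding_subtypeVal.isOpenMap _ (hS.preimage continuous_sigmaMk)

end Cech

/-! ### Descent for morphisms -/

theorem exists_index {M : Type u} [TopologicalSpace M] {I : Type v} {U : I → Opens M}
    (hU : ⨆ i, U i = ⊤) (x : M) : ∃ i, x ∈ U i := by
  have : x ∈ ⨆ i, U i := by rw [hU]; trivial
  simpa using this

namespace DDBundle
variable {X : Type u} [TopologicalSpace X] {A B : DDBundle X}

/-- The scalar `ph`, as a complex number of modulus one. -/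
def cph {E F : A ⟶ B} (τ : E ⟶ F) (y : X) : Circle := Morita.TwoIso.phase τ y

theorem coe_cph {E F : A ⟶ B} (τ : E ⟶ F) (y : X) : (cph τ y : ℂ) = ph τ y :=
  Morita.TwoIso.coe_phase τ y

/-- The `2`-morphism with given scalars. -/
def homOfPhase (E F : A ⟶ B) (s : X → Circle) (h : ∀ x, ContinuousAt (fun y => s y *
    Morita.chartPhase F x y * (Morita.chartPhase E x y)⁻¹) x) : E ⟶ F :=
  Morita.TwoIso.ofPhase E F s h

theorem ph_homOfPhase (E F : A ⟶ B) (s : X → Circle) (h) (y : X) :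
    ph (homOfPhase E F s h) y = s y := Morita.TwoIso.scalar_ofPhase E F s h y

theorem continuousAt_cph {E F : A ⟶ B} (τ : E ⟶ F) (x : X) :
    ContinuousAt (fun y => cph τ y * Morita.chartPhase F x y * (Morita.chartPhase E x y)⁻¹) x :=
  Morita.TwoIso.continuousAt_phase τ x

end DDBundle

section Hom
variable {M : Type u} [TopologicalSpace M] {I : Type v} {U : I → Opens M}

namespace Cech
variable (idx : M → I) (hidx : ∀ x, x ∈ U (idx x))

/-- The chosen point over a point of `M`. -/
def pt (x : M) : Γ₀ U := ⟨idx x, x, hidx x⟩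

/-- The `1`-simplex from the chosen point over the same point of `M`. -/
def toPt (p : Γ₀ U) : Γ₁ U := ⟨(idx p.2, p.1), p.2, hidx p.2, p.2.2⟩

/-- The `2`-simplex on a `1`-simplex and the chosen point over the same point of `M`. -/
def toEdge (q : Γ₁ U) : Γ₂ U := ⟨(idx q.2, q.1.1, q.1.2), q.2, hidx q.2, q.2.2.1, q.2.2.2⟩

end Cech

theorem restrictHom₂_injective (hU : ⨆ i, U i = ⊤) {A B : DDBundle M} {E F : A ⟶ B} {σ τ : E ⟶ F}
    (h : restrictHom₂ U σ = restrictHom₂ U τ) : σ = τ :=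
  DDBundle.hom_ext fun y => by
    obtain ⟨i, hi⟩ := exists_index hU y
    have h1 := congrArg Desc.Hom₂.β h
    exact congrArg (fun β => DDBundle.ph β ⟨i, y, hi⟩) h1

/-- The structure 2-arrows of restrictions have scalar 1, so compatibility over double overlaps says
that the scalar of b depends only on the underlying point of M. Continuity descends because M is
locally homeomorphic to the cover. -/
theorem restrictHom₂_surjective (hU : ⨆ i, U i = ⊤) {A B : DDBundle M} {E F : A ⟶ B}
    (b : Desc.Hom₂ (restrictHom U E) (restrictHom U F)) : ∃ τ : E ⟶ F, restrictHom₂ U τ = b := by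
  choose idx hidx using exists_index hU
  have key : ∀ p : Γ₀ U, DDBundle.cph b.β (pt idx hidx p.2) = DDBundle.cph b.β p := fun p => by
    apply Circle.coe_injective
    have h := b.ph_comm (toPt idx hidx p)
    rw [ph_restrictHom, ph_restrictHom, mul_one, one_mul] at h
    rw [DDBundle.coe_cph, DDBundle.coe_cph]
    exact h
  have hcont : ∀ x, ContinuousAt (fun y => DDBundle.cph b.β (pt idx hidx y) *
      Morita.chartPhase F x y * (Morita.chartPhase E x y)⁻¹) x := fun x => by
    refine continuousAt_sigma_iff (q := pt idx hidx x) |>.1 ?_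
    refine (DDBundle.continuousAt_cph b.β (pt idx hidx x)).congr ?_
    have h1 : ∀ᶠ p : Γ₀ U in 𝓝 (pt idx hidx x), (p.2 : M) ∈ Morita.base E x :=
      eventually_sigma_iff.2 (Morita.base_mem_nhds E x)
    have h2 : ∀ᶠ p : Γ₀ U in 𝓝 (pt idx hidx x), (p.2 : M) ∈ Morita.base F x :=
      eventually_sigma_iff.2 (Morita.base_mem_nhds F x)
    filter_upwards [h1, h2] with p hE hF
    rw [key]
    exact congrArg₂ (fun c d => DDBundle.cph b.β p * c * d⁻¹)
      (Morita.chartPhase_pullback (proj U) F (x := pt idx hidx x) (y := p) hF)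
      (Morita.chartPhase_pullback (proj U) E (x := pt idx hidx x) (y := p) hE)
  refine ⟨DDBundle.homOfPhase E F _ hcont, Desc.Hom₂.ext (DDBundle.hom_ext fun p => ?_)⟩
  change DDBundle.ph (DDBundle.homOfPhase E F _ hcont) (p.2 : M) = _
  rw [DDBundle.ph_homOfPhase, key, DDBundle.coe_cph]

end Hom

end

/-! ### Essential surjectivity on 1-arrows -/

section
open Cech

namespace Cech
variable {M : Type u} [TopologicalSpace M] {I : Type v} {U : I → Opens M}

/-- Face maps are local homeomorphisms too. In particular, continuity at one end of an edge may be
tested on the edge, which is how continuity travels from sheet to sheet. -/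
theorem map_nhds_reindex {J K : Type*} {V : J → Opens M} {W : K → Opens M} (g : J → K)
    (h : ∀ j, V j ≤ W (g j)) (q : Σ j, V j) :
    Filter.map (reindex g h) (𝓝 q) = 𝓝 (reindex g h q) := by
  obtain ⟨j, y⟩ := q
  rw [Sigma.nhds_mk, Filter.map_map]
  change Filter.map (Sigma.mk (g j) ∘ Set.inclusion (h j)) (𝓝 y) =
    𝓝 (⟨g j, Set.inclusion (h j) y⟩ : Σ k, W k)
  rw [Sigma.nhds_mk, ← Filter.map_map]
  congr 1
  exact (Opens.isOpenEmbedding_of_le (h j)).map_nhds_eq y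

theorem continuousAt_reindex_iff {J K Z : Type*} [TopologicalSpace Z] {V : J → Opens M}
    {W : K → Opens M} (g : J → K) (h : ∀ j, V j ≤ W (g j)) {f : (Σ k, W k) → Z} {q : Σ j, V j} :
    ContinuousAt (fun q' => f (reindex g h q')) q ↔ ContinuousAt f (reindex g h q) := by
  rw [ContinuousAt, ContinuousAt, ← map_nhds_reindex g h q, Filter.tendsto_map'_iff]
  rfl

theorem continuousAt_v₀_iff {Z : Type*} [TopologicalSpace Z] {f : Γ₀ U → Z} {q : Γ₁ U} :
    ContinuousAt (fun q' => f (v₀ U q')) q ↔ ContinuousAt f (v₀ U q) :=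
  continuousAt_reindex_iff _ _

theorem continuousAt_v₁_iff {Z : Type*} [TopologicalSpace Z] {f : Γ₀ U → Z} {q : Γ₁ U} :
    ContinuousAt (fun q' => f (v₁ U q')) q ↔ ContinuousAt f (v₁ U q) :=
  continuousAt_reindex_iff _ _

end Cech

theorem circle_smul_smul {V : Type*} [AddCommGroup V] [Module ℂ V] {c d e : Circle} (h : c * d = e)
    (T : V) : (c : ℂ) • (d : ℂ) • T = (e : ℂ) • T := by
  rw [smul_smul, ← Circle.coe_mul, h]

theorem smul_conjMap_smul {H K H' K' : Type*} [NormedAddCommGroup H] [InnerProductSpace ℂ H]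
    [CompleteSpace H] [NormedAddCommGroup K] [InnerProductSpace ℂ K]
    [NormedAddCommGroup H'] [InnerProductSpace ℂ H'] [CompleteSpace H']
    [NormedAddCommGroup K'] [InnerProductSpace ℂ K']
    (c d : Circle) (u : K →L[ℂ] K') (w : H →L[ℂ] H') (T : H →L[ℂ] K) :
    (c : ℂ) • conjMap u w ((d : ℂ) • T) = ((c * d : Circle) : ℂ) • conjMap u w T := by
  rw [map_smul, smul_smul, Circle.coe_mul]

section HomDescent
variable {M : Type u} [TopologicalSpace M] {I : Type v} {U : I → Opens M} {A B : DDBundle M}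
  (f : Desc.Hom₁ (restrictObj U A) (restrictObj U B)) (idx : M → I) (hidx : ∀ x, x ∈ U (idx x))

namespace Desc.Hom₁

/-- The scalar of the structure `2`-morphism on the `1`-simplex from the chosen point. -/
def gauge (p : Γ₀ U) : Circle := DDBundle.cph f.α (toPt idx hidx p)

/-- The cocycle identity of f on the triangle with vertices on the chosen sheet and at the two ends
of q; the 2-arrows of restricted objects contribute 1. -/
theorem gauge_mul (q : Γ₁ U) :
    f.gauge idx hidx (v₀ U q) * DDBundle.cph f.α q = f.gauge idx hidx (v₁ U q) := by
  apply Circle.coe_injective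
  have h := f.ph_coh (toEdge idx hidx q)
  rw [ph_restrictObj, ph_restrictObj, mul_one, one_mul] at h
  rw [Circle.coe_mul, gauge, gauge, DDBundle.coe_cph, DDBundle.coe_cph, DDBundle.coe_cph]
  exact h

/-- The previous identity on the degenerate edge at the chosen point, both of whose ends have the
same gauge. -/
theorem gauge_pt (x : M) : f.gauge idx hidx (pt idx hidx x) = 1 :=
  mul_eq_left.1 (f.gauge_mul idx hidx (toPt idx hidx (pt idx hidx x)))

/-- Continuity of α, with the chart phases of its composite source and target expanded; the identity
factors coming from the restricted objects have phase 1. -/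
theorem continuousAt_edge (q : Γ₁ U) : ContinuousAt (fun q' => DDBundle.cph f.α q' *
    Morita.chartPhase f.F (v₁ U q) (v₁ U q') * (Morita.chartPhase f.F (v₀ U q) (v₀ U q'))⁻¹) q := by
  refine (DDBundle.continuousAt_cph f.α q).congr ?_
  have h0 : ∀ᶠ q' in 𝓝 q, v₀ U q' ∈ Morita.base f.F (v₀ U q) :=
    (v₀ U).continuous.continuousAt (Morita.base_mem_nhds f.F (v₀ U q))
  have h1 : ∀ᶠ q' in 𝓝 q, v₁ U q' ∈ Morita.base f.F (v₁ U q) :=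
    (v₁ U).continuous.continuousAt (Morita.base_mem_nhds f.F (v₁ U q))
  filter_upwards [h0, h1] with q' h0 h1
  have e1 := Morita.chartPhase_comp (restrictObj U A).E (DDBundle.pullbackHom (v₁ U) f.F)
    (x := q) (y := q') (Morita.base_subset f.F _ h1).1 h1
  have e2 : Morita.chartPhase (restrictObj U A).E q q' = 1 :=
    Morita.chartPhase_id (A := (A.pullback (proj U)).pullback (v₀ U)) (Morita.base_subset f.F _ h0).1
  have e3 := Morita.chartPhase_comp (DDBundle.pullbackHom (v₀ U) f.F) (restrictObj U B).E
    (x := q) (y := q') h0 (Morita.base_subset f.F _ h1).2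
  have e4 : Morita.chartPhase (restrictObj U B).E q q' = 1 :=
    Morita.chartPhase_id (A := (B.pullback (proj U)).pullback (v₀ U)) (Morita.base_subset f.F _ h0).2
  have e5 := Morita.chartPhase_pullback (v₀ U) f.F (x := q) (y := q') h0
  have e6 := Morita.chartPhase_pullback (v₁ U) f.F (x := q) (y := q') h1
  refine congrArg₂ (fun c d => DDBundle.cph f.α q' * c * d⁻¹) ?_ ?_
  · refine e1.trans ?_
    rw [e2, mul_one]
    exact e6
  · refine e3.trans ?_
    rw [e4, one_mul]
    exact e5

open Classical in
/-- The scalars that define the charts of the descended Morita isomorphism. -/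
def descPhase (x y : M) : Circle :=
  if h : y ∈ U (idx x) then Morita.chartPhase f.F (pt idx hidx x) ⟨idx x, y, h⟩ *
    f.gauge idx hidx ⟨idx x, y, h⟩ else 1

theorem descPhase_eq {x : M} {p : Γ₀ U} (hp : p.1 = idx x) : f.descPhase idx hidx x p.2 =
    Morita.chartPhase f.F (pt idx hidx x) p * f.gauge idx hidx p := by
  obtain ⟨i, y⟩ := p
  obtain rfl : i = idx x := hp
  rw [descPhase, dif_pos y.2]

/-- The descended Morita isomorphism. -/
def descend : A ⟶ B :=
  Morita.ofChartPhase (A := A) (B := B)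
    (fun x => slice (idx x) (Morita.base f.F (pt idx hidx x)))
    (fun x => isOpen_slice _ (Morita.isOpen_base f.F _))
    (fun x => ⟨hidx x, Morita.mem_base f.F (pt idx hidx x)⟩)
    (fun x y ⟨h, hy⟩ => Morita.base_subset f.F _ hy)
    (f.descPhase idx hidx)
    (fun x₀ x₁ s z ⟨⟨h₀, hz₀⟩, ⟨h₁, hz₁⟩⟩ hs => by
      -- A section s downstairs gives the section e of F whose value at p is s, multiplied by the
      -- gauge, in the centred chart. In the charts of F on the chosen sheets, e looks exactly like
      -- s in the proposed charts.
      choose e he using fun p : Γ₀ U => (Morita.isChart f.F p p (Morita.mem_base f.F p)).exists_eq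
        (T := (f.gauge idx hidx p : ℂ) • (s p.2).1) (IsCompactOperator.smul (s p.2).2 _)
      have hF : ∀ p₀ p, p ∈ Morita.base f.F p₀ → Morita.chart f.F p₀ p (e p) =
          ((Morita.chartPhase f.F p₀ p * f.gauge idx hidx p : Circle) : ℂ) •
            conjMap (B.implement p₀.2 p.2) (A.implement p₀.2 p.2) (s p.2).1 := fun p₀ p hp =>
        (Morita.chart_eq f.F hp (e p)).trans ((congrArg (fun T =>
          (Morita.chartPhase f.F p₀ p : ℂ) • conjMap (B.implement p₀.2 p.2) (A.implement p₀.2 p.2) T)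
            (he p)).trans (smul_conjMap_smul _ _ _ _ _))
      have key : ∀ x z (h : z ∈ U (idx x)),
          (⟨idx x, z, h⟩ : Γ₀ U) ∈ Morita.base f.F (pt idx hidx x) →
          ∀ᶠ p : Γ₀ U in 𝓝 ⟨idx x, z, h⟩, conjChart (f.descPhase idx hidx x p.2)
            (B.implement x p.2) (A.implement x p.2) (s p.2) =
              Morita.chart f.F (pt idx hidx x) p (e p) := fun x z h hz => by
        filter_upwards [(Morita.isOpen_base f.F _).mem_nhds hz, eventually_fst_eq _] with p hp hp'
        refine Eq.trans ?_ (hF _ p hp).symm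
        rw [conjChart_apply, f.descPhase_eq idx hidx hp']
        rfl
      -- Continuity of e is carried from the sheet of x₀ to that of x₁ along this edge: pull back
      -- along `v₀`, multiply by the continuous product from `continuousAt_edge`, and push down
      -- along `v₁`. The relation `gauge_mul` matches the scalars.
      let q : Γ₁ U := ⟨(idx x₀, idx x₁), z, h₀, h₁⟩
      have h1 := (continuousAt_sigma_iff (V := U) (q := ⟨idx x₀, z, h₀⟩)).2 hs
      have h2 := (Morita.contAt_iff f.F e hz₀).2 (h1.congr (key x₀ z h₀ hz₀))
      have h3 := (continuousAt_v₀_iff (q := q)).2 h2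
      have h4 := (continuousAt_coe_circle.2 (f.continuousAt_edge q)).smul h3
      have h5 : ContinuousAt (fun q' => Morita.chart f.F (v₁ U q) (v₁ U q') (e (v₁ U q'))) q := by
        refine h4.congr ?_
        have g0 : ∀ᶠ q' in 𝓝 q, v₀ U q' ∈ Morita.base f.F (v₀ U q) :=
          (v₀ U).continuous.continuousAt (Morita.base_mem_nhds f.F (v₀ U q))
        have g1 : ∀ᶠ q' in 𝓝 q, v₁ U q' ∈ Morita.base f.F (v₁ U q) :=
          (v₁ U).continuous.continuousAt (Morita.base_mem_nhds f.F (v₁ U q))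
        filter_upwards [g0, g1] with q' g0 g1
        refine Eq.trans (congrArg (fun T => ((DDBundle.cph f.α q' * Morita.chartPhase f.F (v₁ U q)
          (v₁ U q') * (Morita.chartPhase f.F (v₀ U q) (v₀ U q'))⁻¹ : Circle) : ℂ) • T)
          (hF (v₀ U q) (v₀ U q') g0)) (Eq.trans ?_ (hF _ _ g1).symm)
        refine circle_smul_smul ?_ (conjMap (B.implement z q'.2) (A.implement z q'.2) (s q'.2).1)
        rw [← f.gauge_mul idx hidx q']
        generalize Morita.chartPhase f.F (v₀ U q) (v₀ U q') = c
        rw [mul_assoc, inv_mul_cancel_left, mul_comm (DDBundle.cph f.α q'), mul_assoc,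
          mul_comm (DDBundle.cph f.α q')]
      have h6 := (continuousAt_v₁_iff (f := fun p => Morita.chart f.F (v₁ U q) p (e p))).1 h5
      have h7 := (Morita.contAt_iff f.F e hz₁).1 h6
      exact (continuousAt_sigma_iff (V := U) (q := ⟨idx x₁, z, h₁⟩)).1
        (h7.congr ((key x₁ z h₁ hz₁).mono fun _ h => h.symm)))

/-- The gauge is 1 at the chosen point, so the phase agrees with that of F there and cancels against
the ambiguity of `implement y y`. -/
theorem descPhase_self (y : M) (T : CompactMap (A.hilb y) (B.hilb y)) :
    conjChart (f.descPhase idx hidx y y) (B.implement y y) (A.implement y y) T = T.1 := by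
  let p := pt idx hidx y
  obtain ⟨e, he⟩ := (Morita.isChart f.F p p (Morita.mem_base f.F p)).exists_eq (T := T.1) T.2
  have h := Morita.chart_eq f.F (Morita.mem_base f.F p) e
  rw [he] at h
  refine Eq.trans ?_ h.symm
  have hd : f.descPhase idx hidx y y = Morita.chartPhase f.F p p :=
    (f.descPhase_eq idx hidx (x := y) (p := p) rfl).trans (mul_eq_left.2 (f.gauge_pt idx hidx y))
  rw [conjChart_apply, hd]
  rfl

/-- Because the centred charts of the descended bundle are the tautological ones, the phases put
into its definition are its chart phases. -/
theorem chartPhase_descend {x : M} {p : Γ₀ U} (h : p.1 = idx x)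
    (hp : p ∈ Morita.base f.F (pt idx hidx x)) :
    Morita.chartPhase (f.descend idx hidx) x p.2 =
      Morita.chartPhase f.F (pt idx hidx x) p * f.gauge idx hidx p := by
  rw [← f.descPhase_eq idx hidx h]
  have hb : (p.2 : M) ∈ Morita.base (f.descend idx hidx) x := by
    obtain ⟨i, y⟩ := p
    obtain rfl : i = idx x := h
    exact ⟨y.2, hp⟩
  obtain ⟨T, hT⟩ := Morita.exists_chart_ne_zero (f.descend idx hidx) hb
  refine Morita.chartPhase_eq (f.descend idx hidx) hb hT ?_
  refine Eq.trans ?_ (congrArg (fun S => (f.descPhase idx hidx x p.2 : ℂ) •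
    conjMap (B.implement x p.2) (A.implement x p.2) S) (f.descPhase_self idx hidx p.2 T)).symm
  rfl

/-- The comparison of the descended Morita isomorphism with the given one. -/
def descendHom : DDBundle.pullbackHom (proj U) (f.descend idx hidx) ⟶ f.F :=
  DDBundle.homOfPhase _ _ (f.gauge idx hidx) fun p => by
    -- Continuity at p is tested on the edge from the chosen sheet. There the gauge at the end v₁ is
    -- the gauge at v₀ times α, and the gauge at v₀ cancels against the one in the phase of the
    -- descended bundle, leaving the product of `continuousAt_edge`.
    let q := toPt idx hidx p
    have h1 := f.continuousAt_edge q
    refine (continuousAt_v₁_iff (q := q)).1 (h1.congr ?_)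
    have g0 : ∀ᶠ q' in 𝓝 q, v₀ U q' ∈ Morita.base f.F (v₀ U q) :=
      (v₀ U).continuous.continuousAt (Morita.base_mem_nhds f.F (v₀ U q))
    filter_upwards [g0, (v₀ U).continuous.continuousAt (eventually_fst_eq (v₀ U q))] with q' g0 g1
    have e1 : Morita.chartPhase (DDBundle.pullbackHom (proj U) (f.descend idx hidx)) p (v₁ U q') =
        Morita.chartPhase (f.descend idx hidx) p.2 (v₀ U q').2 :=
      Morita.chartPhase_pullback (proj U) (f.descend idx hidx) (x := p) (y := v₁ U q') (by
        obtain ⟨⟨i, j⟩, y⟩ := q'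
        obtain rfl : i = idx p.2 := g1
        exact ⟨y.2.1, g0⟩)
    have e2 := e1.trans (f.chartPhase_descend idx hidx (x := p.2) (p := v₀ U q') g1 g0)
    rw [e2, ← f.gauge_mul idx hidx q']
    change DDBundle.cph f.α q' * Morita.chartPhase f.F p (v₁ U q') *
      (Morita.chartPhase f.F (v₀ U q) (v₀ U q'))⁻¹ = f.gauge idx hidx (v₀ U q') *
        DDBundle.cph f.α q' * Morita.chartPhase f.F p (v₁ U q') *
        (Morita.chartPhase f.F (v₀ U q) (v₀ U q') * f.gauge idx hidx (v₀ U q'))⁻¹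
    generalize Morita.chartPhase f.F (v₀ U q) (v₀ U q') = c
    rw [mul_inv, mul_assoc, mul_assoc, mul_assoc, mul_comm (f.gauge idx hidx (v₀ U q')) _,
      mul_assoc, mul_assoc, mul_assoc, inv_mul_cancel, mul_one]

/-- The descended Morita isomorphism restricts to the given one. -/
def descendIso : restrictHom U (f.descend idx hidx) ≅ f :=
  Desc.mkIso (f := restrictHom U (f.descend idx hidx)) (g := f)
    (DDBundle.isoOfHom (f.descendHom idx hidx))
    (Desc.Hom₂.ofPh (f := restrictHom U (f.descend idx hidx)) (g := f) (f.descendHom idx hidx)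
      (fun _ => DDBundle.ph_homOfPhase _ _ _ _ _) (fun _ => DDBundle.ph_homOfPhase _ _ _ _ _)
      (ph_restrictHom U _) (fun z => (DDBundle.coe_cph f.α z).symm) (fun z => by
        rw [one_mul, ← Circle.coe_mul, f.gauge_mul])) rfl

end Desc.Hom₁

theorem restriction_mapFunctor_isEquivalence (hU : ⨆ i, U i = ⊤) (A B : DDBundle M) :
    ((restriction U).mapFunctor A B).IsEquivalence := by
  choose idx hidx using exists_index hU
  exact {
    faithful := ⟨fun h => restrictHom₂_injective hU h⟩
    full := ⟨fun b => restrictHom₂_surjective hU b⟩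
    essSurj := ⟨fun f => ⟨Desc.Hom₁.descend f idx hidx, ⟨Desc.Hom₁.descendIso f idx hidx⟩⟩⟩ }

end HomDescent

end

/-! ### The circle-valued functions attached to an object of the descent bicategory -/

section
open Cech

theorem smul_comp_smul {H K L : Type*} [NormedAddCommGroup H] [InnerProductSpace ℂ H]
    [NormedAddCommGroup K] [InnerProductSpace ℂ K] [NormedAddCommGroup L] [InnerProductSpace ℂ L]
    (c d : Circle) (S : K →L[ℂ] L) (T : H →L[ℂ] K) :
    ((c : ℂ) • S) ∘L ((d : ℂ) • T) = ((c * d : Circle) : ℂ) • (S ∘L T) := by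
  rw [ContinuousLinearMap.comp_smul, ContinuousLinearMap.smul_comp, smul_smul, ← Circle.coe_mul,
    mul_comm d c]

namespace Desc
variable {M : Type u} [TopologicalSpace M] {I : Type v} {U : I → Opens M} (P : Desc U)
  (idx : M → I) (hidx : ∀ x, x ∈ U (idx x))

/-- The scalar of `τ` on the `2`-simplex given by a `1`-simplex and the chosen point. -/
def gauge (q : Γ₁ U) : Circle := DDBundle.cph P.τ (toEdge idx hidx q)

/-- Coherence of τ on the tetrahedron obtained from z by adding the vertex on the chosen sheet. It
makes τ a coboundary, pointwise and with no continuity of the gauge. -/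
theorem gauge_mul (z : Γ₂ U) : P.gauge idx hidx (e₀₂ U z) * DDBundle.cph P.τ z =
    P.gauge idx hidx (e₁₂ U z) * P.gauge idx hidx (e₀₁ U z) := by
  apply Circle.coe_injective
  have h := (coh_iff P.τ).1 P.coh ⟨(idx z.2, z.1), z.2, hidx z.2, z.2.2⟩
  simp only [Circle.coe_mul, gauge, DDBundle.coe_cph]
  exact (mul_comm _ _).trans (h.symm.trans (mul_comm _ _))

/-- The fibre of `E` as a space of operators, normalized such that `τ` becomes the composition. -/
def operator (q : Γ₁ U) :
    Morita.fib P.E q →ₗ[ℂ] (P.A.hilb (v₀ U q) →L[ℂ] P.A.hilb (v₁ U q)) :=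
  (P.gauge idx hidx q : ℂ) • Morita.chart P.E q q

/-- The operators of `operator`, transported to fixed Hilbert spaces by the unitary operators that
implement the charts of `A` at `p` and `p'`. -/
def twist (p p' : Γ₀ U) (q : Γ₁ U) : Morita.fib P.E q →ₗ[ℂ] (P.A.hilb p →L[ℂ] P.A.hilb p') :=
  conjMap (P.A.implement p' (v₁ U q)) (P.A.implement p (v₀ U q)) ∘ₗ P.operator idx hidx q

theorem twist_apply (p p' : Γ₀ U) (q : Γ₁ U) (e : Morita.fib P.E q) :
    P.twist idx hidx p p' q e = (P.gauge idx hidx q : ℂ) •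
      conjMap (P.A.implement p' (v₁ U q)) (P.A.implement p (v₀ U q)) (Morita.chart P.E q q e) := by
  change conjMap _ _ ((P.gauge idx hidx q : ℂ) • Morita.chart P.E q q e) = _
  exact map_smul _ _ _

theorem norm_twist {p p' : Γ₀ U} {q : Γ₁ U} (h : v₀ U q ∈ P.A.base p) (h' : v₁ U q ∈ P.A.base p')
    (e : Morita.fib P.E q) : ‖P.twist idx hidx p p' q e‖ = ‖e‖ := by
  rw [twist_apply, norm_smul, Circle.norm_coe, one_mul]
  exact (norm_conjMap (P.A.isUnitaryMap_implement h') (P.A.isUnitaryMap_implement h) _).trans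
    ((Morita.isChart P.E q q (Morita.mem_base P.E q)).norm_map e)

theorem isCompactOperator_twist (p p' : Γ₀ U) (q : Γ₁ U) (e : Morita.fib P.E q) :
    IsCompactOperator (P.twist idx hidx p p' q e) := by
  rw [twist_apply]
  exact (isCompactOperator_conjMap _ _ ((Morita.isChart P.E q q (Morita.mem_base P.E q)).compact
    e)).smul _

/-- Connects the normalized operators with the topology of E: up to an explicit phase, `twist` is a
chart of E moved by transition operators, which become strongly continuous after rescaling. -/
theorem twist_eq_chart {p p' : Γ₀ U} {q q' : Γ₁ U} (hq : q' ∈ Morita.base P.E q)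
    (e : Morita.fib P.E q') :
    conjMap (P.A.transition (v₁ U q) p' (v₁ U q')) (P.A.transition (v₀ U q) p (v₀ U q'))
      (Morita.chart P.E q q' e) =
    ((Morita.chartPhase P.E q q' * (P.gauge idx hidx q')⁻¹ : Circle) : ℂ) •
      P.twist idx hidx p p' q' e := by
  have hb := Morita.base_subset P.E q hq
  have h1 := congrArg (fun S => conjMap (P.A.transition (v₁ U q) p' (v₁ U q'))
    (P.A.transition (v₀ U q) p (v₀ U q')) S) (Morita.chart_eq P.E hq e)
  refine h1.trans ?_
  refine (map_smul _ _ _).trans ?_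
  refine Eq.trans (congrArg (fun S => (Morita.chartPhase P.E q q' : ℂ) • S)
    (conjMap_conjMap (P.A.implement (v₁ U q) (v₁ U q')) (P.A.implement (v₀ U q) (v₀ U q')) _ _
      (Morita.chart P.E q' q' e))) ?_
  rw [P.A.transition_comp_implement hb.1, P.A.transition_comp_implement hb.2, twist_apply,
    smul_smul, ← Circle.coe_mul, inv_mul_cancel_right]

theorem transition_comp_twist {p p' p'' : Γ₀ U} {q : Γ₁ U} (h : v₁ U q ∈ P.A.base p')
    (e : Morita.fib P.E q) : P.A.transition p' p'' (v₁ U q) ∘L P.twist idx hidx p p' q e =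
      P.twist idx hidx p p'' q e := by
  rw [twist_apply, twist_apply, ContinuousLinearMap.comp_smul]
  exact congrArg (fun u => (P.gauge idx hidx q : ℂ) • conjMap u (P.A.implement p (v₀ U q))
    (Morita.chart P.E q q e)) (P.A.transition_comp_implement h)

/-- The purpose of the normalization: the gauge absorbs the scalar of τ, and the implementing
unitary at the middle vertex cancels, so τ becomes composition of operators. -/
theorem twist_comp {p p' p'' : Γ₀ U} {z : Γ₂ U} (h : w₁ U z ∈ P.A.base p')
    (f : Morita.fib (hom₁₂ P.E) z) (e : Morita.fib (hom₀₁ P.E) z) :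
    P.twist idx hidx p p'' (e₀₂ U z) (Morita.TwoIso.app P.τ z
      (Morita.tmul (hom₀₁ P.E) (hom₁₂ P.E) f e)) =
    P.twist idx hidx p' p'' (e₁₂ U z) f ∘L P.twist idx hidx p p' (e₀₁ U z) e := by
  have h1 := Morita.TwoIso.scalar_spec P.τ
    (Morita.mem_base (Morita.comp (hom₀₁ P.E) (hom₁₂ P.E)) z) (Morita.mem_base (hom₀₂ P.E) z)
    (Morita.tmul (hom₀₁ P.E) (hom₁₂ P.E) f e)
  have h2 := h1.trans ((congrArg (fun S => Morita.TwoIso.scalar P.τ z z • S)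
    (Morita.chart_tmul (hom₀₁ P.E) (hom₁₂ P.E) (Morita.mem_base (hom₀₁ P.E) z)
      (Morita.mem_base (hom₁₂ P.E) z) f e)).trans (congrArg (fun c : ℂ => c • _)
      (DDBundle.coe_cph P.τ z).symm))
  refine (P.twist_apply idx hidx p p'' (e₀₂ U z) _).trans ?_
  refine (congrArg (fun S => (P.gauge idx hidx (e₀₂ U z) : ℂ) •
    conjMap (P.A.implement p'' (w₂ U z)) (P.A.implement p (w₀ U z)) S) h2).trans ?_
  refine (smul_conjMap_smul _ _ _ _ _).trans ?_
  refine (congrArg (fun S => ((P.gauge idx hidx (e₀₂ U z) * DDBundle.cph P.τ z : Circle) : ℂ) • S)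
    (conjMap_comp (P.A.isUnitaryMap_implement h) (P.A.implement p'' (w₂ U z))
      (P.A.implement p (w₀ U z)) (Morita.chart (hom₁₂ P.E) z z f)
      (Morita.chart (hom₀₁ P.E) z z e)).symm).trans ?_
  refine (congrArg (fun c : Circle => (c : ℂ) • _) (P.gauge_mul idx hidx z)).trans ?_
  refine Eq.trans ?_ (congrArg₂ (fun S T => S ∘L T) (P.twist_apply idx hidx p' p'' (e₁₂ U z) f)
    (P.twist_apply idx hidx p p' (e₀₁ U z) e)).symm
  exact (smul_comp_smul _ _ _ _).symm

/-- The scalars `s` make `twist` compatible with the topology of `E` at `q`. -/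
structure Good (p p' : Γ₀ U) (s : M → Circle) (q : Γ₁ U) : Prop where
  left : v₀ U q ∈ P.A.base p
  right : v₁ U q ∈ P.A.base p'
  cont : ∀ e : ∀ q', Morita.fib P.E q', Morita.ContAt P.E e q →
    ContinuousAt (fun q' => (s q'.2 : ℂ) • P.twist idx hidx p p' q' (e q')) q

variable {P idx hidx}

namespace Good
variable {p p' p'' : Γ₀ U} {s s' : M → Circle} {q : Γ₁ U}

theorem mul (h : P.Good idx hidx p p' s q) {c : M → Circle} (hc : ContinuousAt c (q.2 : M)) :
    P.Good idx hidx p p' (fun y => c y * s y) q where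
  left := h.left
  right := h.right
  cont e he := by
    have h1 := (continuousAt_coe_circle.2 ((continuousAt_sigma_iff (q := q)).2 hc)).smul (h.cont e he)
    refine h1.congr (Filter.Eventually.of_forall fun q' => ?_)
    exact circle_smul_smul rfl _

/-- Goodness is stated for sections over `Γ₁` only; `continuousAt_transfer` extends it to sections
along a map, as needed for the edges of triangles. -/
theorem comp (h : P.Good idx hidx p p' s q) {Y : Type*} [TopologicalSpace Y] {f : Y → Γ₁ U} {y : Y}
    (hy : f y = q) (hf : ContinuousAt f y) (e : ∀ y, Morita.fib P.E (f y))
    (he : ContinuousAt (fun y' => Morita.chart P.E q (f y') (e y')) y) :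
    ContinuousAt (fun y' => (s (f y').2 : ℂ) • P.twist idx hidx p p' (f y') (e y')) y := by
  have hN : Morita.base P.E q ∩ (v₀ U ⁻¹' P.A.base p ∩ v₁ U ⁻¹' P.A.base p') ∈ 𝓝 q :=
    Filter.inter_mem (Morita.base_mem_nhds P.E q) (Filter.inter_mem
      ((v₀ U).continuous.continuousAt (P.A.base_mem_nhds h.left))
      ((v₁ U).continuous.continuousAt (P.A.base_mem_nhds h.right)))
  exact continuousAt_transfer (V := Morita.fib P.E) (fun q' => Morita.chart P.E q q')
    (fun q' => (s q'.2 : ℂ) • P.twist idx hidx p p' q') hN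
    (fun q' hq' => (Morita.isChart P.E q q' hq'.1).norm_map)
    (fun q' hq' e => by
      rw [LinearMap.smul_apply, norm_smul, Circle.norm_coe, one_mul,
        P.norm_twist idx hidx hq'.2.1 hq'.2.2])
    (fun q' hq' => by
      rw [(Morita.isChart P.E q q (Morita.mem_base P.E q)).range_eq,
        (Morita.isChart P.E q q' hq'.1).range_eq])
    h.cont hy hf e he

/-- Both functions make the same nonvanishing section continuous, so their quotient is continuous by
`Morita.continuousAt_of_smul`. -/
theorem unique (h : P.Good idx hidx p p' s q) (h' : P.Good idx hidx p p' s' q) :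
    ContinuousAt (fun y => s' y * (s y)⁻¹) (q.2 : M) := by
  obtain ⟨a, ha⟩ := exists_ne (0 : P.A.hilb (v₀ U q))
  obtain ⟨b, hb⟩ := exists_ne (0 : P.A.hilb (v₁ U q))
  obtain ⟨e, he, hec⟩ := Morita.exists_contAt P.E q (isCompactOperator_rankOne b a)
  have hq := Morita.mem_base P.E q
  refine (continuousAt_sigma_iff (q := q)).1 (continuousAt_coe_circle.1 ?_)
  refine Morita.continuousAt_of_smul (h.cont e (hec q hq)) ?_ ((h'.cont e (hec q hq)).congr
    (Filter.Eventually.of_forall fun q' => (circle_smul_smul ?_ _).symm))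
  · rw [← norm_ne_zero_iff, norm_smul, Circle.norm_coe, one_mul,
      P.norm_twist idx hidx h.left h.right, ← (Morita.isChart P.E q q hq).norm_map]
    exact (congrArg norm (he q hq)).trans_ne (norm_ne_zero_iff.2
      (InnerProductSpace.rankOne_ne_zero hb ha))
  · rw [inv_mul_cancel_right]

end Good

open Classical in
/-- Good scalars exist locally. -/
theorem exists_good {p p' : Γ₀ U} {q : Γ₁ U} (h : v₀ U q ∈ P.A.base p)
    (h' : v₁ U q ∈ P.A.base p') :
    ∃ s : M → Circle, ∀ᶠ q' in 𝓝 q, P.Good idx hidx p p' s q' := by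
  obtain ⟨ρ, hρ⟩ := P.A.exists_lift (P.A.mem_base (v₀ U q)) h
  obtain ⟨ρ', hρ'⟩ := P.A.exists_lift (P.A.mem_base (v₁ U q)) h'
  -- The phase of `twist_eq_chart` after the two transition operators are multiplied by their
  -- lifting scalars; conjugation inverts the scalar on the source side.
  let s : Γ₁ U → Circle := fun q' => ρ' (v₁ U q') * (ρ (v₀ U q'))⁻¹ *
    (Morita.chartPhase P.E q q' * (P.gauge idx hidx q')⁻¹)
  -- Good functions live on all of M, but only their germs matter, so the value 1 off this component
  -- is arbitrary.
  let dM : M → Circle := fun y => if hy : y ∈ U q.1.1 ⊓ U q.1.2 then s ⟨q.1, y, hy⟩ else 1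
  have hs : ∀ q' : Γ₁ U, q'.1 = q.1 → dM q'.2 = s q' := by
    intro q' h
    obtain ⟨⟨i, j⟩, y⟩ := q
    obtain ⟨i', y'⟩ := q'
    obtain rfl : i' = (i, j) := h
    exact dif_pos y'.2
  refine ⟨dM, ?_⟩
  have hev : ∀ᶠ q' in 𝓝 q, q'.1 = q.1 ∧ q' ∈ Morita.base P.E q ∧ v₀ U q' ∈ P.A.base p ∧
      v₁ U q' ∈ P.A.base p' := by
    filter_upwards [eventually_fst_eq q, Morita.base_mem_nhds P.E q,
      (v₀ U).continuous.continuousAt (P.A.base_mem_nhds h),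
      (v₁ U).continuous.continuousAt (P.A.base_mem_nhds h')] with q' h1 h2 h3 h4
    exact ⟨h1, h2, h3, h4⟩
  filter_upwards [hev.eventually_nhds, (v₀ U).continuous.continuousAt hρ,
    (v₁ U).continuous.continuousAt hρ'] with r hr hr₀ hr₁
  have hr' := hr.self_of_nhds
  refine ⟨hr'.2.2.1, hr'.2.2.2, fun e he => ?_⟩
  have h1 := (Morita.contAt_iff P.E e hr'.2.1).1 he
  have hs₁ : StrongContAt (fun q' => (ρ' (v₁ U q') : ℂ) • P.A.transition (v₁ U q) p' (v₁ U q')) r :=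
    fun v => ContinuousAt.comp (g := fun x => ((ρ' x : ℂ) • P.A.transition (v₁ U q) p' x) v)
      (hr₁ v) (v₁ U).continuous.continuousAt
  have hs₀ : StrongContAt (fun q' => (ρ (v₀ U q') : ℂ) • P.A.transition (v₀ U q) p (v₀ U q')) r :=
    fun v => ContinuousAt.comp (g := fun x => ((ρ x : ℂ) • P.A.transition (v₀ U q) p x) v)
      (hr₀ v) (v₀ U).continuous.continuousAt
  have h2 := hs₁.conjMap (hr.mono fun q' hq' => ((P.A.isUnitaryMap_transition
      (Morita.base_subset P.E q hq'.2.1).2 hq'.2.2.2).smul _).norm_le) hs₀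
    (hr.mono fun q' hq' => ((P.A.isUnitaryMap_transition
      (Morita.base_subset P.E q hq'.2.1).1 hq'.2.2.1).smul _).norm_le) h1
    ((Morita.isChart P.E q r hr'.2.1).compact (e r))
  refine h2.congr (hr.mono fun q' hq' => ?_)
  refine (conjMap_smul_smul _ _ _ _ _).trans ?_
  have h3 : ((ρ' (v₁ U q') : ℂ) * (starRingEnd ℂ) (ρ (v₀ U q') : ℂ)) =
      ((ρ' (v₁ U q') * (ρ (v₀ U q'))⁻¹ : Circle) : ℂ) := by
    rw [Circle.coe_mul, Circle.coe_inv_eq_conj]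
  refine (congrArg₂ (fun (c : ℂ) S => c • S) h3
    (P.twist_eq_chart idx hidx hq'.2.1 (e q'))).trans ?_
  exact circle_smul_smul (hs q' hq'.1).symm _

namespace Good
variable {p p' p'' : Γ₀ U} {s s' : M → Circle}

/-- The product of good scalars is good. -/
theorem trans {z : Γ₂ U} (h : P.Good idx hidx p p' s (e₀₁ U z))
    (h' : P.Good idx hidx p' p'' s' (e₁₂ U z)) :
    P.Good idx hidx p p'' (fun y => s' y * s y) (e₀₂ U z) := by
  -- Compare with a reference function d known to be good: it remains to see that the quotient of
  -- the product by d is continuous.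
  obtain ⟨d, hdn⟩ := exists_good (P := P) (idx := idx) (hidx := hidx) (q := e₀₂ U z) h.left h'.right
  have hdn := hdn.self_of_nhds
  suffices hc : ContinuousAt (fun y => (s' y * s y) * (d y)⁻¹) (z.2 : M) by
    have := hdn.mul (c := fun y => (s' y * s y) * (d y)⁻¹) hc
    simpa only [inv_mul_cancel_right] using this
  obtain ⟨a, ha⟩ := exists_norm_eq (P.A.hilb (w₀ U z)) (zero_le_one (α := ℝ))
  obtain ⟨b, hb⟩ := exists_norm_eq (P.A.hilb (w₁ U z)) (zero_le_one (α := ℝ))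
  obtain ⟨k, hk⟩ := exists_norm_eq (P.A.hilb (w₂ U z)) (zero_le_one (α := ℝ))
  -- The sections e and f share the middle vector b, so that their product is nonzero at z.
  obtain ⟨e, he, hec⟩ := Morita.exists_contAt (hom₀₁ P.E) z (isCompactOperator_rankOne b a)
  obtain ⟨f, hf, hfc⟩ := Morita.exists_contAt (hom₁₂ P.E) z (isCompactOperator_rankOne k b)
  have hz₀ := Morita.mem_base (hom₀₁ P.E) z
  have hz₁ := Morita.mem_base (hom₁₂ P.E) z
  have h1 := h.comp (f := e₀₁ U) rfl (e₀₁ U).continuous.continuousAt e (hec z hz₀)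
  have h2 := h'.comp (f := e₁₂ U) rfl (e₁₂ U).continuous.continuousAt f (hfc z hz₁)
  -- The 2-arrow τ maps the continuous section f ⊗ e to a continuous section of E over the long
  -- edge. By `twist_comp` its operator is the product of the operators of f and e, so d and s' · s
  -- are compared on one section.
  have h3 := Morita.TwoIso.contAt P.τ _ z
    (Morita.contAt_tmul (hom₀₁ P.E) (hom₁₂ P.E) (hfc z hz₁) (hec z hz₀))
  have h4 := hdn.comp (f := e₀₂ U) rfl (e₀₂ U).continuous.continuousAt _ h3
  have h5 := h2.clm_comp h1
  have hev : ∀ᶠ z' in 𝓝 z, w₁ U z' ∈ P.A.base p' :=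
    (w₁ U).continuous.continuousAt (P.A.base_mem_nhds h.right)
  have h6 : ContinuousAt (fun z' : Γ₂ U => d z'.2 * (s' z'.2 * s z'.2)⁻¹) z := by
    refine continuousAt_coe_circle.1 (Morita.continuousAt_of_smul h5 ?_ (h4.congr ?_))
    · have h7 := P.twist_comp idx hidx (p := p) (p'' := p'') h.right (f z) (e z)
      refine norm_ne_zero_iff.1 ((congrArg norm (smul_comp_smul _ _ _ _)).trans_ne ?_)
      rw [norm_smul, Circle.norm_coe, one_mul]
      refine (congrArg norm h7).symm.trans_ne ?_
      refine (P.norm_twist idx hidx (q := e₀₂ U z) h.left h'.right _).trans_ne ?_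
      refine (LinearIsometryEquiv.norm_map (Morita.TwoIso.app P.τ z) _).trans_ne ?_
      refine ((Morita.isChart (Morita.comp (hom₀₁ P.E) (hom₁₂ P.E)) z z
        (Morita.mem_base (Morita.comp (hom₀₁ P.E) (hom₁₂ P.E)) z)).norm_map _).symm.trans_ne ?_
      refine (congrArg norm ((Morita.chart_tmul (hom₀₁ P.E) (hom₁₂ P.E) hz₀ hz₁ _ _).trans
        (congrArg₂ (fun S T => S ∘L T) (hf z hz₁) (he z hz₀)))).trans_ne ?_
      refine norm_ne_zero_iff.2 fun h0 => ?_
      have h8 : InnerProductSpace.rankOne ℂ k b (InnerProductSpace.rankOne ℂ b a a) = 0 :=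
        congrArg (fun T => T a) h0
      have hk' := norm_ne_zero_iff.1 (hk.trans_ne one_ne_zero)
      simp [ha, hb] at h8
      exact hk' h8
    · filter_upwards [hev] with z' hz'
      refine (congrArg (fun S => (d z'.2 : ℂ) • S) (P.twist_comp idx hidx (p := p) (p'' := p'')
        hz' (f z') (e z'))).trans ?_
      refine Eq.trans ?_ (congrArg (fun S => ((d z'.2 * (s' z'.2 * s z'.2)⁻¹ : Circle) : ℂ) • S)
        (smul_comp_smul (s' z'.2) (s z'.2) _ _)).symm
      exact (circle_smul_smul (inv_mul_cancel_right _ _) _).symm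
  have h7 := (continuousAt_sigma_iff (f := fun y => d y * (s' y * s y)⁻¹) (q := z)).1 h6
  refine h7.inv.congr (Filter.Eventually.of_forall fun y => ?_)
  simp [mul_comm]

/-- On the diagonal the constant `1` is good. -/
theorem one {p : Γ₀ U} {r : Γ₀ U} (h : r ∈ P.A.base p) :
    P.Good idx hidx p p 1 ⟨(r.1, r.1), r.2, r.2.2, r.2.2⟩ := by
  obtain ⟨s, hs⟩ := exists_good (P := P) (idx := idx) (hidx := hidx) (p := p) (p' := p)
    (q := ⟨(r.1, r.1), r.2, r.2.2, r.2.2⟩) h h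
  have hs := hs.self_of_nhds
  -- On the degenerate triangle s · s is good as well. Uniqueness then makes s itself continuous,
  -- and dividing by s leaves the constant 1.
  have h1 : P.Good idx hidx p p (fun y => s y * s y) ⟨(r.1, r.1), r.2, r.2.2, r.2.2⟩ :=
    Good.trans (U := U) (z := (⟨(r.1, r.1, r.1), r.2, r.2.2, r.2.2, r.2.2⟩ : Γ₂ U)) hs hs
  have h2 := hs.unique h1
  simp only [mul_inv_cancel_right] at h2
  have h3 := hs.mul h2.inv
  convert h3 using 1
  funext y
  simp

open Classical in
/-- On the diagonal, good scalars lift the transition functions of `A` to unitary operators. -/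
theorem strongContAt {r : Γ₀ U} {s : M → Circle}
    (h : P.Good idx hidx p p' s ⟨(r.1, r.1), r.2, r.2.2, r.2.2⟩) :
    StrongContAt (fun r' : Γ₀ U => (s r'.2 : ℂ) • P.A.transition p p' r') r := by
  let q : Γ₁ U := ⟨(r.1, r.1), r.2, r.2.2, r.2.2⟩
  have hl : r ∈ P.A.base p := h.left
  have hr : r ∈ P.A.base p' := h.right
  obtain ⟨ρ, hρ⟩ := P.A.exists_lift hl hr
  have hρ := hρ.self_of_nhds
  let c : M → Circle := fun y => if hy : y ∈ U r.1 then ρ ⟨r.1, y, hy⟩ else 1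
  have hc : ∀ r' : Γ₀ U, r'.1 = r.1 → c r'.2 = ρ r' := by
    intro r' h
    obtain ⟨i, y⟩ := r
    obtain ⟨i', y'⟩ := r'
    obtain rfl : i' = i := h
    exact dif_pos y'.2
  have hρc : StrongContAt (fun r' : Γ₀ U => (c r'.2 : ℂ) • P.A.transition p p' r') r := fun v =>
    (hρ v).congr ((eventually_fst_eq r).mono fun r' hr' =>
      congrArg (fun a : Circle => ((a : ℂ) • P.A.transition p p' r') v) (hc r' hr').symm)
  -- A lift of the transition operators is good: with `Good.one`, composing the untwisted operators
  -- for p, p with the lift gives those for p, p', multiplied by c. Hence s differs from c by a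
  -- continuous factor.
  have hgood : P.Good idx hidx p p' c q := by
    refine ⟨hl, hr, fun e he => ?_⟩
    have h1 := (Good.one (P := P) (idx := idx) (hidx := hidx) hl).cont e he
    have hs : StrongContAt (fun q' : Γ₁ U => (c q'.2 : ℂ) • P.A.transition p p' (v₁ U q')) q :=
      fun v => (continuousAt_v₁_iff (q := q)
        (f := fun r' : Γ₀ U => ((c r'.2 : ℂ) • P.A.transition p p' r') v)).2 (hρc v)
    have hev : ∀ᶠ q' in 𝓝 q, v₁ U q' ∈ P.A.base p ∧ v₁ U q' ∈ P.A.base p' :=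
      ((v₁ U).continuous.continuousAt (x := q)).eventually
        (Filter.Eventually.and (P.A.base_mem_nhds hl) (P.A.base_mem_nhds hr))
    have h2 := hs.comp_compact (hev.mono fun q' hq' =>
      ((P.A.isUnitaryMap_transition hq'.1 hq'.2).smul _).norm_le) h1
      ((P.isCompactOperator_twist idx hidx p p q (e q)).smul _)
    refine h2.congr (hev.mono fun q' hq' => ?_)
    refine (smul_comp_smul (c q'.2) 1 _ _).trans ?_
    rw [mul_one, P.transition_comp_twist idx hidx hq'.1]
  have h3 := hgood.unique h
  refine fun v => ((continuousAt_coe_circle.2 ((continuousAt_sigma_iff (q := r)).2 h3)).smul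
    (hρc v)).congr (Filter.Eventually.of_forall fun r' => ?_)
  exact circle_smul_smul (inv_mul_cancel_right _ _) _

end Good

end Desc

end

section

open Filter

/-! ### Gram-Schmidt frames of continuous fields of Hilbert spaces -/

/-- The Hilbert space of square-summable families. -/
abbrev SquareSum (ι : Type*) : Type _ := lp (fun _ : ι => ℂ) 2

section Frames
variable {H : Type*} [NormedAddCommGroup H] [InnerProductSpace ℂ H]

instance (ι : Type*) [Countable ι] : SeparableSpace (SquareSum ι) := by
  classical
  let b : HilbertBasis ι ℂ (SquareSum ι) := ⟨LinearIsometryEquiv.refl ℂ _⟩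
  have h : IsSeparable (Submodule.span ℂ (Set.range b) : Set (SquareSum ι)) :=
    (Set.countable_range b).isSeparable.span
  have h' := h.closure
  rw [← Submodule.topologicalClosure_coe, b.dense_span] at h'
  exact isSeparable_univ_iff.1 h'

/-- If `e` is a bounded sequence, the vectors `η m + 2⁻ʲ e j`, where every `m` occurs for infinitely
many `j`, span a dense subspace as soon as the vectors `η m` and `e j` do. -/
theorem topologicalClosure_span_perturb {e η : ℕ → H} (he : ∀ j, ‖e j‖ ≤ 1)
    (h : (Submodule.span ℂ (Set.range e ∪ Set.range η)).topologicalClosure = ⊤) :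
    (Submodule.span ℂ (Set.range fun j => η (Nat.unpair j).1 +
      ((2⁻¹ ^ j : ℝ) : ℂ) • e j)).topologicalClosure = ⊤ := by
  set v : ℕ → H := fun j => η (Nat.unpair j).1 + ((2⁻¹ ^ j : ℝ) : ℂ) • e j with hv
  set W := (Submodule.span ℂ (Set.range v)).topologicalClosure with hW
  have hvW : ∀ j, v j ∈ W := fun j =>
    Submodule.le_topologicalClosure _ (Submodule.subset_span ⟨j, rfl⟩)
  have hη : ∀ m, η m ∈ W := by
    intro m
    -- Along the infinitely many indices `Nat.pair m i` belonging to m, the perturbation is at most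
    -- 2⁻ⁱ. So η m lies in the closure, and by subtraction so does every e j.
    have hlim : Tendsto (fun i => v (Nat.pair m i)) atTop (𝓝 (η m)) := by
      rw [tendsto_iff_norm_sub_tendsto_zero]
      have h0 : Tendsto (fun i : ℕ => (2⁻¹ : ℝ) ^ i) atTop (𝓝 0) :=
        tendsto_pow_atTop_nhds_zero_of_lt_one (by norm_num) (by norm_num)
      refine squeeze_zero (fun _ => norm_nonneg _) (fun i => ?_) h0
      simp only [hv, Nat.unpair_pair, add_sub_cancel_left, norm_smul, Complex.norm_real]
      rw [Real.norm_of_nonneg (by positivity)]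
      refine (mul_le_of_le_one_right (by positivity) (he _)).trans ?_
      exact pow_le_pow_of_le_one (by norm_num) (by norm_num) (Nat.right_le_pair m i)
    exact (Submodule.isClosed_topologicalClosure _).mem_of_tendsto hlim
      (Eventually.of_forall fun i => hvW _)
  have hee : ∀ j, e j ∈ W := by
    intro j
    have h1 : ((2⁻¹ ^ j : ℝ) : ℂ) • e j ∈ W := by
      have := W.sub_mem (hvW j) (hη (Nat.unpair j).1)
      simpa only [hv, add_sub_cancel_left] using this
    exact (W.smul_mem_iff (by simp)).1 h1
  rw [eq_top_iff, ← h]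
  refine Submodule.topologicalClosure_minimal _ (Submodule.span_le.2 ?_)
    (Submodule.isClosed_topologicalClosure _)
  rintro _ (⟨j, rfl⟩ | ⟨m, rfl⟩)
  exacts [hee j, hη m]

/-- The inner product with e i kills every η and isolates the i-th coefficient. -/
theorem linearIndependent_perturb {e η : ℕ → H} (he : Orthonormal ℂ e)
    (h : ∀ j m, inner ℂ (e j) (η m) = 0) :
    LinearIndependent ℂ (fun j => η (Nat.unpair j).1 + ((2⁻¹ ^ j : ℝ) : ℂ) • e j) := by
  rw [linearIndependent_iff']
  intro s g hg i hi
  have h1 := congrArg (fun x => inner ℂ (e i) x) hg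
  simp only [inner_sum, inner_smul_right, inner_add_right, h, zero_add, inner_zero_right,
    orthonormal_iff_ite.1 he] at h1
  simpa [hi] using h1

variable [CompleteSpace H]

open Classical in
/-- The unitary operator given by the Gram-Schmidt orthonormalization of a linearly independent total
sequence, and zero for other sequences. -/
def frameMap (v : ℕ → H) : H →L[ℂ] SquareSum ℕ :=
  if h : LinearIndependent ℂ v ∧ (Submodule.span ℂ (Set.range v)).topologicalClosure = ⊤ then
    ((HilbertBasis.mk (InnerProductSpace.gramSchmidtNormed_orthonormal h.1) (by
      rw [InnerProductSpace.span_gramSchmidtNormed_range, InnerProductSpace.span_gramSchmidt,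
        h.2])).repr : H →L[ℂ] SquareSum ℕ)
  else 0

theorem isUnitaryMap_frameMap {v : ℕ → H} (h : LinearIndependent ℂ v)
    (h' : (Submodule.span ℂ (Set.range v)).topologicalClosure = ⊤) : IsUnitaryMap (frameMap v) := by
  rw [frameMap, dif_pos ⟨h, h'⟩]
  exact IsUnitaryMap.of_equiv _

theorem frameMap_apply {v : ℕ → H} (h : LinearIndependent ℂ v)
    (h' : (Submodule.span ℂ (Set.range v)).topologicalClosure = ⊤) (x : H) (n : ℕ) :
    frameMap v x n = inner ℂ (InnerProductSpace.gramSchmidtNormed ℂ v n) x := by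
  rw [frameMap, dif_pos ⟨h, h'⟩]
  change HilbertBasis.repr _ x n = _
  rw [HilbertBasis.repr_apply_apply, HilbertBasis.coe_mk]

/-- Gram-Schmidt is triangular, so the expansion of v j has at most j + 1 terms. Norm continuity of
its image thereby reduces to finitely many scalar functions. -/
theorem frameMap_self {v : ℕ → H} (h : LinearIndependent ℂ v)
    (h' : (Submodule.span ℂ (Set.range v)).topologicalClosure = ⊤) (j : ℕ) : frameMap v (v j) = ∑ n ∈ Finset.range (j + 1),
    lp.single 2 n (inner ℂ (InnerProductSpace.gramSchmidtNormed ℂ v n) (v j) : ℂ) := by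
  ext n
  rw [frameMap_apply h h', lp.coeFn_sum, Finset.sum_apply]
  simp only [lp.coeFn_single, Pi.single_apply]
  rw [Finset.sum_ite_eq]
  split_ifs with hn
  · rfl
  · have hn : j < n := by simpa using hn
    rw [InnerProductSpace.gramSchmidtNormed, inner_smul_left,
      InnerProductSpace.gramSchmidt_inv_triangular ℂ v hn, mul_zero]

end Frames

section FrameContinuity
variable {Y : Type*} [TopologicalSpace Y] {V : Y → Type*} [∀ y, NormedAddCommGroup (V y)]
  [∀ y, InnerProductSpace ℂ (V y)] {v : ℕ → ∀ y, V y} {z : Y}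

/-- The spaces V y are unrelated, so continuity makes sense only for inner products. The
Gram-Schmidt recursion expresses those of the new vectors through the Gram matrix of v, with nonzero
denominators by linear independence. -/
theorem continuousAt_inner_gramSchmidt
    (hli : ∀ᶠ y in 𝓝 z, LinearIndependent ℂ fun j => v j y)
    (hc : ∀ i j, ContinuousAt (fun y => inner ℂ (v i y) (v j y)) z) (n j : ℕ) :
    ContinuousAt (fun y => inner ℂ (InnerProductSpace.gramSchmidt ℂ (fun j => v j y) n) (v j y)) z ∧
    ContinuousAt (fun y => ‖InnerProductSpace.gramSchmidt ℂ (fun j => v j y) n‖) z := by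
  induction n using Nat.strong_induction_on generalizing j with
  | _ n ih =>
  set g : ℕ → ∀ y, V y := fun n y => InnerProductSpace.gramSchmidt ℂ (fun j => v j y) n with hg
  have h1 : ∀ j, ContinuousAt (fun y => inner ℂ (g n y) (v j y)) z := by
    intro j
    have h2 : (fun y => inner ℂ (g n y) (v j y)) = fun y => inner ℂ (v n y) (v j y) -
        ∑ i ∈ Finset.Iio n, (starRingEnd ℂ) (inner ℂ (g i y) (v n y) / (‖g i y‖ : ℂ) ^ 2) *
          inner ℂ (g i y) (v j y) := by
      funext y
      simp only [hg]
      rw [InnerProductSpace.gramSchmidt_def, inner_sub_left, sum_inner]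
      congr 1
      refine Finset.sum_congr rfl fun i _ => ?_
      rw [Submodule.starProjection_singleton, inner_smul_left]
      simp
    rw [h2]
    refine (hc n j).sub (tendsto_finsetSum _ fun i hi => ?_)
    have hi := Finset.mem_Iio.1 hi
    refine ContinuousAt.mul ?_ (ih i hi j).1
    refine (Complex.continuous_conj.continuousAt).comp (ContinuousAt.div (ih i hi n).1
      ((Complex.continuous_ofReal.continuousAt.comp (ih i hi n).2).pow 2) ?_)
    have := InnerProductSpace.gramSchmidt_ne_zero (𝕜 := ℂ) i hli.self_of_nhds
    simpa [hg] using this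
  refine ⟨h1 j, ?_⟩
  -- The vectors v n and g n differ by earlier orthogonal vectors, so ⟨g n, v n⟩ = ‖g n‖².
  have h3 : ∀ y, ‖g n y‖ = Real.sqrt (RCLike.re (inner ℂ (g n y) (v n y))) := by
    intro y
    have h4 : inner ℂ (g n y) (v n y) = inner ℂ (g n y) (g n y) := by
      conv_lhs => rw [InnerProductSpace.gramSchmidt_def'' ℂ (fun j => v j y) n]
      rw [inner_add_right, inner_sum, Finset.sum_eq_zero, add_zero]
      intro i hi
      rw [inner_smul_right, InnerProductSpace.gramSchmidt_orthogonal ℂ _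
        (Finset.mem_Iio.1 hi).ne', mul_zero]
    rw [h4]
    exact norm_eq_sqrt_re_inner _
  refine ContinuousAt.congr (f := fun y => Real.sqrt (RCLike.re (inner ℂ (g n y) (v n y)))) ?_
    (Eventually.of_forall fun y => (h3 y).symm)
  exact Real.continuous_sqrt.continuousAt.comp (RCLike.continuous_re.continuousAt.comp (h1 n))

theorem continuousAt_frameMap [∀ y, CompleteSpace (V y)]
    (hli : ∀ᶠ y in 𝓝 z, LinearIndependent ℂ fun j => v j y)
    (hd : ∀ᶠ y in 𝓝 z, (Submodule.span ℂ (Set.range fun j => v j y)).topologicalClosure = ⊤)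
    (hc : ∀ i j, ContinuousAt (fun y => inner ℂ (v i y) (v j y)) z) (j : ℕ) :
    ContinuousAt (fun y => frameMap (fun j => v j y) (v j y)) z := by
  have h1 : ContinuousAt (fun y => ∑ n ∈ Finset.range (j + 1), lp.single (E := fun _ : ℕ => ℂ) 2 n
      (inner ℂ (InnerProductSpace.gramSchmidtNormed ℂ (fun j => v j y) n) (v j y) : ℂ)) z := by
    refine tendsto_finsetSum _ fun n _ => ?_
    refine ((lp.isometry_single (E := fun _ : ℕ => ℂ) (p := 2) n).continuous.continuousAt).comp
      (f := fun y => inner ℂ (InnerProductSpace.gramSchmidtNormed ℂ (fun j => v j y) n) (v j y)) ?_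
    obtain ⟨h2, h3⟩ := continuousAt_inner_gramSchmidt hli hc n j
    simp only [InnerProductSpace.gramSchmidtNormed, inner_smul_left]
    refine ContinuousAt.mul ?_ h2
    refine Complex.continuous_conj.continuousAt.comp (ContinuousAt.inv₀
      (Complex.continuous_ofReal.continuousAt.comp h3) ?_)
    have := InnerProductSpace.gramSchmidt_ne_zero (𝕜 := ℂ) n hli.self_of_nhds
    simpa using this
  refine h1.congr ?_
  filter_upwards [hli, hd] with y h2 h3
  exact (frameMap_self h2 h3 j).symm

end FrameContinuity
end

section

open Filter

theorem IsUnitaryMap.closure_span_range {H K ι : Type*} [NormedAddCommGroup H]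
    [InnerProductSpace ℂ H] [CompleteSpace H] [NormedAddCommGroup K] [InnerProductSpace ℂ K]
    [CompleteSpace K] {u : H →L[ℂ] K} (hu : IsUnitaryMap u) {v : ι → H}
    (hv : (Submodule.span ℂ (Set.range v)).topologicalClosure = ⊤) :
    (Submodule.span ℂ (Set.range fun i => u (v i))).topologicalClosure = ⊤ := by
  rw [← Submodule.dense_iff_topologicalClosure_eq_top] at hv ⊢
  have h1 : Function.Surjective u := fun y => ⟨_, hu.apply_adjoint y⟩
  have h2 := h1.denseRange.dense_image u.continuous hv
  have h3 : Submodule.span ℂ (Set.range fun i => u (v i)) =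
      (Submodule.span ℂ (Set.range v)).map (u : H →ₗ[ℂ] K) := by
    rw [Submodule.map_span, ← Set.range_comp]
    rfl
  rw [h3]
  exact h2

/-! ### Systems of phases and twisted Hilbert bundles -/

/-- A system of good scalar functions, which are the transition functions of a twisted line bundle:
`good p p' s y` says that `s` is compatible at `y` with the local data `p` and `p'`. -/
structure PhaseSystem (M : Type u) [TopologicalSpace M] (Λ : Type v) where
  dom : Λ → Set M
  isOpen_dom : ∀ p, IsOpen (dom p)
  good : Λ → Λ → (M → Circle) → M → Prop
  mem_left : ∀ {p p' s y}, good p p' s y → y ∈ dom p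
  mem_right : ∀ {p p' s y}, good p p' s y → y ∈ dom p'
  mul : ∀ {p p' s y} {c : M → Circle}, good p p' s y → ContinuousAt c y →
    good p p' (fun y => c y * s y) y
  unique : ∀ {p p' s s' y}, good p p' s y → good p p' s' y →
    ContinuousAt (fun y => s' y * (s y)⁻¹) y
  exists_good : ∀ {p p' y}, y ∈ dom p → y ∈ dom p' → ∃ s, ∀ᶠ y' in 𝓝 y, good p p' s y'
  trans : ∀ {p p' p'' s s' y}, good p p' s y → good p' p'' s' y →
    good p p'' (fun y => s' y * s y) y
  one : ∀ {p y}, y ∈ dom p → good p p 1 y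

/-- Hilbert spaces `hilb y` with unitary local trivializations, twisted by a system of phases. -/
structure TwistedFrames {M : Type u} [TopologicalSpace M] {Λ : Type v} (S : PhaseSystem M Λ)
    (pt : M → Λ) where
  hilb : M → SepHilbert
  base : M → Set M
  isOpen_base : ∀ x, IsOpen (base x)
  mem_base : ∀ x, x ∈ base x
  base_subset : ∀ x, base x ⊆ S.dom (pt x)
  frame : M → ∀ y, hilb y →L[ℂ] SquareSum ℕ
  unitary : ∀ {x y}, y ∈ base x → IsUnitaryMap (frame x y)
  strongContAt : ∀ {x x' s z}, z ∈ base x → z ∈ base x' → S.good (pt x) (pt x') s z →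
    StrongContAt (fun y => (s y : ℂ) • (frame x' y ∘L ContinuousLinearMap.adjoint (frame x y))) z

namespace PhaseSystem
variable {M : Type u} [TopologicalSpace M] {Λ : Type v} (S : PhaseSystem M Λ)

/-- If s' is any good function in the other direction, s' · s is good from p to p and hence
continuous at y by comparison with 1; dividing s' by it gives the inverse of s. -/
theorem symm {S : PhaseSystem M Λ} {p p' : Λ} {s : M → Circle} {y : M} (h : S.good p p' s y) :
    S.good p' p (fun y => (s y)⁻¹) y := by
  obtain ⟨s', hs'⟩ := S.exists_good (S.mem_right h) (S.mem_left h)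
  have hs' := hs'.self_of_nhds
  have h1 := S.unique (S.one (S.mem_left h)) (S.trans h hs')
  have h2 := S.mul hs' h1.inv
  convert h2 using 1
  funext y
  simp [mul_comm]

/-! #### The fibres -/

variable {κ : Type} (loc : κ → Λ)

/-- The fibre of the twisted Hilbert bundle of a family `loc` of local data: the square-summable
families indexed by the data around `y`, with multiplicity. -/
abbrev Fiber (y : M) : Type := SquareSum {a : κ × ℕ // y ∈ S.dom (loc a.1)}

open Classical in
/-- The basis vectors, extended by zero. -/
def vec (a : κ × ℕ) (y : M) : S.Fiber loc y :=
  if h : y ∈ S.dom (loc a.1) then lp.single 2 ⟨a, h⟩ (1 : ℂ) else 0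

open Classical in
theorem inner_vec (a b : κ × ℕ) (y : M) : inner ℂ (S.vec loc a y) (S.vec loc b y) =
    if a = b ∧ y ∈ S.dom (loc a.1) then (1 : ℂ) else 0 := by
  by_cases ha : y ∈ S.dom (loc a.1)
  · by_cases hb : y ∈ S.dom (loc b.1)
    · rw [vec, vec, dif_pos ha, dif_pos hb, lp.inner_single_left, lp.coeFn_single, Pi.single_apply]
      simp [ha, Subtype.ext_iff]
    · rw [vec, vec, dif_neg hb, inner_zero_right, if_neg]
      rintro ⟨rfl, -⟩
      exact hb ha
  · rw [vec, dif_neg ha, inner_zero_left, if_neg fun h => ha h.2]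

theorem closure_span_vec (y : M) :
    (Submodule.span ℂ (Set.range fun a => S.vec loc a y)).topologicalClosure = ⊤ := by
  classical
  let b : HilbertBasis {a : κ × ℕ // y ∈ S.dom (loc a.1)} ℂ (S.Fiber loc y) :=
    ⟨LinearIsometryEquiv.refl ℂ _⟩
  rw [eq_top_iff, ← b.dense_span]
  refine Submodule.topologicalClosure_mono (Submodule.span_mono ?_)
  rintro _ ⟨a, rfl⟩
  refine ⟨a.1, ?_⟩
  rw [← b.repr_symm_single]
  exact dif_pos a.2

variable {loc} in
/-- Sections that are continuous at `z` with respect to the local data `p`, by finite combinations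
of basis vectors. -/
inductive IsSection (p : Λ) (z : M) : (∀ y, S.Fiber loc y) → Prop
  | single (a : κ × ℕ) (t : M → ℝ) (s : M → Circle) (ht : ContinuousAt t z)
      (hs : t z ≠ 0 → S.good (loc a.1) p s z) :
      IsSection p z fun y => ((t y : ℂ) * (s y : ℂ)) • S.vec loc a y
  | add {f g : ∀ y, S.Fiber loc y} : IsSection p z f → IsSection p z g →
      IsSection p z fun y => f y + g y

variable {S loc}

/-- Where a cut-off function vanishes at z the product is squeezed by |t t'| and nothing is required
of the phases. Otherwise both phases start at the same datum, and s · l / l' is continuous by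
transitivity and uniqueness. -/
theorem continuousAt_inner_single {p p' : Λ} {z : M} {s : M → Circle} (h : S.good p p' s z)
    {a a' : κ × ℕ} {t t' : M → ℝ} {l l' : M → Circle} (ht : ContinuousAt t z)
    (hs : t z ≠ 0 → S.good (loc a.1) p l z) (ht' : ContinuousAt t' z)
    (hs' : t' z ≠ 0 → S.good (loc a'.1) p' l' z) :
    ContinuousAt (fun y => (s y : ℂ) * inner ℂ (((t' y : ℂ) * (l' y : ℂ)) • S.vec loc a' y)
      (((t y : ℂ) * (l y : ℂ)) • S.vec loc a y)) z := by
  classical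
  have hval : ∀ y, (s y : ℂ) * inner ℂ (((t' y : ℂ) * (l' y : ℂ)) • S.vec loc a' y)
      (((t y : ℂ) * (l y : ℂ)) • S.vec loc a y) = if a' = a ∧ y ∈ S.dom (loc a'.1) then
      ((t y * t' y : ℝ) : ℂ) * (((s y * l y) * (l' y)⁻¹ : Circle) : ℂ) else 0 := by
    intro y
    rw [inner_smul_left, inner_smul_right, inner_vec]
    split_ifs
    · simp only [Circle.coe_mul, Circle.coe_inv_eq_conj, map_mul, Complex.conj_ofReal,
        Complex.ofReal_mul]
      ring
    · simp
  simp only [hval]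
  by_cases h0 : t z = 0 ∨ t' z = 0
  · have hz : t z * t' z = 0 := mul_eq_zero.2 h0
    rw [ContinuousAt, hz, Complex.ofReal_zero, zero_mul, ite_self]
    have hlim : Tendsto (fun y => |t y * t' y|) (𝓝 z) (𝓝 0) := by
      have := (ht.mul ht').abs
      rwa [ContinuousAt, Pi.mul_apply, hz, abs_zero] at this
    refine squeeze_zero_norm (fun y => ?_) hlim
    split_ifs
    · rw [norm_mul, Circle.norm_coe, mul_one, Complex.norm_real, Real.norm_eq_abs]
    · rw [norm_zero]; positivity
  · push Not at h0
    have h1 := hs h0.1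
    have h2 := hs' h0.2
    by_cases haa : a' = a
    · subst haa
      have h3 := S.unique h2 (S.trans h1 h)
      refine ((Complex.continuous_ofReal.continuousAt.comp (ht.mul ht')).mul
        (continuousAt_coe_circle.2 h3)).congr ?_
      filter_upwards [(S.isOpen_dom _).mem_nhds (S.mem_left h1)] with y hy
      rw [if_pos ⟨rfl, hy⟩]
      rfl
    · simp only [haa, false_and, if_false]
      exact continuousAt_const

theorem IsSection.continuousAt_inner {p p' : Λ} {z : M} {s : M → Circle} (h : S.good p p' s z)
    {f g : ∀ y, S.Fiber loc y} (hf : S.IsSection p z f) (hg : S.IsSection p' z g) :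
    ContinuousAt (fun y => (s y : ℂ) * inner ℂ (g y) (f y)) z := by
  induction hf with
  | single a t l ht hs =>
    induction hg with
    | single a' t' l' ht' hs' => exact continuousAt_inner_single h ht hs ht' hs'
    | add _ _ h1 h2 =>
      simp only [inner_add_left, mul_add]
      exact h1.add h2
  | add _ _ h1 h2 =>
    simp only [inner_add_right, mul_add]
    exact h1.add h2

end PhaseSystem

/-- Metrizability of the base enters here, through the distance to the complement; it yields cut-off
functions that are nonzero exactly on a given open set. -/
theorem exists_continuous_support_eq {M : Type*} [TopologicalSpace M] [MetrizableSpace M] {O : Set M}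
    (hO : IsOpen O) : ∃ t : M → ℝ, Continuous t ∧ ∀ y, t y ≠ 0 ↔ y ∈ O := by
  let := metrizableSpaceMetric M
  rcases Oᶜ.eq_empty_or_nonempty with h | h
  · exact ⟨fun _ => 1, continuous_const, fun y => by simp [Set.compl_empty_iff.1 h]⟩
  · refine ⟨fun y => Metric.infDist y Oᶜ, Metric.continuous_infDist_pt _, fun y => ?_⟩
    rw [← not_iff_not, not_not, ← hO.isClosed_compl.mem_iff_infDist_zero h]
    rfl

namespace PhaseSystem
variable {M : Type u} [TopologicalSpace M] {Λ : Type v} {S : PhaseSystem M Λ}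
  [MetrizableSpace M] [SecondCountableTopology M]

/-- Countably many sections without common zeros. -/
theorem exists_sections (p p' : Λ) : ∃ (t : ℕ → M → ℝ) (s : ℕ → M → Circle),
    (∀ i, Continuous (t i)) ∧ (∀ i y, t i y ≠ 0 → S.good p p' (s i) y) ∧
    ∀ y, y ∈ S.dom p → y ∈ S.dom p' → ∃ i, t i y ≠ 0 := by
  have hex : ∀ z : ↥(S.dom p ∩ S.dom p'), ∃ (s : M → Circle) (O : Set M), IsOpen O ∧ (z : M) ∈ O ∧
      ∀ y ∈ O, S.good p p' s y := by
    intro z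
    obtain ⟨s, hs⟩ := S.exists_good z.2.1 z.2.2
    obtain ⟨O, h1, h2, h3⟩ := eventually_nhds_iff.1 hs
    exact ⟨s, O, h2, h3, h1⟩
  choose s O hO hz hs using hex
  choose t ht ht' using fun z => exists_continuous_support_eq (hO z)
  -- Lindelöf: countably many of the open sets carrying good functions cover the overlap.
  obtain ⟨T, hT, hTO⟩ := isOpen_iUnion_countable O hO
  have hcov : ∀ y, y ∈ S.dom p → y ∈ S.dom p' → ∃ z ∈ T, y ∈ O z := by
    intro y h1 h2
    have : y ∈ ⋃ z, O z := Set.mem_iUnion.2 ⟨⟨y, h1, h2⟩, hz _⟩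
    rw [← hTO] at this
    simpa using this
  -- An empty subcover means that the two domains do not meet; zero sections then do.
  rcases T.eq_empty_or_nonempty with rfl | hne
  · exact ⟨fun _ _ => 0, fun _ _ => 1, fun _ => continuous_const, fun _ _ h => (h rfl).elim,
      fun y h1 h2 => by simpa using hcov y h1 h2⟩
  · obtain ⟨f, rfl⟩ := hT.exists_eq_range hne
    refine ⟨fun i => t (f i), fun i => s (f i), fun i => ht _, fun i y h => hs _ y ((ht' _ y).1 h),
      fun y h1 h2 => ?_⟩
    obtain ⟨_, ⟨i, rfl⟩, hi⟩ := hcov y h1 h2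
    exact ⟨i, (ht' _ y).2 hi⟩

/-- The pointwise linear algebra of the frame: the block k₀ supplies an orthonormal sequence
orthogonal to the η, and the two together contain nonzero multiples of all nonzero basis vectors of
the fibre. -/
theorem linearIndependent_and_total (S : PhaseSystem M Λ) {κ : Type} (loc : κ → Λ) {y : M} {k₀ : κ}
    (hy : y ∈ S.dom (loc k₀)) (l : Circle) (b : ℕ → κ × ℕ) (c : ℕ → ℂ)
    (hb : ∀ m, c m ≠ 0 → (b m).1 ≠ k₀)
    (hc : ∀ a : κ × ℕ, a.1 ≠ k₀ → y ∈ S.dom (loc a.1) → ∃ m, b m = a ∧ c m ≠ 0) :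
    (LinearIndependent ℂ fun j => c (Nat.unpair j).1 • S.vec loc (b (Nat.unpair j).1) y +
      ((2⁻¹ ^ j : ℝ) : ℂ) • (l : ℂ) • S.vec loc (k₀, j) y) ∧
    (Submodule.span ℂ (Set.range fun j => c (Nat.unpair j).1 • S.vec loc (b (Nat.unpair j).1) y +
      ((2⁻¹ ^ j : ℝ) : ℂ) • (l : ℂ) • S.vec loc (k₀, j) y)).topologicalClosure = ⊤ := by
  classical
  obtain ⟨e, he⟩ : ∃ e : ℕ → S.Fiber loc y, e = fun j => (l : ℂ) • S.vec loc (k₀, j) y := ⟨_, rfl⟩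
  obtain ⟨η, hη⟩ : ∃ η : ℕ → S.Fiber loc y, η = fun m => c m • S.vec loc (b m) y := ⟨_, rfl⟩
  have hon : Orthonormal ℂ e := by
    rw [orthonormal_iff_ite]
    intro i j
    rw [he, inner_smul_left, inner_smul_right, inner_vec, ← mul_assoc, ← Circle.coe_inv_eq_conj,
      ← Circle.coe_mul, inv_mul_cancel, Circle.coe_one, one_mul]
    simp [hy]
  have horth : ∀ j m, inner ℂ (e j) (η m) = 0 := by
    intro j m
    rw [he, hη, inner_smul_left, inner_smul_right, inner_vec]
    by_cases h : c m = 0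
    · rw [h, zero_mul, mul_zero]
    · rw [if_neg, mul_zero, mul_zero]
      rintro ⟨h', -⟩
      exact hb m h (congrArg Prod.fst h').symm
  have h1 := linearIndependent_perturb hon horth
  have h2 := topologicalClosure_span_perturb (e := e) (η := η) (fun j => (hon.1 j).le) (by
    rw [eq_top_iff, ← S.closure_span_vec loc y]
    refine Submodule.topologicalClosure_mono (Submodule.span_le.2 ?_)
    rintro _ ⟨⟨k, n⟩, rfl⟩
    by_cases hk : k = k₀
    · subst hk
      have h1 : e n ∈ Submodule.span ℂ (Set.range e ∪ Set.range η) :=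
        Submodule.subset_span (Or.inl ⟨n, rfl⟩)
      rw [he] at h1 ⊢
      exact (Submodule.smul_mem_iff _ (Circle.coe_ne_zero _)).1 h1
    · by_cases hyk : y ∈ S.dom (loc k)
      · obtain ⟨m, hm, hm'⟩ := hc (k, n) hk hyk
        have h1 : η m ∈ Submodule.span ℂ (Set.range e ∪ Set.range η) :=
          Submodule.subset_span (Or.inr ⟨m, rfl⟩)
        have h2 : η m = c m • S.vec loc (k, n) y := by rw [hη, ← hm]
        rw [h2] at h1
        exact (Submodule.smul_mem_iff _ hm').1 h1
      · simp only [vec, dif_neg hyk]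
        exact Submodule.zero_mem _)
  rw [he, hη] at h1 h2
  exact ⟨h1, h2⟩

variable {κ : Type} [Countable κ] {loc : κ → Λ}

open Classical in
/-- Local sections of the twisted Hilbert bundle that are linearly independent and total. -/
theorem exists_total_sections (hloc : ∀ x, ∃ k, x ∈ S.dom (loc k)) (p : Λ) {x : M}
    (hx : x ∈ S.dom p) : ∃ (N : Set M) (v : ℕ → ∀ y, S.Fiber loc y), IsOpen N ∧ x ∈ N ∧
      N ⊆ S.dom p ∧ ∀ y ∈ N, (∀ j, S.IsSection p y (v j)) ∧
        (LinearIndependent ℂ fun j => v j y) ∧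
        (Submodule.span ℂ (Set.range fun j => v j y)).topologicalClosure = ⊤ := by
  obtain ⟨k₀, hk₀⟩ := hloc x
  obtain ⟨l, hl⟩ := S.exists_good hk₀ hx
  obtain ⟨N, hN, hNo, hxN⟩ := eventually_nhds_iff.1 hl
  choose t s ht hs hex using fun k => S.exists_sections (loc k) p
  have : Nonempty κ := ⟨k₀⟩
  -- The sequence runs through triples of a datum k, a copy n of its line, and the number i of a
  -- cut-off section from `exists_sections`.
  obtain ⟨c, hc⟩ := exists_surjective_nat (κ × ℕ × ℕ)
  obtain ⟨b, hb⟩ : ∃ b : ℕ → κ × ℕ, ∀ m, b m = ((c m).1, (c m).2.1) := ⟨_, fun _ => rfl⟩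
  -- The coefficient is zero on the block k₀, whose vectors enter only through the perturbations.
  obtain ⟨r, hr⟩ : ∃ r : ℕ → M → ℝ, ∀ m y, r m y =
    if (c m).1 = k₀ then 0 else t (c m).1 (c m).2.2 y := ⟨_, fun _ _ => rfl⟩
  obtain ⟨σ, hσ⟩ : ∃ σ : ℕ → M → Circle, ∀ m, σ m = s (c m).1 (c m).2.2 := ⟨_, fun _ => rfl⟩
  have hrc : ∀ m, Continuous (r m) := fun m => by
    rw [funext (hr m)]
    split_ifs
    exacts [continuous_const, ht _ _]
  have hrg : ∀ m y, r m y ≠ 0 → (c m).1 ≠ k₀ ∧ S.good (loc (b m).1) p (σ m) y := fun m y h => by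
    rw [hr] at h
    split_ifs at h with h'
    · exact (h rfl).elim
    · rw [hb, hσ]
      exact ⟨h', hs _ _ y h⟩
  refine ⟨N, fun j y => ((r (Nat.unpair j).1 y : ℂ) * (σ (Nat.unpair j).1 y : ℂ)) •
    S.vec loc (b (Nat.unpair j).1) y + ((2⁻¹ ^ j : ℝ) : ℂ) • (l y : ℂ) • S.vec loc (k₀, j) y,
    hNo, hxN, fun y hy => S.mem_right (hN y hy), fun y hy => ⟨fun j => ?_, ?_⟩⟩
  · refine IsSection.add (IsSection.single _ _ _ (hrc _).continuousAt fun h => (hrg _ y h).2) ?_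
    have := IsSection.single (S := S) (p := p) (z := y) (loc := loc) (k₀, j) (fun _ => 2⁻¹ ^ j) l
      continuousAt_const (fun _ => hN y hy)
    simpa only [smul_smul] using this
  · refine S.linearIndependent_and_total loc (S.mem_left (hN y hy)) (l y) b
      (fun m => (r m y : ℂ) * (σ m y : ℂ)) (fun m hm => ?_) fun a ha hya => ?_
    · rw [hb]
      exact (hrg m y (Complex.ofReal_ne_zero.1 (left_ne_zero_of_mul hm))).1
    · obtain ⟨i, hi⟩ := hex a.1 y hya (S.mem_right (hN y hy))
      obtain ⟨m, hm⟩ := hc (a.1, a.2, i)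
      refine ⟨m, by rw [hb, hm], mul_ne_zero (Complex.ofReal_ne_zero.2 ?_) (Circle.coe_ne_zero _)⟩
      rw [hr, hm, if_neg ha]
      exact hi

/-- Twisted Hilbert bundles exist. -/
theorem nonempty_twistedFrames (S : PhaseSystem M Λ) (pt : M → Λ) (hpt : ∀ x, x ∈ S.dom (pt x)) :
    Nonempty (TwistedFrames S pt) := by
  obtain ⟨T, hT, hTO⟩ := isOpen_iUnion_countable S.dom S.isOpen_dom
  have : Countable T := hT.to_subtype
  -- The fibres of a DD-bundle live in `Type`, so the countable set of local data is moved to the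
  -- lowest universe.
  let loc : Shrink.{0} T → Λ := fun k => ((equivShrink.{0} T).symm k : T)
  have hloc : ∀ x, ∃ k, x ∈ S.dom (loc k) := by
    intro x
    have h : x ∈ ⋃ p ∈ T, S.dom p := by rw [hTO]; exact Set.mem_iUnion.2 ⟨_, hpt x⟩
    obtain ⟨p, hp, hx⟩ := Set.mem_iUnion₂.1 h
    exact ⟨equivShrink.{0} T ⟨p, hp⟩, by simpa [loc] using hx⟩
  have : Countable (Shrink.{0} T) := (equivShrink.{0} T).symm.injective.countable
  choose N v hN hxN hNs hv using fun x => exists_total_sections (S := S) hloc (pt x) (hpt x)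
  have hnt : ∀ y, Nontrivial (S.Fiber loc y) := by
    intro y
    obtain ⟨k, hk⟩ := hloc y
    refine ⟨⟨S.vec loc (k, 0) y, 0, fun h => ?_⟩⟩
    have h1 := S.inner_vec loc (k, 0) (k, 0) y
    rw [h, inner_zero_left, if_pos ⟨rfl, hk⟩] at h1
    exact zero_ne_one h1
  refine ⟨{
    hilb := fun y => ⟨S.Fiber loc y⟩
    base := N
    isOpen_base := hN
    mem_base := hxN
    base_subset := hNs
    frame := fun x y => frameMap fun j => v x j y
    unitary := fun {x y} h => isUnitaryMap_frameMap (hv x y h).2.1 (hv x y h).2.2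
    strongContAt := fun {x x' s z} h h' hs => ?_ }⟩
  have hcont : ∀ x, z ∈ N x → ∀ j,
      ContinuousAt (fun y => frameMap (fun j => v x j y) (v x j y)) z := by
    intro x hx
    refine continuousAt_frameMap (Eventually.mono ((hN x).mem_nhds hx) fun y hy => (hv x y hy).2.1)
      (Eventually.mono ((hN x).mem_nhds hx) fun y hy => (hv x y hy).2.2) fun i j => ?_
    -- Within one frame the constant 1 is good, so the Gram matrix itself is continuous.
    refine (IsSection.continuousAt_inner (S.one (hNs x hx)) ((hv x z hx).1 j)
      ((hv x z hx).1 i)).congr (Eventually.of_forall fun y => ?_)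
    simp
  have htot : ∀ x, z ∈ N x → (Submodule.span ℂ (Set.range fun j =>
      frameMap (fun j => v x j z) (v x j z))).topologicalClosure = ⊤ := by
    intro x hx
    exact (isUnitaryMap_frameMap (hv x z hx).2.1 (hv x z hx).2.2).closure_span_range (hv x z hx).2.2
  -- Test on the images of the frame sections, which are norm continuous in ℓ² and total. Their
  -- matrix coefficients are s times inner products of sections for the two data.
  refine strongContAt_of_inner (N := N x ∩ N x') (inter_mem ((hN x).mem_nhds h)
    ((hN x').mem_nhds h')) (fun y hy => ?_) _ _ (hcont x h) (hcont x' h') (htot x h) (htot x' h') ?_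
  · exact ((isUnitaryMap_frameMap (hv x' y hy.2).2.1 (hv x' y hy.2).2.2).comp
      (isUnitaryMap_frameMap (hv x y hy.1).2.1 (hv x y hy.1).2.2).symm).smul _
  · intro i j
    refine (IsSection.continuousAt_inner hs ((hv x z h).1 i) ((hv x' z h').1 j)).congr ?_
    filter_upwards [(hN x).mem_nhds h, (hN x').mem_nhds h'] with y hy hy'
    have h1 := isUnitaryMap_frameMap (hv x y hy).2.1 (hv x y hy).2.2
    have h2 := isUnitaryMap_frameMap (hv x' y hy').2.1 (hv x' y hy').2.2
    rw [smul_apply, inner_smul_right, ContinuousLinearMap.comp_apply,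
      h1.adjoint_apply, h2.inner_map]

end PhaseSystem
end

section

/-! ### The bundle of compact operators of a twisted Hilbert bundle -/

/-- A unitary operator is determined up to a scalar by the conjugation of compact operators. -/
theorem IsUnitaryMap.exists_smul_eq {H K : Type*} [NormedAddCommGroup H] [InnerProductSpace ℂ H]
    [CompleteSpace H] [Nontrivial H] [NormedAddCommGroup K] [InnerProductSpace ℂ K]
    [CompleteSpace K] {u w : H →L[ℂ] K} (hu : IsUnitaryMap u) (hw : IsUnitaryMap w)
    (h : ∀ T : H →L[ℂ] H, IsCompactOperator T → conjMap w w T = conjMap u u T) :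
    ∃ c : Circle, w = (c : ℂ) • u := by
  obtain ⟨p, hp⟩ := exists_norm_eq H (zero_le_one (α := ℝ))
  have h1 : ∀ v, w v = inner ℂ (u p) (w p) • u v := fun v => by
    have h2 := congrArg (fun T => T (w p)) (h _ (isCompactOperator_rankOne v p))
    simpa [conjMap_apply, hw.adjoint_apply, ContinuousLinearMap.adjoint_inner_right, hp] using h2
  have h3 : ‖(inner ℂ (u p) (w p) : ℂ)‖ = 1 := by
    have h4 := congrArg norm (h1 p)
    rw [norm_smul, hw.norm_map, hu.norm_map, hp, mul_one] at h4
    exact h4.symm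
  refine ⟨DDBundle.phase (inner ℂ (u p) (w p)), ContinuousLinearMap.ext fun v => ?_⟩
  rw [DDBundle.phase_eq h3]
  exact h1 v

theorem IsUnitaryMap.smul_comp_adjoint_comp {H K L : Type*} [NormedAddCommGroup H]
    [InnerProductSpace ℂ H] [CompleteSpace H] [NormedAddCommGroup K] [InnerProductSpace ℂ K]
    [CompleteSpace K] [NormedAddCommGroup L] [InnerProductSpace ℂ L] {u : H →L[ℂ] K}
    (hu : IsUnitaryMap u) (c : ℂ) (w : H →L[ℂ] L) :
    (c • (w ∘L ContinuousLinearMap.adjoint u)) ∘L u = c • w := by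
  rw [ContinuousLinearMap.smul_comp, ContinuousLinearMap.comp_assoc, hu.adjoint_comp,
    ContinuousLinearMap.comp_id]

/-- Controls the arbitrary choice in `implement`: any explicit unitary with the same conjugation
differs from it by a phase only. -/
theorem DDBundle.exists_implement_eq {X : Type u} [TopologicalSpace X] (A : DDBundle X) {x y : X}
    (h : y ∈ A.base x) {u : A.hilb y →L[ℂ] A.hilb x} (hu : IsUnitaryMap u)
    (hc : ∀ a, A.chart x y a = conjMap u u (A.chart y y a)) :
    ∃ c : Circle, A.implement x y = (c : ℂ) • u :=
  hu.exists_smul_eq (A.isUnitaryMap_implement h) fun T hT => by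
    obtain ⟨a, rfl⟩ := (A.isChart y y (A.mem_base y)).exists_eq hT
    rw [← A.chart_eq h, hc]

namespace TwistedFrames
variable {M : Type u} [TopologicalSpace M] {Λ : Type v} {S : PhaseSystem M Λ} {pt : M → Λ}
  (W : TwistedFrames S pt)

/-- The circle factor drops out of the conjugation, which is why a twisted Hilbert bundle has an
untwisted bundle of compact operators. -/
theorem conjMap_frame_frame {x x' y : M} (h : y ∈ W.base x) (s : Circle)
    (T : W.hilb y →L[ℂ] W.hilb y) :
    conjMap ((s : ℂ) • (W.frame x' y ∘L ContinuousLinearMap.adjoint (W.frame x y)))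
      ((s : ℂ) • (W.frame x' y ∘L ContinuousLinearMap.adjoint (W.frame x y)))
      (conjMap (W.frame x y) (W.frame x y) T) = conjMap (W.frame x' y) (W.frame x' y) T := by
  rw [conjMap_smul_smul, conjMap_conjMap, ContinuousLinearMap.comp_assoc,
    (W.unitary h).adjoint_comp, ContinuousLinearMap.comp_id, ← Circle.coe_inv_eq_conj,
    ← Circle.coe_mul, mul_inv_cancel, Circle.coe_one, one_smul]

/-- The standard separable Hilbert space. -/
def model : SepHilbert where
  carrier := SquareSum ℕ
  nontrivial := by
    classical
    refine ⟨⟨lp.single 2 0 (1 : ℂ), 0, fun h => ?_⟩⟩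
    have := congrArg (fun f : SquareSum ℕ => f 0) h
    simp at this

/-- The Dixmier-Douady bundle of the compact operators of a twisted Hilbert bundle. -/
def bundle : DDBundle M where
  fib y := compactAlgebra (W.hilb y)
  hilb _ := model
  base := W.base
  isOpen_base := W.isOpen_base
  mem_base := W.mem_base
  chart x y := conjMap (W.frame x y) (W.frame x y) ∘ₗ
    (compactAlgebra (W.hilb y)).toNonUnitalSubalgebra.toSubmodule.subtype
  isChart x y h := {
    norm_map := fun a => norm_conjMap (W.unitary h) (W.unitary h) a.1
    map_mul := fun a b => (conjMap_comp (W.unitary h) _ _ a.1 b.1).symm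
    map_star := fun a => (conjMap_adjoint _ _ a.1).symm
    range_eq := by
      apply Set.Subset.antisymm
      · rintro _ ⟨a, rfl⟩
        exact isCompactOperator_conjMap _ _ a.2
      · intro T hT
        exact ⟨⟨conjMap (ContinuousLinearMap.adjoint (W.frame x y))
          (ContinuousLinearMap.adjoint (W.frame x y)) T, isCompactOperator_conjMap _ _ hT⟩,
          conjMap_conjMap_adjoint (W.unitary h) (W.unitary h) T⟩ }
  compat x₀ x₁ a z hz ha := by
    obtain ⟨s, hs⟩ := S.exists_good (W.base_subset x₀ hz.1) (W.base_subset x₁ hz.2)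
    have h1 := W.strongContAt hz.1 hz.2 hs.self_of_nhds
    have hb : ∀ᶠ y in 𝓝 z, ‖(s y : ℂ) • (W.frame x₁ y ∘L
        ContinuousLinearMap.adjoint (W.frame x₀ y))‖ ≤ 1 := by
      filter_upwards [(W.isOpen_base x₀).mem_nhds hz.1, (W.isOpen_base x₁).mem_nhds hz.2]
        with y h0 h1
      exact (((W.unitary h1).comp (W.unitary h0).symm).smul _).norm_le
    have ha' : ContinuousAt (fun y => conjMap (W.frame x₀ y) (W.frame x₀ y) (a y).1) z := ha
    refine (h1.conjMap hb h1 hb ha' (isCompactOperator_conjMap _ _ (a z).2)).congr ?_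
    filter_upwards [(W.isOpen_base x₀).mem_nhds hz.1] with y hy
    exact W.conjMap_frame_frame hy _ _

/-- The centred chart of the bundle is conjugation by `frame y y`, so the implementing unitary is
`frame x y` after the inverse of `frame y y`, up to a phase. -/
theorem exists_implement_comp_frame {x y : M} (h : y ∈ W.base x) :
    ∃ c : Circle, ((W.bundle).implement x y : SquareSum ℕ →L[ℂ] SquareSum ℕ) ∘L W.frame y y =
      (c : ℂ) • W.frame x y := by
  have hy := W.mem_base y
  obtain ⟨c, hc⟩ := (W.bundle).exists_implement_eq h
    ((W.unitary h).comp (W.unitary hy).symm) (fun a => by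
      have := W.conjMap_frame_frame (x' := x) hy 1 a.1
      rw [Circle.coe_one, one_smul] at this
      exact this.symm)
  exact ⟨c, (congrArg (fun T => T ∘L W.frame y y) hc).trans
    ((W.unitary hy).smul_comp_adjoint_comp c (W.frame x y))⟩

end TwistedFrames

open Cech

/-! ### The phase system of a descent datum -/

namespace Desc
variable {M : Type u} [TopologicalSpace M] {I : Type v} {U : I → Opens M} (P : Desc U)
  (idx : M → I) (hidx : ∀ x, x ∈ U (idx x))

theorem eventually_slice {J : Type*} {V : J → Opens M} {Q : (Σ j, V j) → Prop} {q : Σ j, V j}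
    (h : ∀ᶠ q' in 𝓝 q, Q q') : ∀ᶠ y in 𝓝 (q.2 : M), ∃ hy : y ∈ V q.1, Q ⟨q.1, y, hy⟩ := by
  rw [← map_nhds_sigma q, Filter.eventually_map]
  filter_upwards [h, eventually_fst_eq q] with q' h1 h2
  obtain ⟨j, y⟩ := q
  obtain ⟨j', y'⟩ := q'
  obtain rfl : j' = j := h2
  exact ⟨y'.2, h1⟩

/-- The good scalars of a descent datum. -/
def phaseSystem : PhaseSystem M (Γ₀ U) where
  dom p := slice p.1 (P.A.base p)
  isOpen_dom p := isOpen_slice p.1 (P.A.isOpen_base p)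
  good p p' s y := ∃ h : y ∈ U p.1 ⊓ U p'.1, P.Good idx hidx p p' s ⟨(p.1, p'.1), y, h⟩
  mem_left := fun ⟨h, hg⟩ => ⟨h.1, hg.left⟩
  mem_right := fun ⟨h, hg⟩ => ⟨h.2, hg.right⟩
  mul := fun ⟨h, hg⟩ hc => ⟨h, hg.mul hc⟩
  unique := fun ⟨_, hg⟩ ⟨_, hg'⟩ => hg.unique hg'
  exists_good := fun {p p' y} ⟨h, hb⟩ ⟨h', hb'⟩ => by
    obtain ⟨s, hs⟩ := exists_good (P := P) (idx := idx) (hidx := hidx) (p := p) (p' := p')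
      (q := ⟨(p.1, p'.1), y, h, h'⟩) hb hb'
    exact ⟨s, eventually_slice hs⟩
  trans := fun {p p' p'' s s' y} ⟨h, hg⟩ ⟨h', hg'⟩ =>
    ⟨⟨h.1, h'.2⟩, Good.trans (z := (⟨(p.1, p'.1, p''.1), y, h.1, h'⟩ : Γ₂ U)) hg hg'⟩
  one := fun {p y} ⟨h, hb⟩ => ⟨⟨h, h⟩, Good.one (r := ⟨p.1, y, h⟩) hb⟩

theorem mem_dom (p : Γ₀ U) : (p.2 : M) ∈ (P.phaseSystem idx hidx).dom p :=
  ⟨p.2.2, P.A.mem_base p⟩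

/-- In one component, good scalars lift the transition functions. -/
theorem strongContAt_of_good {p p' r : Γ₀ U} {s : M → Circle} (h : r.1 = p.1) (h' : r.1 = p'.1)
    (hs : (P.phaseSystem idx hidx).good p p' s r.2) :
    StrongContAt (fun r' : Γ₀ U => (s r'.2 : ℂ) • P.A.transition p p' r') r := by
  obtain ⟨i, x⟩ := p
  obtain ⟨i', x'⟩ := p'
  obtain rfl : r.1 = i := h
  obtain rfl : r.1 = i' := h'
  exact Good.strongContAt hs.2

/-- The scalars of the charts of `E` are good, up to the gauge. -/
theorem good_chartPhase (q : Γ₁ U) {s : M → Circle} (hs : ∀ᶠ q' in 𝓝 q, s q'.2 =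
    Morita.chartPhase P.E q q' * (P.gauge idx hidx q')⁻¹) :
    (P.phaseSystem idx hidx).good (v₀ U q) (v₁ U q) s q.2 := by
  refine ⟨q.2.2, P.A.mem_base (v₀ U q), P.A.mem_base (v₁ U q), fun e he => ?_⟩
  refine ContinuousAt.congr he ?_
  filter_upwards [hs, Morita.base_mem_nhds P.E q] with q' hq' hb
  refine (Morita.chart_eq P.E hb (e q')).trans ?_
  refine Eq.trans ?_ (congrArg₂ (fun (c : Circle) T => (c : ℂ) • T) hq'
    (P.twist_apply idx hidx (v₀ U q) (v₁ U q) q' (e q'))).symm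
  exact (circle_smul_smul (inv_mul_cancel_right _ _) _).symm

end Desc
end

/-! ### The Morita isomorphism from the twisted Hilbert bundle to the descent datum -/

section

open Cech

section
variable {H K H' K' H'' K'' : Type*} [NormedAddCommGroup H] [InnerProductSpace ℂ H] [CompleteSpace H]
  [NormedAddCommGroup K] [InnerProductSpace ℂ K] [CompleteSpace K]
  [NormedAddCommGroup H'] [InnerProductSpace ℂ H'] [CompleteSpace H']
  [NormedAddCommGroup K'] [InnerProductSpace ℂ K'] [CompleteSpace K']
  [NormedAddCommGroup H''] [InnerProductSpace ℂ H''] [CompleteSpace H'']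
  [NormedAddCommGroup K''] [InnerProductSpace ℂ K''] [CompleteSpace K'']

theorem conjMap_smul_smul_smul (a b c : Circle) (u : K →L[ℂ] K') (w : H →L[ℂ] H')
    (u' : K' →L[ℂ] K'') (w' : H' →L[ℂ] H'') (T : H →L[ℂ] K) :
    conjMap ((a : ℂ) • u') ((b : ℂ) • w') ((c : ℂ) • conjMap u w T) =
      ((a * b⁻¹ * c : Circle) : ℂ) • conjMap (u' ∘L u) (w' ∘L w) T := by
  rw [map_smul, conjMap_smul_smul, conjMap_conjMap, smul_smul, Circle.coe_mul, Circle.coe_mul,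
    Circle.coe_inv_eq_conj, mul_comm (c : ℂ)]

theorem conjMap_smul_conjMap {u : K →L[ℂ] K'} {g : H' →L[ℂ] H''} {u₀ : K →L[ℂ] K}
    {w : H →L[ℂ] H'} {w' : H →L[ℂ] H''} {c n k : Circle}
    (hn : u₀ = (n : ℂ) • ContinuousLinearMap.id ℂ K) (hk : g ∘L w = (k : ℂ) • w') (T : H →L[ℂ] K) :
    conjMap u g ((c : ℂ) • conjMap u₀ w T) =
      ((c * (n * k⁻¹) : Circle) : ℂ) • conjMap u w' T := by
  rw [map_smul, conjMap_conjMap, hk, hn, ContinuousLinearMap.comp_smul, ContinuousLinearMap.comp_id,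
    conjMap_smul_smul, smul_smul, Circle.coe_mul, Circle.coe_mul, Circle.coe_inv_eq_conj]

theorem isUnitaryMap_id : IsUnitaryMap (ContinuousLinearMap.id ℂ H) := by
  constructor <;> simp [ContinuousLinearMap.adjoint_id]

theorem conjMap_id_id (T : H →L[ℂ] K) :
    conjMap (ContinuousLinearMap.id ℂ K) (ContinuousLinearMap.id ℂ H) T = T := by
  simp [conjMap_apply, ContinuousLinearMap.adjoint_id]

end

namespace Desc
variable {M : Type u} [TopologicalSpace M] {I : Type v} {U : I → Opens M} (P : Desc U)
  (idx : M → I) (hidx : ∀ x, x ∈ U (idx x))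
  (W : TwistedFrames (P.phaseSystem idx hidx) (pt idx hidx))

theorem exists_centre (p : Γ₀ U) : ∃ s : M → Circle, ∀ᶠ y in 𝓝 (p.2 : M),
    (P.phaseSystem idx hidx).good (pt idx hidx p.2) p s y :=
  (P.phaseSystem idx hidx).exists_good (P.mem_dom idx hidx (pt idx hidx p.2)) (P.mem_dom idx hidx p)

/-- Good scalars around a point of `Γ₀`, relative to the chosen point. -/
def centre (p : Γ₀ U) : M → Circle := (P.exists_centre idx hidx p).choose

/-- The domain of the charts of the descended Morita isomorphism. -/
def centreBase (p : Γ₀ U) : Set (Γ₀ U) :=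
  {r | r.1 = p.1} ∩ (P.A.base p ∩ (proj U ⁻¹' (W.base p.2 ∩
    interior {y | (P.phaseSystem idx hidx).good (pt idx hidx p.2) p (P.centre idx hidx p) y})))

theorem isOpen_centreBase (p : Γ₀ U) : IsOpen (P.centreBase idx hidx W p) := by
  refine IsOpen.inter (isOpen_iff_mem_nhds.2 fun r hr => ?_) ((P.A.isOpen_base p).inter
    (((W.isOpen_base _).inter isOpen_interior).preimage (proj U).continuous))
  exact (eventually_fst_eq r).mono fun r' hr' => hr'.trans hr

theorem mem_centreBase (p : Γ₀ U) : p ∈ P.centreBase idx hidx W p :=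
  ⟨rfl, P.A.mem_base p, W.mem_base _, mem_interior_iff_mem_nhds.2
    (P.exists_centre idx hidx p).choose_spec⟩

variable {P idx hidx W} in
theorem good_centre {p r : Γ₀ U} (h : r ∈ P.centreBase idx hidx W p) :
    (P.phaseSystem idx hidx).good (pt idx hidx p.2) p (P.centre idx hidx p) r.2 :=
  interior_subset (s := {y | (P.phaseSystem idx hidx).good (pt idx hidx p.2) p
    (P.centre idx hidx p) y}) h.2.2.2

/-- The compact operators from the twisted Hilbert bundle to the local Hilbert spaces of `A`. -/
def descMorita : Morita (W.bundle.pullback (proj U)) P.A where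
  fib r := CompactMap (W.hilb r.2) (P.A.hilb r)
  left r a := compactLeft (P.A.chart r r a)
  right _ b := compactRight b.1
  base := P.centreBase idx hidx W
  isOpen_base := P.isOpen_centreBase idx hidx W
  mem_base := P.mem_centreBase idx hidx W
  base_subset p r h := ⟨h.2.2.1, h.2.1⟩
  chart p r := conjChart (P.centre idx hidx p r.2) (P.A.implement p r) (W.frame p.2 r.2)
  isChart p r h := isModChart_conjChart (H' := SquareSum ℕ) (ψA := fun b : compactAlgebra _ => b.1) _
    (P.A.isUnitaryMap_implement h.2.1) (W.unitary h.2.2.1) (fun _ => rfl) (P.A.chart_eq h.2.1)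
  compat p p' f r hr hf := by
    -- The function s makes the change of frame of W strongly continuous, and s · centre p' / centre
    -- p does the same for the transition operators of A. In the conjugation s cancels, and centre p
    -- is replaced by centre p', as the charts demand.
    obtain ⟨s, hs⟩ := (P.phaseSystem idx hidx).exists_good (W.base_subset _ hr.1.2.2.1)
      (W.base_subset _ hr.2.2.2.1)
    have hs := hs.self_of_nhds
    have hg : (P.phaseSystem idx hidx).good p p' (fun y => P.centre idx hidx p' y *
        (s y * (P.centre idx hidx p y)⁻¹)) r.2 :=
      (P.phaseSystem idx hidx).trans ((P.phaseSystem idx hidx).trans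
        (PhaseSystem.symm (good_centre hr.1)) hs) (good_centre hr.2)
    have h1 := P.strongContAt_of_good idx hidx hr.1.1 hr.2.1 hg
    have h2 : StrongContAt (fun r' : Γ₀ U => (s r'.2 : ℂ) • (W.frame p'.2 r'.2 ∘L
        ContinuousLinearMap.adjoint (W.frame p.2 r'.2))) r := fun v =>
      (continuousAt_sigma_iff (q := r) (f := fun y => ((s y : ℂ) • (W.frame p'.2 y ∘L
        ContinuousLinearMap.adjoint (W.frame p.2 y))) v)).2
        (W.strongContAt hr.1.2.2.1 hr.2.2.2.1 hs v)
    have hf' : ContinuousAt (fun r' : Γ₀ U => (P.centre idx hidx p r'.2 : ℂ) •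
      conjMap (P.A.implement p r') (W.frame p.2 r'.2) (f r').1) r := hf
    have hev : ∀ᶠ r' in 𝓝 r, r' ∈ P.centreBase idx hidx W p ∧ r' ∈ P.centreBase idx hidx W p' :=
      Filter.inter_mem ((P.isOpen_centreBase idx hidx W p).mem_nhds hr.1)
        ((P.isOpen_centreBase idx hidx W p').mem_nhds hr.2)
    have h3 := h1.conjMap (hev.mono fun r' h => ((P.A.isUnitaryMap_transition h.1.2.1
        h.2.2.1).smul _).norm_le) h2 (hev.mono fun r' h => (((W.unitary h.2.2.2.1).comp
        (W.unitary h.1.2.2.1).symm).smul _).norm_le) hf'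
      ((isCompactOperator_conjMap _ _ (f r).2).smul _)
    refine h3.congr (hev.mono fun r' h => ?_)
    refine (conjMap_smul_smul_smul _ _ _ _ _ _ _ _).trans ?_
    refine congrArg₂ (fun (c : Circle) T => (c : ℂ) • T) ?_ (congrArg₂ (fun u w =>
      conjMap u w (f r').1) (P.A.transition_comp_implement h.1.2.1) ?_)
    · rw [mul_comm (s r'.2), ← mul_assoc, mul_inv_cancel_right, inv_mul_cancel_right]
    · have hu : IsUnitaryMap (W.frame p.2 r'.2) := W.unitary h.1.2.2.1
      rw [ContinuousLinearMap.comp_assoc, hu.adjoint_comp, ContinuousLinearMap.comp_id]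

/-- Separates the arbitrary phases by origin. The factor k comes from `implement` of the bundle over
M and is the same on all sheets, so it cancels between the ends of an edge; n depends on the point r
alone and can be absorbed into the scalars of α. -/
theorem exists_chartPhase_descMorita : ∃ (k : M → M → Circle) (n : Γ₀ U → Circle), ∀ p r,
    r ∈ P.centreBase idx hidx W p → (P.descMorita idx hidx W).chartPhase p r =
      P.centre idx hidx p r.2 * k p.2 r.2 * (n r)⁻¹ := by
  have hk : ∀ x y, ∃ c : Circle, y ∈ W.base x →
      (W.bundle.implement x y : SquareSum ℕ →L[ℂ] SquareSum ℕ) ∘L W.frame y y =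
        (c : ℂ) • W.frame x y := fun x y => by
    by_cases h : y ∈ W.base x
    · exact (W.exists_implement_comp_frame h).imp fun _ hc _ => hc
    · exact ⟨1, fun h' => (h h').elim⟩
  have hn : ∀ r, ∃ c : Circle, P.A.implement r r = (c : ℂ) • ContinuousLinearMap.id ℂ _ := fun r =>
    P.A.exists_implement_eq (P.A.mem_base r) isUnitaryMap_id fun a => (conjMap_id_id _).symm
  choose k hk using hk
  choose n hn using hn
  refine ⟨k, fun r => n r * P.centre idx hidx r r.2, fun p r h => ?_⟩
  obtain ⟨f, hf⟩ := (P.descMorita idx hidx W).exists_chart_ne_zero h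
  refine (P.descMorita idx hidx W).chartPhase_eq h hf ?_
  have h1 := conjMap_smul_conjMap (u := P.A.implement p r) (c := P.centre idx hidx r r.2) (hn r)
    (hk p.2 r.2 h.2.2.1) (show CompactMap (W.hilb r.2) (P.A.hilb r) from f).1
  refine Eq.trans ?_ (congrArg (fun T => ((P.centre idx hidx p r.2 * k p.2 r.2 *
    (n r * P.centre idx hidx r r.2)⁻¹ : Circle) : ℂ) • T) h1).symm
  refine (circle_smul_smul ?_ _).symm
  generalize P.centre idx hidx p r.2 = a
  generalize P.centre idx hidx r r.2 = b
  rw [mul_comm (n r) b, ← mul_assoc b, ← mul_assoc, inv_mul_cancel_right, mul_inv_cancel_right]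

end Desc
end

/-! ### Essential surjectivity on objects -/

section

open Cech

namespace Desc
variable {M : Type u} [TopologicalSpace M] {I : Type v} {U : I → Opens M} (P : Desc U)
  (idx : M → I) (hidx : ∀ x, x ∈ U (idx x))
  (W : TwistedFrames (P.phaseSystem idx hidx) (pt idx hidx))

/-- The descended Morita isomorphism, as a `1`-morphism. -/
def descF : (restrictObj U W.bundle).A ⟶ P.A := P.descMorita idx hidx W

open Classical in
-- After substituting the chart phases, k and n cancel. What remains is the quotient of centre (v₁
-- q) / centre (v₀ q) by chartPhase E / gauge; both are good from v₀ q to v₁ q, so the quotient is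
-- continuous by uniqueness.
theorem continuousAt_descAlpha {k : M → M → Circle} {n : Γ₀ U → Circle}
    (hkn : ∀ p r, r ∈ P.centreBase idx hidx W p → (P.descMorita idx hidx W).chartPhase p r =
      P.centre idx hidx p r.2 * k p.2 r.2 * (n r)⁻¹) (q : Γ₁ U) :
    ContinuousAt (fun q' => (P.gauge idx hidx q' * (n (v₁ U q') * (n (v₀ U q'))⁻¹)) *
      Morita.chartPhase ((restrictObj U W.bundle).E ≫
        DDBundle.pullbackHom (v₁ U) (P.descF idx hidx W)) q q' *
      (Morita.chartPhase (DDBundle.pullbackHom (v₀ U) (P.descF idx hidx W) ≫ P.E) q q')⁻¹) q := by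
  let s : M → Circle := fun y => if hy : y ∈ U q.1.1 ⊓ U q.1.2 then
    Morita.chartPhase P.E q ⟨q.1, y, hy⟩ * (P.gauge idx hidx ⟨q.1, y, hy⟩)⁻¹ else 1
  have hs : ∀ q' : Γ₁ U, q'.1 = q.1 →
      s q'.2 = Morita.chartPhase P.E q q' * (P.gauge idx hidx q')⁻¹ := by
    intro q' h
    obtain ⟨⟨i, j⟩, y⟩ := q
    obtain ⟨i', y'⟩ := q'
    obtain rfl : i' = (i, j) := h
    exact dif_pos y'.2
  have hg := P.good_chartPhase idx hidx q (s := s) ((eventually_fst_eq q).mono hs)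
  have hg₀ : (P.phaseSystem idx hidx).good (pt idx hidx q.2) (v₀ U q)
    (P.centre idx hidx (v₀ U q)) q.2 := good_centre (P.mem_centreBase idx hidx W (v₀ U q))
  have hg₁ : (P.phaseSystem idx hidx).good (pt idx hidx q.2) (v₁ U q)
    (P.centre idx hidx (v₁ U q)) q.2 := good_centre (P.mem_centreBase idx hidx W (v₁ U q))
  have hg' := (P.phaseSystem idx hidx).trans (PhaseSystem.symm hg₀) hg₁
  have hc := (continuousAt_sigma_iff (q := q)).2 ((P.phaseSystem idx hidx).unique hg hg')
  refine hc.congr ?_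
  have h₀ : ∀ᶠ q' in 𝓝 q, v₀ U q' ∈ P.centreBase idx hidx W (v₀ U q) :=
    (v₀ U).continuous.continuousAt ((P.isOpen_centreBase idx hidx W _).mem_nhds
      (P.mem_centreBase idx hidx W _))
  have h₁ : ∀ᶠ q' in 𝓝 q, v₁ U q' ∈ P.centreBase idx hidx W (v₁ U q) :=
    (v₁ U).continuous.continuousAt ((P.isOpen_centreBase idx hidx W _).mem_nhds
      (P.mem_centreBase idx hidx W _))
  filter_upwards [h₀, h₁, eventually_fst_eq q, Morita.base_mem_nhds P.E q] with q' h₀ h₁ h2 h3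
  have e1 : Morita.chartPhase ((restrictObj U W.bundle).E ≫
      DDBundle.pullbackHom (v₁ U) (P.descF idx hidx W)) q q' =
      (P.centre idx hidx (v₁ U q) q'.2 * k q.2 q'.2 * (n (v₁ U q'))⁻¹) * 1 :=
    (Morita.chartPhase_comp (Morita.id ((W.bundle.pullback (proj U)).pullback (v₀ U)))
      ((P.descMorita idx hidx W).pullback (v₁ U)) h₀.2.2.1 h₁).trans
      (congrArg₂ (· * ·) ((Morita.chartPhase_pullback (v₁ U) (P.descMorita idx hidx W) h₁).trans
        (hkn _ _ h₁)) (Morita.chartPhase_id h₀.2.2.1))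
  have e2 : Morita.chartPhase (DDBundle.pullbackHom (v₀ U) (P.descF idx hidx W) ≫ P.E) q q' =
      Morita.chartPhase P.E q q' *
        (P.centre idx hidx (v₀ U q) q'.2 * k q.2 q'.2 * (n (v₀ U q'))⁻¹) :=
    (Morita.chartPhase_comp ((P.descMorita idx hidx W).pullback (v₀ U)) P.E h₀ h3).trans
      (congrArg (Morita.chartPhase P.E q q' * ·)
        ((Morita.chartPhase_pullback (v₀ U) (P.descMorita idx hidx W) h₀).trans (hkn _ _ h₀)))
  rw [e1, e2, hs q' h2]
  generalize Morita.chartPhase P.E q q' = a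
  generalize P.gauge idx hidx q' = b
  generalize P.centre idx hidx (v₁ U q) q'.2 = c
  generalize P.centre idx hidx (v₀ U q) q'.2 = d
  generalize n (v₁ U q') = n₁
  generalize n (v₀ U q') = n₀
  generalize k q.2 q'.2 = k
  apply Circle.coe_injective
  simp only [Circle.coe_mul, Circle.coe_inv, Circle.coe_one]
  field_simp [Circle.coe_ne_zero]

/-- Every descent datum is the target of a `1`-morphism from a restriction. -/
theorem exists_hom [MetrizableSpace M] [SecondCountableTopology M] (hU : ⨆ i, U i = ⊤) :
    ∃ B : DDBundle M, Nonempty (Hom₁ (restrictObj U B) P) := by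
  choose idx hidx using exists_index hU
  obtain ⟨W⟩ := (P.phaseSystem idx hidx).nonempty_twistedFrames (pt idx hidx)
    fun x => P.mem_dom idx hidx (pt idx hidx x)
  obtain ⟨k, n, hkn⟩ := P.exists_chartPhase_descMorita idx hidx W
  refine ⟨W.bundle, ⟨⟨P.descF idx hidx W, DDBundle.homOfPhase _ _ _
    (P.continuousAt_descAlpha idx hidx W hkn), (sq_coh_iff _ _ _).2 fun z => ?_⟩⟩⟩
  -- In the cocycle identity the quotients of n telescope along the triangle, and the rest is the
  -- relation `gauge_mul` between τ and the gauge.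
  have hα : ∀ q, DDBundle.ph (DDBundle.homOfPhase _ _ _
      (P.continuousAt_descAlpha idx hidx W hkn)) q =
      ((P.gauge idx hidx q * (n (v₁ U q) * (n (v₀ U q))⁻¹) : Circle) : ℂ) :=
    DDBundle.ph_homOfPhase _ _ _ _
  have h1 := P.gauge_mul idx hidx z
  rw [ph_restrictObj, mul_one, ← DDBundle.coe_cph P.τ z]
  refine (congrArg₂ (· * ·) (hα _) (hα _)).trans
    (Eq.trans ?_ (congrArg ((DDBundle.cph P.τ z : ℂ) * ·) (hα _)).symm)
  rw [← Circle.coe_mul, ← Circle.coe_mul]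
  refine congrArg _ ?_
  change P.gauge idx hidx (e₀₁ U z) * (n (w₁ U z) * (n (w₀ U z))⁻¹) *
      (P.gauge idx hidx (e₁₂ U z) * (n (w₂ U z) * (n (w₁ U z))⁻¹)) =
    DDBundle.cph P.τ z * (P.gauge idx hidx (e₀₂ U z) * (n (w₂ U z) * (n (w₀ U z))⁻¹))
  rw [← mul_assoc (DDBundle.cph P.τ z), mul_comm (DDBundle.cph P.τ z), h1]
  generalize P.gauge idx hidx (e₀₁ U z) = a
  generalize P.gauge idx hidx (e₁₂ U z) = b
  apply Circle.coe_injective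
  simp only [Circle.coe_mul, Circle.coe_inv]
  field_simp [Circle.coe_ne_zero]

end Desc

/-- Any 1-arrow out of a restricted bundle is already an equivalence, so `exists_hom` settles the
objects. -/
theorem isBiequivalence_restriction {M : Type u} [TopologicalSpace M] [MetrizableSpace M]
    [SecondCountableTopology M] {I : Type v} (U : I → Opens M) (hU : ⨆ i, U i = ⊤) :
    IsBiequivalence (restriction U) := by
  refine ⟨restriction_mapFunctor_isEquivalence hU, fun P => ?_⟩
  obtain ⟨B, ⟨f⟩⟩ := P.exists_hom hU
  exact ⟨B, ⟨Desc.equivalence (P := restrictObj U B) (Q := P) f⟩⟩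
end

end DixmierDouady
end

theorem theoremt {n : ℕ} {M : Type u} [TopologicalSpace M]
    [ChartedSpace (EuclideanSpace ℝ (Fin n)) M] [IsManifold (𝓡 n) ∞ M]
    [T2Space M] [SecondCountableTopology M]
    {I : Type v} (U : I → TopologicalSpace.Opens M) (hU : ⨆ i, U i = ⊤) :
    DixmierDouady.IsBiequivalence (DixmierDouady.restriction U) := by
  -- Local compactness and the Hausdorff property give regularity, and Urysohn's theorem then makes
  -- M metrizable.
  have : LocallyCompactSpace M := ChartedSpace.locallyCompactSpace (EuclideanSpace ℝ (Fin n)) M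
  have : TopologicalSpace.MetrizableSpace M :=
    TopologicalSpace.metrizableSpace_of_t3_secondCountable M
  exact DixmierDouady.isBiequivalence_restriction U hU
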